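/- **Setting.** Let $G$ be a graph on $\{1,\dots,m\}$, $\Gamma\subset\{1,\dots,m\}$, $\mu_k\in\mathbb R^n_{\ge 0}$ ($k\in\Gamma$) probability vectors, and $\mathbf C(x)=\sum_{(k,l)\in E(G)}C^{(k,l)}(x_k,x_l)$ for $x\in\{1,\dots,n\}^m$. A plan is a tensor $\mathbf B\ge 0$ with one-mode projections $P_k(\mathbf B)=\mu_k$ for all $k\in\Gamma$; it is an $\varepsilon$-approximate solution if $\langle\mathbf C,\mathbf B\rangle\le\langle\mathbf C,\mathbf B'\rangle+\varepsilon$ for all plans $\mathbf B'$. Let $\mathcal T$ be a junction tree (tree decomposition) of $G$ of minimal width $w(G)$ (the width is the largest cluster size minus one, and $w(G)$ is the tree-width), whose leaves are exactly one cluster $\{k\}$ for each $k\in\Gamma$, where the unique neighbour $c_{\ell_k}$ of the leaf of $k$ contains $k$. Let $d(\mathcal T)$ be the diameter of $\mathcal T$, and let $\mathbf C(x)=\sum_c\mathbf C_c(x_c)$ be a splitting into cluster costs $\mathbf C_c\ge 0$, with $\mathbf C_c=0$ for leaves. Put $R_C^\Gamma=\max_{k\in\Gamma}R_C^k$, where $R_C^k=\max_x\sum_{c\in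 D_k}\mathbf C_c(x_c)$ and $D_k$ consists of $c_{\ell_k}$ and of all clusters whose cost $\mathbf C_c$ depends on $x_k$ (so $R_C^k=\|\mathbf C_{c_{\ell_k}}\|_\infty$ if no other cluster cost depends on $x_k$). **Algorithm.** Put $\eta=\varepsilon/(2m\log n)$ and $\varepsilon'=\varepsilon/(8R_C^\Gamma)$. For vectors $u=(u_k)_{k\in\Gamma}$ let $\mathbf B(u)(x)=e^{-\mathbf C(x)/\eta}\prod_{k\in\Gamma}u_k(x_k)\mu_k(x_k)$. The messages of belief propagation on $\mathcal T$ are $$m_{\ell\to k}(x_{c_\ell\cap c_k})=\sum_{x_{c_\ell\setminus c_k}}e^{-\mathbf C_{c_\ell}(x_{c_\ell})/\eta}\prod_{j\in N(\ell)\setminus k}m_{j\to\ell}(x_{c_j\cap c_\ell})$$ if $c_\ell$ is not a leaf, and $m_{\ell\to k}=u_\ell\odot\mu_\ell$ if $c_\ell$ is the leaf $\{\ell\}$. Start with $u_k=\mathbf 1$ for all $k$, compute all messages towards the leaf of some $k^{(0)}\in\Gamma$, and update $u_{k^{(0)}}$, where the update of $u_k$ is $u_k\leftarrow 1/m_{\ell_k\to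 k}$. While $\sum_{k\in\Gamma}\|P_k(\mathbf B(u))-\mu_k\|_1\ge\varepsilon'$: for $t=1,2,\dots$ pick $k^{(t)}$ uniformly at random in $\Gamma\setminus\{k^{(t-1)}\}$, given the past; recompute the messages along the path from the leaf of $k^{(t-1)}$ to the leaf of $k^{(t)}$; update $u_{k^{(t)}}$. On termination, compute the remaining messages and thereby the projections of $\widetilde{\mathbf B}=\mathbf B(u)$ on the clusters, and round these: for every $k\in\Gamma$ and every cluster $c\ni k$, scale the entries of the table of $c$ by $\min\{\mu_k(x_k)/P_k(\widetilde{\mathbf B})(x_k),1\}$, and put the lost mass back as the product of its projection on the coordinates of $c$ other than $k$ and the normalized vector $\mu_k-\min\{\mu_k,P_k(\widetilde{\mathbf B})\}$. The output is the resulting family of tables on the clusters. For each cluster, the product of its potential and of all its incoming messages is kept in memory; a message is computed by summing this product over the variables outside the separation set and dividing by the opposite message, and the product at the receiving cluster is corrected by the ratio of the new and the old message ($0/0=0$; a message is initially $\mathbf 1$). Let $T$ be the total number of arithmetic operations (additions, subtractions, multiplications, divisions, minima, exponentials) used for the potentials, the messages, the scaling vectors and the rounding; $\eta$, $\varepsilon'$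 and the evaluation of the stopping test are not charged. **Theorem.** There is a universal constant $c>0$ such that the following holds for all such data and all $\varepsilon>0$ with $\varepsilon^2\le m(R_C^\Gamma)^2\log n$. Almost surely the algorithm terminates and its output is the family of cluster projections of an $\varepsilon$-approximate solution. Moreover $$\mathbb E[T]\le c\,\frac{d(\mathcal T)\,m\,|\Gamma|^2\,n^{w(G)+1}(R_C^\Gamma)^2\log n}{\varepsilon^2},$$ and for all $\delta\in(0,\tfrac12)$ $$\mathbb P\!\left(T\le c\,\frac{d(\mathcal T)\,m\,|\Gamma|^2\,n^{w(G)+1}(R_C^\Gamma)^2\log n\,\log(1/\delta)}{\varepsilon^2}\right)\ge 1-\delta .$$ -/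

import Mathlib

open MeasureTheory
open scoped ENNReal

noncomputable section

/-! ## Graph-structured multi-marginal optimal transport -/

/-- An `m`-marginal optimal transport problem over a space of `n` points, with a cost that decouples
along the edges of a graph on the `m` modes and with marginals prescribed on the modes in `Γ`.
For an edge `{k, l}` with `k < l` the cost matrix is `pairCost k l`. -/
structure GraphMOT (m n : ℕ) where
  G : SimpleGraph (Fin m)
  pairCost : Fin m → Fin m → Fin n → Fin n → ℝ
  Γ : Finset (Fin m)
  μ : Γ → Fin n → ℝ
  μ_nonneg : ∀ k x, 0 ≤ μ k x
  μ_sum : ∀ k, ∑ x, μ k x = 1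

/-- Real tensors with one mode (of size `n`) for every element of `s`. -/
abbrev Table {m : ℕ} (n : ℕ) (s : Finset (Fin m)) : Type := (s → Fin n) → ℝ

/-- The projection of a full tensor on the modes in `s`. -/
def clusterMarginal {m n : ℕ} (B : (Fin m → Fin n) → ℝ) (s : Finset (Fin m)) : Table n s :=
  fun y => ∑ x with s.restrict x = y, B x

namespace GraphMOT

variable {m n : ℕ} (P : GraphMOT m n)

open scoped Classical in
/-- The cost tensor: the sum of the pair costs over the edges of the graph. -/
def cost (x : Fin m → Fin n) : ℝ :=
  ∑ k, ∑ l, if k < l ∧ P.G.Adj k l then P.pairCost k l (x k) (x l) else 0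

/-- The one-mode projection `P_k(B)`. -/
def marginal (B : (Fin m → Fin n) → ℝ) (k : Fin m) (a : Fin n) : ℝ :=
  ∑ x with x k = a, B x

/-- Feasible transport plans. -/
def IsPlan (B : (Fin m → Fin n) → ℝ) : Prop :=
  (∀ x, 0 ≤ B x) ∧ ∀ (k : P.Γ) a, marginal B k a = P.μ k a

/-- The total cost `⟨C, B⟩`. -/
def totalCost (B : (Fin m → Fin n) → ℝ) : ℝ := ∑ x, P.cost x * B x

/-- `B` is an `ε`-approximate solution of the transport problem. -/
def IsApproxSolution (ε : ℝ) (B : (Fin m → Fin n) → ℝ) : Prop :=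
  P.IsPlan B ∧ ∀ B', P.IsPlan B' → P.totalCost B ≤ P.totalCost B' + ε

/-- The tensor `B(Λ)` in the scaling variables `u_k = exp(λ_k / η)`. -/
def scaledTensor (η : ℝ) (u : P.Γ → Fin n → ℝ) (x : Fin m → Fin n) : ℝ :=
  Real.exp (-P.cost x / η) * ∏ k : P.Γ, (u k (x k) * P.μ k (x k))

/-- The residual `∑_{k ∈ Γ} ‖P_k(B(Λ)) - μ_k‖₁` of the stopping criterion. -/
def residual (η : ℝ) (u : P.Γ → Fin n → ℝ) : ℝ :=
  ∑ k : P.Γ, ∑ a, |marginal (P.scaledTensor η u) k a - P.μ k a|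

end GraphMOT

/-! ## Junction trees and tree-width -/

/-- A junction tree (tree decomposition) with `N` clusters of a graph. -/
structure JunctionTree {m : ℕ} (G : SimpleGraph (Fin m)) (N : ℕ) where
  tree : SimpleGraph (Fin N)
  isTree : tree.IsTree
  bag : Fin N → Finset (Fin m)
  cover : ∀ k, ∃ c, k ∈ bag c
  family_preservation : ∀ k l, G.Adj k l → ∃ c, k ∈ bag c ∧ l ∈ bag c
  running_intersection : ∀ (c c' : Fin N) (p : tree.Walk c c'), p.IsPath →
    ∀ b ∈ p.support, bag c ∩ bag c' ⊆ bag b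

namespace JunctionTree

variable {m N : ℕ} {G : SimpleGraph (Fin m)} (T : JunctionTree G N)

/-- The largest cluster size minus one. -/
def width : ℕ := (Finset.univ.sup fun c => (T.bag c).card) - 1

/-- The separation set of two clusters. -/
abbrev sep (c c' : Fin N) : Finset (Fin m) := T.bag c ∩ T.bag c'

/-- The path between two clusters. -/
def path (c c' : Fin N) : T.tree.Walk c c' := (T.isTree.existsUnique_path c c').choose

/-- The oriented edges of the path from `c` to `c'`, in order. -/
def pathSchedule (c c' : Fin N) : List (Fin N × Fin N) :=
  (T.path c c').darts.map fun e => e.toProd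

/-- The oriented edges leading from the clusters at distance `j + 1` from `r` one step towards
`r`. -/
def layer (r : Fin N) (j : ℕ) : List (Fin N × Fin N) :=
  ((List.finRange N).filter fun c => T.tree.dist c r = j + 1).map fun c => (c, (T.path c r).snd)

/-- All edges of the tree, oriented towards `r`, the outermost ones first. -/
def collectSchedule (r : Fin N) : List (Fin N × Fin N) :=
  (List.range N).reverse.flatMap (T.layer r)

/-- All edges of the tree, oriented away from `r`, the innermost ones first. -/
def distributeSchedule (r : Fin N) : List (Fin N × Fin N) :=
  (List.range N).flatMap fun j => (T.layer r j).map Prod.swap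

end JunctionTree

/-- The tree-width: the smallest width of a junction tree. -/
def treewidth {m : ℕ} (G : SimpleGraph (Fin m)) : ℕ :=
  sInf {w | ∃ (N : ℕ) (T : JunctionTree G N), T.width = w}

/-- The table `f` depends on the coordinate `k`. -/
def Table.DependsOn {m n : ℕ} {s : Finset (Fin m)} (f : Table n s) (k : Fin m) : Prop :=
  ∃ y y' : s → Fin n, (∀ i : s, (i : Fin m) ≠ k → y i = y' i) ∧ f y ≠ f y'

/-- A junction tree prepared for Sinkhorn belief propagation: its leaves are single-vertex clusters
that correspond to the elements of `Γ`, the separation set between the leaf of `k` and its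
neighbouring cluster is `{k}`, and the cost tensor is split into nonnegative cluster costs (the
leaves carry none, as no edge of the graph fits into them). -/
structure LeafSplitting {m n N : ℕ} (P : GraphMOT m n) (T : JunctionTree P.G N) where
  leaf : P.Γ → Fin N
  nbr : P.Γ → Fin N
  adj_nbr : ∀ k, T.tree.Adj (leaf k) (nbr k)
  isLeaf_iff : ∀ c, (∃! c', T.tree.Adj c c') ↔ ∃ k, leaf k = c
  bag_leaf : ∀ k, T.bag (leaf k) = {(k : Fin m)}
  mem_bag_nbr : ∀ k : P.Γ, (k : Fin m) ∈ T.bag (nbr k)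
  clusterCost : ∀ c, Table n (T.bag c)
  clusterCost_nonneg : ∀ c y, 0 ≤ clusterCost c y
  clusterCost_leaf : ∀ k y, clusterCost (leaf k) y = 0
  sum_clusterCost : ∀ x, ∑ c, clusterCost c ((T.bag c).restrict x) = P.cost x

/-! ## Computations that count their arithmetic operations -/

/-- A value together with the number of arithmetic operations used to compute it. -/
structure Counted (α : Type) where
  val : α
  ops : ℕ

namespace Counted

instance : Monad Counted where
  pure a := ⟨a, 0⟩
  bind x f := ⟨(f x.val).val, x.ops + (f x.val).ops⟩

/-- The elementary operations on real numbers; each of them costs one. -/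
def add (a b : ℝ) : Counted ℝ := ⟨a + b, 1⟩
def sub (a b : ℝ) : Counted ℝ := ⟨a - b, 1⟩
def mul (a b : ℝ) : Counted ℝ := ⟨a * b, 1⟩
/-- Division, with the convention `0 / 0 = 0` that is usual for tables with zero entries. -/
def div (a b : ℝ) : Counted ℝ := ⟨a / b, 1⟩
def neg (a : ℝ) : Counted ℝ := ⟨-a, 1⟩
def exp (a : ℝ) : Counted ℝ := ⟨Real.exp a, 1⟩
def min (a b : ℝ) : Counted ℝ := ⟨Min.min a b, 1⟩

/-- Fill a table entry by entry. -/
def tab {ι : Type} [Fintype ι] {α : ι → Type} (f : ∀ i, Counted (α i)) : Counted (∀ i, α i) :=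
  ⟨fun i => (f i).val, ∑ i, (f i).ops⟩

/-- Add up the entries of a table over a finite set, one addition for each entry. -/
def sum {ι : Type} (s : Finset ι) (f : ι → ℝ) : Counted ℝ := ⟨∑ i ∈ s, f i, s.card⟩

/-- Sum a table over `s` down to a table over `t ⊆ s`. -/
def project {m n : ℕ} {s t : Finset (Fin m)} (h : t ⊆ s) (f : Table n s) : Counted (Table n t) :=
  tab fun z => sum (Finset.univ.filter fun y => Finset.restrict₂ (π := fun _ => Fin n) h y = z) f

end Counted

/-! ## Sinkhorn belief propagation on a junction tree -/

/-- The memory of the algorithm: the scaling vectors `u k`, the messages `msg c c'` from `c` to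
`c'`, and for every cluster `c` the product `bel c` of its potential and of all messages that enter
it (so that a message update need not multiply the messages of all neighbours afresh). The potential
of `c` is `exp (-C_c / η)`, and `u_k μ_k` if `c` is the leaf of `k`. -/
structure BPState {m n N : ℕ} (P : GraphMOT m n) (T : JunctionTree P.G N) where
  u : P.Γ → Fin n → ℝ
  msg : ∀ c c', Table n (T.sep c c')
  bel : ∀ c, Table n (T.bag c)

namespace LeafSplitting

variable {m n N : ℕ} {P : GraphMOT m n} {T : JunctionTree P.G N} (S : LeafSplitting P T)

open scoped Classical in
/-- `R_C^k`: the largest entry of the cost of the cluster next to the leaf of `k`; if the costs of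
other clusters depend on `x_k` too, these are added to it. -/
def R_at (k : P.Γ) : ℝ :=
  ⨆ x : Fin m → Fin n,
    ∑ c with c = S.nbr k ∨ (S.clusterCost c).DependsOn k, S.clusterCost c ((T.bag c).restrict x)

/-- `R_C^Γ = max_{k ∈ Γ} R_C^k`. -/
def R : ℝ := ⨆ k : P.Γ, S.R_at k

/-- Reindexing between `sep c c'` and `sep c' c`. -/
def swapSep (T : JunctionTree P.G N) {c c' : Fin N} (z : T.sep c c' → Fin n) :
    T.sep c' c → Fin n :=
  Finset.restrict₂ (π := fun _ => Fin n) (Finset.inter_comm _ _).subset z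

open scoped Classical in
/-- The update of the message from `c` to `c'`: the sum, over the variables of `c` outside the
separation set, of the potential of `c` times the messages that enter `c` from the neighbours other
than `c'`. As the message from `c'` to `c` only depends on the separation set, it is divided out of
the sum of `bel c`. Afterwards the old message is replaced by the new one in `bel c'`. -/
def pass (T : JunctionTree P.G N) (s : BPState P T) (c c' : Fin N) : Counted (BPState P T) := do
  let total ← Counted.project (t := T.sep c c') Finset.inter_subset_left (s.bel c)
  let new ← Counted.tab fun z => Counted.div (total z) (s.msg c' c (swapSep T z))
  let ratio ← Counted.tab fun z => Counted.div (new z) (s.msg c c' z)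
  let bel' ← Counted.tab fun y => Counted.mul (s.bel c' y)
    (ratio (Finset.restrict₂ (π := fun _ => Fin n) Finset.inter_subset_right y))
  pure { s with
    msg := Function.update s.msg c (Function.update (s.msg c) c' new)
    bel := Function.update s.bel c' bel' }

/-- Successive message updates. -/
def passes (T : JunctionTree P.G N) (l : List (Fin N × Fin N)) (s : BPState P T) :
    Counted (BPState P T) :=
  l.foldlM (fun s e => pass T s e.1 e.2) s

/-- The message that the leaf of `k` receives, as a vector. -/
def incoming (s : BPState P T) (k : P.Γ) (a : Fin n) : ℝ :=
  s.msg (S.nbr k) (S.leaf k) fun _ => a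

/-- Recompute `bel` at the leaf of `k`, whose potential is `u_k μ_k`. -/
def refreshLeaf (s : BPState P T) (k : P.Γ) : Counted (BPState P T) := do
  let v ← Counted.tab fun a => do
    let w ← Counted.mul (s.u k a) (P.μ k a)
    Counted.mul w (S.incoming s k a)
  pure { s with
    bel := Function.update s.bel (S.leaf k) fun y =>
      v (y ⟨k, by rw [S.bag_leaf]; exact Finset.mem_singleton_self _⟩) }

/-- The Sinkhorn update of the scaling vector `u_k`. -/
def scale (s : BPState P T) (k : P.Γ) : Counted (BPState P T) := do
  let v ← Counted.tab fun a => Counted.div 1 (S.incoming s k a)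
  S.refreshLeaf { s with u := Function.update s.u k v } k

/-- Initialization: all scaling vectors are equal to one, the messages towards the leaf of `k`
are computed (starting from messages equal to one), and the scaling vector of `k` is updated. -/
def init (η : ℝ) (k : P.Γ) : Counted (BPState P T) := do
  let K ← Counted.tab fun c => Counted.tab fun y => do
    let a ← Counted.div (S.clusterCost c y) η
    let b ← Counted.neg a
    Counted.exp b
  let s₀ : BPState P T := { u := fun _ _ => 1, msg := fun _ _ _ => 1, bel := K }
  let s₁ ← (Finset.univ : Finset P.Γ).toList.foldlM S.refreshLeaf s₀
  let s₂ ← passes T (T.collectSchedule (S.leaf k)) s₁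
  S.scale s₂ k

/-- One iteration, which updates `u_k'` after an update of `u_k`: only the messages on the path
between the two leaves are recomputed. -/
def step (k k' : P.Γ) (s : BPState P T) : Counted (BPState P T) := do
  let s' ← passes T (T.pathSchedule (S.leaf k) (S.leaf k')) s
  S.scale s' k'

/-- The state after `t` iterations, if `κ 0` is the index of the initialization and `κ (i + 1)` is
the index that is picked in iteration `i + 1`. -/
def run (η : ℝ) (κ : ℕ → P.Γ) : ℕ → Counted (BPState P T)
  | 0 => S.init η (κ 0)
  | t + 1 => do
    let s ← run η κ t
    S.step (κ t) (κ (t + 1)) s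

/-! ### Rounding -/

/-- Rounding of a table `F` in the coordinate `k`, as in the rounding of matrices: the entries are
scaled by `keep`, and the lost mass is put back as a product with the vector `dir`, so that the
projection on the other coordinates does not change. -/
def roundCoordinate {s : Finset (Fin m)} (k : Fin m) (hk : k ∈ s) (keep dir : Fin n → ℝ)
    (F : Table n s) : Counted (Table n s) := do
  let kept ← Counted.tab fun y => Counted.mul (F y) (keep (y ⟨k, hk⟩))
  let lost ← Counted.tab fun y => Counted.sub (F y) (kept y)
  let rest ← Counted.project (t := s.erase k) (Finset.erase_subset k s) lost
  Counted.tab fun y => do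
    let w ← Counted.mul
      (rest (Finset.restrict₂ (π := fun _ => Fin n) (Finset.erase_subset k s) y))
      (dir (y ⟨k, hk⟩))
    Counted.add (kept y) w

/-- Rounding of the cluster marginals `bel c`, in every coordinate `k ∈ Γ`, to cluster marginals of
a tensor with the prescribed marginals `μ_k`. -/
def round (s : BPState P T) : Counted (∀ c, Table n (T.bag c)) := do
  let keep ← Counted.tab fun k : P.Γ => Counted.tab fun a => do
    let q ← Counted.div (P.μ k a) (s.bel (S.leaf k) fun _ => a)
    Counted.min q 1
  let err ← Counted.tab fun k : P.Γ => Counted.tab fun a => do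
    let w ← Counted.mul (keep k a) (s.bel (S.leaf k) fun _ => a)
    Counted.sub (P.μ k a) w
  let mass ← Counted.tab fun k : P.Γ => Counted.sum Finset.univ (err k)
  let dir ← Counted.tab fun k : P.Γ => Counted.tab fun a => Counted.div (err k a) (mass k)
  Counted.tab fun c => (Finset.univ : Finset P.Γ).toList.foldlM
    (fun F (k : P.Γ) => if hk : (k : Fin m) ∈ T.bag c
      then roundCoordinate (k : Fin m) hk (keep k) (dir k) F else pure F)
    (s.bel c)

/-! ### The full method -/

/-- The regularization parameter. -/
def eta (_ : LeafSplitting P T) (ε : ℝ) : ℝ := ε / (2 * m * Real.log n)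

/-- The tolerance of the stopping criterion. -/
def tol (ε : ℝ) : ℝ := ε / (8 * S.R)

/-- The stopping criterion holds after `t` iterations. -/
def Converged (ε : ℝ) (κ : ℕ → P.Γ) (t : ℕ) : Prop :=
  P.residual (S.eta ε) (S.run (S.eta ε) κ t).val.u < S.tol ε

/-- The complete computation with `t` iterations: after the last one, the messages away from the
leaf updated last are computed, and the resulting cluster marginals are rounded. -/
def computation (ε : ℝ) (κ : ℕ → P.Γ) (t : ℕ) : Counted (∀ c, Table n (T.bag c)) := do
  let s ← S.run (S.eta ε) κ t
  let s' ← passes T (T.distributeSchedule (S.leaf (κ t))) s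
  S.round s'

open scoped Classical in
/-- The output of the method, if it terminates: it stops as soon as the stopping criterion holds. -/
def output (ε : ℝ) (κ : ℕ → P.Γ) : Option (∀ c, Table n (T.bag c)) :=
  if h : ∃ t, S.Converged ε κ t then some (S.computation ε κ (Nat.find h)).val else none

open scoped Classical in
/-- The number of arithmetic operations of the method, infinite if it does not terminate. All
operations on potentials, messages, scaling vectors and in the rounding are counted; the stopping
criterion is a test on the current iterate and is not charged. -/
def operations (ε : ℝ) (κ : ℕ → P.Γ) : ℝ≥0∞ :=
  if h : ∃ t, S.Converged ε κ t then ((S.computation ε κ (Nat.find h)).ops : ℝ≥0∞) else ⊤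

/-- The output consists of the cluster marginals of an `ε`-approximate solution. -/
def Finds (ε : ℝ) (κ : ℕ → P.Γ) : Prop :=
  ∃ b B, S.output ε κ = some b ∧ P.IsApproxSolution ε B ∧ ∀ c, clusterMarginal B (T.bag c) = b c

end LeafSplitting

/-- The law of the picked indices: given the past, the next index is uniformly distributed on
`Γ` without the previous index. -/
structure IsRandomPick {Ω : Type*} [MeasurableSpace Ω] (ℙ : Measure Ω) {m : ℕ} {Γ : Finset (Fin m)}
    (κ : ℕ → Ω → Γ) : Prop where
  measurable : ∀ t k, MeasurableSet {ω | κ t ω = k}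
  law : ∀ (t : ℕ) (j : ℕ → Γ), ℙ {ω | ∀ i ≤ t + 1, κ i ω = j i} =
    ℙ {ω | ∀ i ≤ t, κ i ω = j i} * if j (t + 1) = j t then 0 else ((Γ.card - 1 : ℕ) : ℝ≥0∞)⁻¹

end

/-!
The beliefs and messages of junction tree propagation satisfy three invariants, collected in
`LeafSplitting.Consistent`: every belief is the product of its potential and its incoming
messages; where a message vanishes, the beliefs at both ends of its edge vanish; and the entries
at configurations carrying mass of all prescribed marginals are positive. The second invariant is
what makes the divisions with `0 / 0 = 0` harmless. A message is up to date (`BPState.Updated`) if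
the product of the two messages on its edge is the marginal of the belief at its source. Updating
a message outdates only messages that leave its target in another direction. Hence recomputing the
messages along a path moves the cluster at which everything is collected
(`Consistent.collectedAt_walk`), and at such a cluster the belief is a marginal of the full tensor
(`Consistent.sumOut_scaledTensor`). So each iteration is an exact Sinkhorn update of one scaling
vector, `GraphMOT.IsSinkhornUpdate`.

The number of iterations is controlled by the gap of the dual objective. The oscillation of the
logarithm of a scaling vector is at most `R / η`, because it is a reciprocal of a sum of
exponentials of costs; by concavity, the gap is at most `2 R / η` times the residual
(`GraphMOT.gap_le`). An update of `u_k` decreases the gap by the relative entropy of the marginal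
`k`, thus by a quarter of the squared error of this marginal (`IsSinkhornUpdate.le_dual`). In
expectation over a uniformly random choice, the decrease is quadratic in the residual, hence in `G
+ G₀`, where `G` is the gap and `G₀` is `2 R / η` times the tolerance. Therefore the bounded
concave function `G / (G + G₀)` decreases in mean by a constant in each step
(`LeafSplitting.lyapunov_step`), which gives an exponential tail for the number of iterations with
a mean of order `|Γ|² R / (η ε')`, that is, `|Γ|² m R² log n / ε²`.

An iteration costs at most a constant times the diameter times `n ^ (w + 1)`. The number of
clusters is at most `|Γ|` times the diameter plus one, since every cluster lies on a path between
a leaf and a fixed leaf; this bounds the cost of the initialization and of the rounding.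

Rounding commutes with projections to clusters (`LeafSplitting.round_val`), and it changes the
cost by at most `R` times the residual. The tensor of a scaling minimizes the entropic objective
among the tensors with the same marginals, so that it is compared with an arbitrary plan by
rounding that plan to these marginals (`GraphMOT.isApproxSolution_round`).
-/

/-! ### Summing out coordinates of tensors -/

section SumOut

variable {m n : ℕ}

/-- The tensor `f` summed over the coordinates in `s`. The result is kept as a function of all
coordinates, so that tensors and tables of all shapes can be multiplied with each other. -/
noncomputable def sumOut (s : Finset (Fin m)) (f : (Fin m → Fin n) → ℝ) (x : Fin m → Fin n) : ℝ :=
  ∑ x' with ∀ i, i ∉ s → x' i = x i, f x'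

lemma sumOut_congr {s : Finset (Fin m)} {f g : (Fin m → Fin n) → ℝ} {x : Fin m → Fin n}
    (h : ∀ x', (∀ i, i ∉ s → x' i = x i) → f x' = g x') : sumOut s f x = sumOut s g x :=
  Finset.sum_congr rfl fun x' hx' => h x' (by simpa using hx')

lemma sumOut_empty (f : (Fin m → Fin n) → ℝ) : sumOut ∅ f = f := by
  funext x
  have : (Finset.univ.filter fun x' : Fin m → Fin n => ∀ i, i ∉ (∅ : Finset (Fin m)) → x' i = x i)
      = {x} := by
    ext x'
    simp [funext_iff]
  rw [sumOut, this, Finset.sum_singleton]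

lemma sumOut_mul_left {s : Finset (Fin m)} {h f : (Fin m → Fin n) → ℝ} {x : Fin m → Fin n}
    (hh : ∀ x', (∀ i, i ∉ s → x' i = x i) → h x' = h x) :
    sumOut s (fun x => h x * f x) x = h x * sumOut s f x := by
  rw [sumOut, sumOut, Finset.mul_sum]
  exact Finset.sum_congr rfl fun x' hx' => by rw [hh x' (by simpa using hx')]

lemma sumOut_add (s : Finset (Fin m)) (f g : (Fin m → Fin n) → ℝ) (x : Fin m → Fin n) :
    sumOut s (fun x => f x + g x) x = sumOut s f x + sumOut s g x :=
  Finset.sum_add_distrib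

lemma sumOut_sub (s : Finset (Fin m)) (f g : (Fin m → Fin n) → ℝ) (x : Fin m → Fin n) :
    sumOut s (fun x => f x - g x) x = sumOut s f x - sumOut s g x :=
  Finset.sum_sub_distrib _ _

lemma sumOut_nonneg {s : Finset (Fin m)} {f : (Fin m → Fin n) → ℝ} (hf : ∀ x, 0 ≤ f x)
    (x : Fin m → Fin n) : 0 ≤ sumOut s f x :=
  Finset.sum_nonneg fun _ _ => hf _

lemma le_sumOut {s : Finset (Fin m)} {f : (Fin m → Fin n) → ℝ} (hf : ∀ x, 0 ≤ f x)
    (x : Fin m → Fin n) : f x ≤ sumOut s f x :=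
  Finset.single_le_sum (f := f) (fun _ _ => hf _) (by simp)

/-- A sum over coordinates does not depend on these coordinates. -/
lemma sumOut_eq_of_agree {s : Finset (Fin m)} (f : (Fin m → Fin n) → ℝ) {x x' : Fin m → Fin n}
    (h : ∀ i, i ∉ s → x i = x' i) : sumOut s f x = sumOut s f x' := by
  unfold sumOut
  congr 1
  ext y
  simp only [Finset.mem_filter, Finset.mem_univ, true_and]
  exact forall_congr' fun i => forall_congr' fun hi => by rw [h i hi]

lemma sumOut_dependsOn {s t : Finset (Fin m)} {f : (Fin m → Fin n) → ℝ}
    (hf : DependsOn f (t : Set (Fin m))) :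
    DependsOn (sumOut s f) ((t \ s : Finset (Fin m)) : Set (Fin m)) := by
  intro x x' h
  classical
  refine Finset.sum_nbij' (fun y i => if i ∈ s then y i else x' i)
    (fun y i => if i ∈ s then y i else x i) ?_ ?_ ?_ ?_ ?_
  · intro y _; simp +contextual
  · intro y _; simp +contextual
  · intro y hy
    simp only [Finset.mem_filter, Finset.mem_univ, true_and] at hy
    funext i
    by_cases hi : i ∈ s <;> simp [hi]
    exact (hy i hi).symm
  · intro y hy
    simp only [Finset.mem_filter, Finset.mem_univ, true_and] at hy
    funext i
    by_cases hi : i ∈ s <;> simp [hi]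
    exact (hy i hi).symm
  · intro y hy
    simp only [Finset.mem_filter, Finset.mem_univ, true_and] at hy
    refine hf fun i hi => ?_
    by_cases his : i ∈ s
    · simp [his]
    · simp only [his, if_false]
      rw [hy i his]
      exact h i (by simpa using ⟨hi, his⟩)

lemma sumOut_sumOut {s t : Finset (Fin m)} (hst : Disjoint s t) (f : (Fin m → Fin n) → ℝ) :
    sumOut s (sumOut t f) = sumOut (s ∪ t) f := by
  classical
  funext x
  unfold sumOut
  rw [Finset.sum_sigma']
  refine Finset.sum_nbij' (fun p => p.2)
    (fun y => ⟨fun i => if i ∈ s then y i else x i, y⟩) ?_ ?_ ?_ ?_ ?_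
  · rintro ⟨y, z⟩ h
    simp only [Finset.mem_sigma, Finset.mem_filter, Finset.mem_univ, true_and] at h ⊢
    intro i hi
    simp only [Finset.mem_union, not_or] at hi
    rw [h.2 i hi.2, h.1 i hi.1]
  · intro y h
    simp only [Finset.mem_sigma, Finset.mem_filter, Finset.mem_univ, true_and,
      Finset.mem_union, not_or] at h ⊢
    refine ⟨by simp +contextual, fun i hi => ?_⟩
    by_cases his : i ∈ s
    · simp [his]
    · simpa [his] using h i ⟨his, hi⟩
  · rintro ⟨y, z⟩ h
    simp only [Finset.mem_sigma, Finset.mem_filter, Finset.mem_univ, true_and] at h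
    simp only [Sigma.mk.injEq, heq_eq_eq, and_true]
    funext i
    by_cases his : i ∈ s
    · simp only [his, if_true]
      exact h.2 i (Finset.disjoint_left.1 hst his)
    · simpa [his] using (h.1 i his).symm
  · intro y _; rfl
  · intro y _; rfl

/-- Summing out coordinates is a self-adjoint operation. -/
lemma sum_mul_sumOut (s : Finset (Fin m)) (f g : (Fin m → Fin n) → ℝ) :
    ∑ x, f x * sumOut s g x = ∑ x, g x * sumOut s f x := by
  simp only [sumOut, Finset.mul_sum, Finset.sum_filter]
  rw [Finset.sum_comm]
  refine Finset.sum_congr rfl fun x _ => Finset.sum_congr rfl fun y _ => ?_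
  have : (∀ i, i ∉ s → x i = y i) ↔ ∀ i, i ∉ s → y i = x i :=
    forall_congr' fun i => forall_congr' fun _ => eq_comm
  simp only [this]
  split_ifs <;> ring

lemma sumOut_singleton (k : Fin m) (f : (Fin m → Fin n) → ℝ) (x : Fin m → Fin n) :
    sumOut {k} f x = ∑ b, f (Function.update x k b) := by
  classical
  refine Finset.sum_nbij' (fun y => y k) (fun b => Function.update x k b) ?_ ?_ ?_ ?_ ?_
  · simp
  · intro b _
    simp only [Finset.mem_filter, Finset.mem_univ, true_and, Finset.mem_singleton]
    intro i hi
    rw [Function.update_of_ne hi]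
  · intro y hy
    simp only [Finset.mem_filter, Finset.mem_univ, true_and, Finset.mem_singleton] at hy
    funext i
    by_cases hi : i = k
    · subst hi; simp
    · rw [Function.update_of_ne hi, hy i hi]
  · simp
  · intro y hy
    simp only [Finset.mem_filter, Finset.mem_univ, true_and, Finset.mem_singleton] at hy
    congr 1
    funext i
    by_cases hi : i = k
    · subst hi; simp
    · rw [Function.update_of_ne hi, hy i hi]

lemma restrict_eq_restrict_iff {s : Finset (Fin m)} {x x' : Fin m → Fin n} :
    s.restrict x = s.restrict x' ↔ ∀ i ∈ s, x i = x' i := by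
  simp [funext_iff]

lemma restrict_surjective [NeZero n] (s : Finset (Fin m)) (y : s → Fin n) :
    ∃ x : Fin m → Fin n, s.restrict x = y :=
  ⟨fun i => if h : i ∈ s then y ⟨i, h⟩ else 0, by funext i; simp⟩

lemma clusterMarginal_restrict (B : (Fin m → Fin n) → ℝ) (s : Finset (Fin m)) (x : Fin m → Fin n) :
    clusterMarginal B s (s.restrict x) = sumOut sᶜ B x := by
  unfold clusterMarginal sumOut
  congr 1
  ext y
  simp [funext_iff]

lemma marginal_apply_eq_sumOut (B : (Fin m → Fin n) → ℝ) (k : Fin m) (x : Fin m → Fin n) :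
    GraphMOT.marginal B k (x k) = sumOut {k}ᶜ B x := by
  unfold GraphMOT.marginal sumOut
  congr 1
  ext y
  simp

/-- `Counted.project` sums out the coordinates of `s` that are not in `t`. -/
lemma project_val_restrict {s t : Finset (Fin m)} (h : t ⊆ s) (f : Table n s)
    (x : Fin m → Fin n) :
    (Counted.project h f).val (t.restrict x) = sumOut (s \ t) (fun x => f (s.restrict x)) x := by
  classical
  change ∑ y with Finset.restrict₂ (π := fun _ => Fin n) h y = t.restrict x, f y = _
  refine Finset.sum_nbij' (fun y i => if hi : i ∈ s then y ⟨i, hi⟩ else x i)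
    (fun x => s.restrict x) ?_ ?_ ?_ ?_ ?_
  · intro y hy
    simp only [Finset.mem_filter, Finset.mem_univ, true_and] at hy ⊢
    intro i hi
    by_cases his : i ∈ s
    · have hit : i ∈ t := by by_contra hit; exact hi (by simp [his, hit])
      simpa [his] using congrFun hy ⟨i, hit⟩
    · simp [his]
  · intro y hy
    simp only [Finset.mem_filter, Finset.mem_univ, true_and] at hy ⊢
    funext i
    exact hy i (by simp [i.2])
  · intro y _
    funext i
    simp
  · intro y hy
    simp only [Finset.mem_filter, Finset.mem_univ, true_and] at hy
    funext i
    by_cases his : i ∈ s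
    · simp [his]
    · simpa [his] using (hy i (by simp [his])).symm
  · intro y _
    congr 1
    funext i
    simp

lemma project_ops {s t : Finset (Fin m)} (h : t ⊆ s) (f : Table n s) :
    (Counted.project h f).ops = n ^ s.card := by
  classical
  change ∑ z, (Finset.univ.filter fun y : s → Fin n =>
    Finset.restrict₂ (π := fun _ => Fin n) h y = z).card = _
  rw [Finset.sum_card_fiberwise_eq_card_filter]
  simp

lemma sum_marginal_mul (B : (Fin m → Fin n) → ℝ) (k : Fin m) (f : Fin n → ℝ) :
    ∑ a, GraphMOT.marginal B k a * f a = ∑ x, B x * f (x k) := by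
  classical
  simp only [GraphMOT.marginal, Finset.sum_mul]
  rw [← Finset.sum_fiberwise Finset.univ (fun x : Fin m → Fin n => x k)]
  refine Finset.sum_congr rfl fun a _ => Finset.sum_congr rfl fun x hx => ?_
  rw [(Finset.mem_filter.1 hx).2]

lemma sum_marginal (B : (Fin m → Fin n) → ℝ) (k : Fin m) :
    ∑ a, GraphMOT.marginal B k a = ∑ x, B x := by
  simpa using sum_marginal_mul B k fun _ => 1

lemma marginal_nonneg {B : (Fin m → Fin n) → ℝ} (hB : ∀ x, 0 ≤ B x) (k : Fin m) (a : Fin n) :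
    0 ≤ GraphMOT.marginal B k a :=
  Finset.sum_nonneg fun _ _ => hB _

lemma le_marginal {B : (Fin m → Fin n) → ℝ} (hB : ∀ x, 0 ≤ B x) (k : Fin m) (x : Fin m → Fin n) :
    B x ≤ GraphMOT.marginal B k (x k) :=
  Finset.single_le_sum (f := B) (fun _ _ => hB _) (by simp)

end SumOut

/-! ### The invariants of belief propagation -/

section Messages

variable {m n N : ℕ} {P : GraphMOT m n} {T : JunctionTree P.G N}

namespace BPState

/-- The belief of the cluster `c` as a function of all coordinates. -/
def gbel (s : BPState P T) (c : Fin N) (x : Fin m → Fin n) : ℝ := s.bel c ((T.bag c).restrict x)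

/-- The message from `c` to `e` as a function of all coordinates. -/
def gmsg (s : BPState P T) (c e : Fin N) (x : Fin m → Fin n) : ℝ :=
  s.msg c e ((T.sep c e).restrict x)

lemma gbel_dependsOn (s : BPState P T) (c : Fin N) :
    DependsOn (s.gbel c) (T.bag c : Set (Fin m)) := by
  intro x y h
  unfold gbel
  rw [restrict_eq_restrict_iff.2 fun i hi => h i hi]

lemma gmsg_congr (s : BPState P T) {c e : Fin N} {x y : Fin m → Fin n}
    (h : ∀ i, i ∈ T.bag c → i ∈ T.bag e → x i = y i) : s.gmsg c e x = s.gmsg c e y := by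
  unfold gmsg
  rw [restrict_eq_restrict_iff.2 fun i hi =>
    h i (Finset.mem_inter.1 hi).1 (Finset.mem_inter.1 hi).2]

/-- The updated message from `c` to `e`. -/
noncomputable def newMsg (s : BPState P T) (c e : Fin N) (x : Fin m → Fin n) : ℝ :=
  sumOut (T.bag c \ T.bag e) (s.gbel c) x / s.gmsg e c x

/-- The message from `c` to `e` is up to date. In this form the property is not affected by an
update of the opposite message. -/
def Updated (s : BPState P T) (c e : Fin N) : Prop :=
  ∀ x, sumOut (T.bag c \ T.bag e) (s.gbel c) x = s.gmsg c e x * s.gmsg e c x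

end BPState

/-- The coordinates of `x` carry mass of all prescribed marginals. -/
def GraphMOT.Valid (P : GraphMOT m n) (x : Fin m → Fin n) : Prop := ∀ k : P.Γ, P.μ k (x k) ≠ 0

lemma GraphMOT.exists_mu_ne_zero (P : GraphMOT m n) (k : P.Γ) : ∃ a, P.μ k a ≠ 0 := by
  by_contra! h
  simpa [h] using P.μ_sum k

lemma GraphMOT.exists_valid [NeZero n] (P : GraphMOT m n) : ∃ x, P.Valid x := by
  choose f hf using P.exists_mu_ne_zero
  exact ⟨fun i => if h : i ∈ P.Γ then f ⟨i, h⟩ else 0, fun k => by simpa using hf k⟩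

lemma GraphMOT.Valid.update {P : GraphMOT m n} {x : Fin m → Fin n} (hx : P.Valid x) {k : P.Γ}
    {a : Fin n} (ha : P.μ k a ≠ 0) : P.Valid (Function.update x k a) := by
  intro j
  by_cases hj : j = k
  · subst hj; simpa using ha
  · rw [Function.update_of_ne (fun h => hj (Subtype.ext h))]
    exact hx j

namespace LeafSplitting

lemma pass_u (s : BPState P T) (c e : Fin N) : (pass T s c e).val.u = s.u := rfl

lemma pass_ratio_restrict (s : BPState P T) (c e : Fin N) (x : Fin m → Fin n) :
    (Counted.project (t := T.sep c e) Finset.inter_subset_left (s.bel c)).val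
      ((T.sep c e).restrict x) / s.msg e c (swapSep T ((T.sep c e).restrict x)) =
    s.newMsg c e x := by
  rw [project_val_restrict, Finset.sdiff_inter_self_left]
  rfl

lemma pass_gmsg_self (s : BPState P T) (c e : Fin N) :
    (pass T s c e).val.gmsg c e = s.newMsg c e := by
  funext x
  rw [← pass_ratio_restrict]
  change (Function.update s.msg c (Function.update (s.msg c) e _)) c e ((T.sep c e).restrict x) = _
  rw [Function.update_self, Function.update_self]
  rfl

lemma pass_gmsg_of_ne (s : BPState P T) {c e a b : Fin N} (h : ¬ (a = c ∧ b = e)) :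
    (pass T s c e).val.gmsg a b = s.gmsg a b := by
  funext x
  change (Function.update s.msg c (Function.update (s.msg c) e _)) a b ((T.sep a b).restrict x) = _
  by_cases ha : a = c
  · subst ha
    rw [Function.update_self, Function.update_of_ne fun hb => h ⟨rfl, hb⟩]
    rfl
  · rw [Function.update_of_ne ha]
    rfl

lemma pass_gbel_self (s : BPState P T) (c e : Fin N) (x : Fin m → Fin n) :
    (pass T s c e).val.gbel e x = s.gbel e x * (s.newMsg c e x / s.gmsg c e x) := by
  rw [← pass_ratio_restrict]
  change (Function.update s.bel e _) e ((T.bag e).restrict x) = _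
  rw [Function.update_self]
  rfl

lemma pass_gbel_of_ne (s : BPState P T) {c e b : Fin N} (h : b ≠ e) :
    (pass T s c e).val.gbel b = s.gbel b := by
  funext x
  change (Function.update s.bel e _) b ((T.bag b).restrict x) = _
  rw [Function.update_of_ne h]
  rfl

variable (S : LeafSplitting P T)

open scoped Classical in
/-- The potential of the cluster `c` as a function of all coordinates. -/
noncomputable def pot (η : ℝ) (u : P.Γ → Fin n → ℝ) (c : Fin N) (x : Fin m → Fin n) : ℝ :=
  Real.exp (-S.clusterCost c ((T.bag c).restrict x) / η) *
    ∏ k : P.Γ with S.leaf k = c, (u k (x k) * P.μ k (x k))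

lemma leaf_injective : Function.Injective S.leaf := by
  intro k l h
  have h' := S.bag_leaf k
  rw [h, S.bag_leaf l] at h'
  exact Subtype.ext (Finset.singleton_injective h').symm

lemma adj_leaf_iff {k : P.Γ} {e : Fin N} : T.tree.Adj (S.leaf k) e ↔ e = S.nbr k := by
  constructor
  · intro h
    exact ((S.isLeaf_iff (S.leaf k)).2 ⟨k, rfl⟩).unique h (S.adj_nbr k)
  · rintro rfl
    exact S.adj_nbr k

lemma prod_pot (η : ℝ) (u : P.Γ → Fin n → ℝ) (x : Fin m → Fin n) :
    ∏ c, S.pot η u c x = P.scaledTensor η u x := by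
  classical
  unfold pot GraphMOT.scaledTensor
  rw [Finset.prod_mul_distrib, ← Real.exp_sum, ← Finset.sum_div, Finset.sum_neg_distrib,
    S.sum_clusterCost]
  congr 1
  exact Finset.prod_fiberwise Finset.univ S.leaf fun k : P.Γ => u k (x k) * P.μ k (x k)

lemma pot_leaf (η : ℝ) (u : P.Γ → Fin n → ℝ) (k : P.Γ) (x : Fin m → Fin n) :
    S.pot η u (S.leaf k) x = u k (x k) * P.μ k (x k) := by
  classical
  unfold pot
  have : (Finset.univ.filter fun l : P.Γ => S.leaf l = S.leaf k) = {k} := by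
    ext l
    simp [S.leaf_injective.eq_iff]
  rw [S.clusterCost_leaf, this]
  simp

lemma pot_of_ne (η : ℝ) (u : P.Γ → Fin n → ℝ) {c : Fin N} (hc : ∀ k, S.leaf k ≠ c)
    (x : Fin m → Fin n) :
    S.pot η u c x = Real.exp (-S.clusterCost c ((T.bag c).restrict x) / η) := by
  classical
  simp [pot, hc]

lemma pot_nonneg (η : ℝ) {u : P.Γ → Fin n → ℝ} (hu : ∀ k a, 0 ≤ u k a) (c : Fin N)
    (x : Fin m → Fin n) : 0 ≤ S.pot η u c x :=
  mul_nonneg (Real.exp_nonneg _)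
    (Finset.prod_nonneg fun _ _ => mul_nonneg (hu _ _) (P.μ_nonneg _ _))

lemma pot_pos (η : ℝ) {u : P.Γ → Fin n → ℝ} (hu : ∀ k a, P.μ k a ≠ 0 → 0 < u k a) (c : Fin N)
    {x : Fin m → Fin n} (hx : P.Valid x) : 0 < S.pot η u c x :=
  mul_pos (Real.exp_pos _) (Finset.prod_pos fun _ _ => mul_pos (hu _ _ (hx _))
    ((P.μ_nonneg _ _).lt_of_ne' (hx _)))

open scoped Classical in
/-- The properties of the stored tables that hold throughout the algorithm. Every belief is the
product of its potential and of all incoming messages, and because of `zero` this remains true when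
messages with zero entries are replaced. The entries that matter, at configurations which carry mass
of all the prescribed marginals, are positive. -/
structure Consistent (η : ℝ) (s : BPState P T) : Prop where
  u_nonneg : ∀ k a, 0 ≤ s.u k a
  u_pos : ∀ k a, P.μ k a ≠ 0 → 0 < s.u k a
  bel_nonneg : ∀ c x, 0 ≤ s.gbel c x
  msg_nonneg : ∀ c e x, 0 ≤ s.gmsg c e x
  bel_eq : ∀ c x, s.gbel c x = S.pot η s.u c x * ∏ e with T.tree.Adj c e, s.gmsg e c x
  zero : ∀ c e x, T.tree.Adj c e → s.gmsg c e x = 0 → s.gbel c x = 0 ∧ s.gbel e x = 0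
  msg_pos : ∀ c e x, P.Valid x → 0 < s.gmsg c e x

variable {S} {η : ℝ} {s : BPState P T}

lemma Consistent.bel_pos (hs : S.Consistent η s) (c : Fin N) {x : Fin m → Fin n}
    (hx : P.Valid x) : 0 < s.gbel c x := by
  rw [hs.bel_eq]
  exact mul_pos (S.pot_pos η hs.u_pos c hx) (Finset.prod_pos fun e _ => hs.msg_pos e c x hx)

lemma Consistent.gbel_eq_zero_of_sumOut_eq_zero (hs : S.Consistent η s) {c : Fin N}
    {t : Finset (Fin m)} {x : Fin m → Fin n} (h : sumOut t (s.gbel c) x = 0) : s.gbel c x = 0 :=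
  le_antisymm (h ▸ le_sumOut (hs.bel_nonneg c) x) (hs.bel_nonneg c x)

/-- If one of the two messages along an edge vanishes, then so does the belief summed over the
variables outside the separation set. -/
lemma Consistent.sumOut_eq_zero (hs : S.Consistent η s) {c e : Fin N} (hce : T.tree.Adj c e)
    {x : Fin m → Fin n} (h : s.gmsg c e x = 0 ∨ s.gmsg e c x = 0) :
    sumOut (T.bag c \ T.bag e) (s.gbel c) x = 0 := by
  refine Finset.sum_eq_zero fun y hy => ?_
  simp only [Finset.mem_filter, Finset.mem_univ, true_and, Finset.mem_sdiff, not_and, not_not] at hy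
  have key : ∀ i, i ∈ T.bag c → i ∈ T.bag e → x i = y i := fun i hc he => (hy i fun _ => he).symm
  rcases h with h | h
  · exact (hs.zero c e y hce (by rw [← s.gmsg_congr key, h])).1
  · exact (hs.zero e c y hce.symm (by rw [← s.gmsg_congr fun i he hc => key i hc he, h])).2

lemma Consistent.newMsg_eq_zero (hs : S.Consistent η s) {c e : Fin N} (hce : T.tree.Adj c e)
    {x : Fin m → Fin n} (h : s.gmsg c e x = 0) : s.newMsg c e x = 0 := by
  rw [BPState.newMsg, hs.sumOut_eq_zero hce (Or.inl h), zero_div]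

lemma Consistent.pass (hs : S.Consistent η s) {c e : Fin N} (hce : T.tree.Adj c e) :
    S.Consistent η (pass T s c e).val := by
  classical
  have hnew : ∀ x, 0 ≤ s.newMsg c e x := fun x =>
    div_nonneg (sumOut_nonneg (hs.bel_nonneg c) x) (hs.msg_nonneg e c x)
  have hbel0 : ∀ b x, s.gbel b x = 0 → (LeafSplitting.pass T s c e).val.gbel b x = 0 := by
    intro b x h
    by_cases hb : b = e
    · subst hb; rw [pass_gbel_self, h, zero_mul]
    · rw [pass_gbel_of_ne s hb, h]
  refine ⟨hs.u_nonneg, hs.u_pos, ?_, ?_, ?_, ?_, ?_⟩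
  · intro b x
    by_cases hb : b = e
    · subst hb
      rw [pass_gbel_self]
      exact mul_nonneg (hs.bel_nonneg _ _) (div_nonneg (hnew x) (hs.msg_nonneg _ _ _))
    · rw [pass_gbel_of_ne s hb]
      exact hs.bel_nonneg _ _
  · intro a b x
    by_cases h : a = c ∧ b = e
    · obtain ⟨rfl, rfl⟩ := h
      rw [pass_gmsg_self]
      exact hnew x
    · rw [pass_gmsg_of_ne s h]
      exact hs.msg_nonneg _ _ _
  · intro b x
    by_cases hb : b = e
    · subst hb
      have hmem : c ∈ Finset.univ.filter fun a => T.tree.Adj b a := by simpa using hce.symm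
      have hprod : ∏ a ∈ (Finset.univ.filter fun a => T.tree.Adj b a).erase c,
          (LeafSplitting.pass T s c b).val.gmsg a b x =
          ∏ a ∈ (Finset.univ.filter fun a => T.tree.Adj b a).erase c, s.gmsg a b x :=
        Finset.prod_congr rfl fun a ha => by
          rw [pass_gmsg_of_ne s fun h => Finset.ne_of_mem_erase ha h.1]
      rw [pass_gbel_self, hs.bel_eq, pass_u, ← Finset.mul_prod_erase _ _ hmem,
        ← Finset.mul_prod_erase _ _ hmem, pass_gmsg_self, hprod]
      by_cases h0 : s.gmsg c b x = 0
      · rw [hs.newMsg_eq_zero hce h0]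
        simp
      · field_simp
    · rw [pass_gbel_of_ne s hb, hs.bel_eq, pass_u]
      congr 1
      exact Finset.prod_congr rfl fun a _ => by rw [pass_gmsg_of_ne s fun h => hb h.2]
  · intro a b x hab h
    by_cases hh : a = c ∧ b = e
    · obtain ⟨rfl, rfl⟩ := hh
      rw [pass_gmsg_self] at h
      refine ⟨?_, by rw [pass_gbel_self, h, zero_div, mul_zero]⟩
      refine hbel0 _ _ ?_
      rcases div_eq_zero_iff.1 h with h | h
      · exact hs.gbel_eq_zero_of_sumOut_eq_zero h
      · exact (hs.zero b a x hab.symm h).2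
    · rw [pass_gmsg_of_ne s hh] at h
      exact ⟨hbel0 _ _ (hs.zero a b x hab h).1, hbel0 _ _ (hs.zero a b x hab h).2⟩
  · intro a b x hx
    by_cases hh : a = c ∧ b = e
    · obtain ⟨rfl, rfl⟩ := hh
      rw [pass_gmsg_self]
      exact div_pos ((hs.bel_pos a hx).trans_le (le_sumOut (hs.bel_nonneg a) x))
        (hs.msg_pos _ _ x hx)
    · rw [pass_gmsg_of_ne s hh]
      exact hs.msg_pos _ _ x hx

/-- After an update, a message is up to date. -/
lemma Consistent.updated_pass_self (hs : S.Consistent η s) {c e : Fin N} (hce : T.tree.Adj c e) :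
    (LeafSplitting.pass T s c e).val.Updated c e := by
  intro x
  rw [pass_gbel_of_ne s hce.ne, pass_gmsg_self, pass_gmsg_of_ne s fun h => hce.ne h.2]
  by_cases h0 : s.gmsg e c x = 0
  · rw [hs.sumOut_eq_zero hce (Or.inr h0), h0, mul_zero]
  · rw [BPState.newMsg, div_mul_cancel₀ _ h0]

/-- Only an update of a message that enters `d` from elsewhere than `b` makes the message from `d`
to `b` outdated. -/
lemma Consistent.updated_pass (hs : S.Consistent η s) {a c d b : Fin N} (hac : T.tree.Adj a c)
    (h : s.Updated d b) (hd : c = d → a = b) :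
    (LeafSplitting.pass T s a c).val.Updated d b := by
  by_cases hself : d = a ∧ b = c
  · obtain ⟨rfl, rfl⟩ := hself
    exact hs.updated_pass_self hac
  intro x
  rw [pass_gmsg_of_ne s hself]
  by_cases hcd : c = d
  · obtain rfl := hd hcd
    subst hcd
    rw [pass_gmsg_self]
    have hfun : (LeafSplitting.pass T s a c).val.gbel c =
        fun x => (s.newMsg a c x / s.gmsg a c x) * s.gbel c x := by
      funext y; rw [pass_gbel_self, mul_comm]
    have hdep : ∀ x' : Fin m → Fin n, (∀ i, i ∉ T.bag c \ T.bag a → x' i = x i) →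
        s.newMsg a c x' / s.gmsg a c x' = s.newMsg a c x / s.gmsg a c x := by
      intro x' hx'
      have key : ∀ i, i ∈ T.bag a → i ∈ T.bag c → x' i = x i := fun i ha _ =>
        hx' i (by simp [ha])
      rw [s.gmsg_congr key, BPState.newMsg, BPState.newMsg,
        s.gmsg_congr fun i hc ha => key i ha hc]
      congr 2
      refine sumOut_dependsOn (s.gbel_dependsOn a) fun i hi => ?_
      simp only [Finset.coe_sdiff, Set.mem_sdiff, Finset.mem_coe, not_and, not_not] at hi
      exact key i hi.1 (hi.2 hi.1)
    rw [hfun, sumOut_mul_left hdep, h x]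
    by_cases h0 : s.gmsg a c x = 0
    · rw [hs.newMsg_eq_zero hac h0]; simp
    · field_simp
  · rw [pass_gbel_of_ne s (Ne.symm hcd), h x, pass_gmsg_of_ne s fun hh => hcd hh.2.symm]

lemma passes_cons (e : Fin N × Fin N) (l : List (Fin N × Fin N)) (s : BPState P T) :
    (passes T (e :: l) s).val = (passes T l (LeafSplitting.pass T s e.1 e.2).val).val := rfl

lemma passes_u (l : List (Fin N × Fin N)) (s : BPState P T) : (passes T l s).val.u = s.u := by
  induction l generalizing s with
  | nil => rfl
  | cons e l ih => rw [passes_cons, ih, pass_u]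

lemma Consistent.passes (hs : S.Consistent η s) {l : List (Fin N × Fin N)}
    (hl : ∀ e ∈ l, T.tree.Adj e.1 e.2) : S.Consistent η (passes T l s).val := by
  induction l generalizing s with
  | nil => exact hs
  | cons e l ih =>
    rw [passes_cons]
    exact ih (hs.pass (hl e (by simp))) fun e he => hl e (by simp [he])

lemma Consistent.updated_passes (hs : S.Consistent η s) {l : List (Fin N × Fin N)}
    (hl : ∀ e ∈ l, T.tree.Adj e.1 e.2) {d b : Fin N} (h : s.Updated d b)
    (hd : ∀ e ∈ l, e.2 = d → e.1 = b) : (LeafSplitting.passes T l s).val.Updated d b := by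
  induction l generalizing s with
  | nil => exact h
  | cons e l ih =>
    rw [passes_cons]
    exact ih (hs.pass (hl e (by simp))) (fun e he => hl e (by simp [he]))
      (hs.updated_pass (hl e (by simp)) h (hd e (by simp))) fun e he => hd e (by simp [he])

/-- A schedule brings all its messages up to date, if no message is updated before the
messages it is computed from. -/
lemma Consistent.updated_passes_of_mem (hs : S.Consistent η s) {l : List (Fin N × Fin N)}
    (hl : ∀ e ∈ l, T.tree.Adj e.1 e.2)
    (hp : l.Pairwise fun e f => f.2 = e.1 → f.1 = e.2) {e : Fin N × Fin N} (he : e ∈ l) :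
    (LeafSplitting.passes T l s).val.Updated e.1 e.2 := by
  induction l generalizing s with
  | nil => simp at he
  | cons f l ih =>
    rw [List.pairwise_cons] at hp
    rw [passes_cons]
    have hf := hl f (by simp)
    have hl' : ∀ e ∈ l, T.tree.Adj e.1 e.2 := fun e he => hl e (by simp [he])
    rcases List.mem_cons.1 he with rfl | he
    · exact (hs.pass hf).updated_passes hl' (hs.updated_pass_self hf) hp.1
    · exact ih (hs.pass hf) hl' hp.2 he

end LeafSplitting

end Messages

/-! ### Paths and schedules in the junction tree -/

namespace JunctionTree

variable {m N : ℕ} {G : SimpleGraph (Fin m)} (T : JunctionTree G N)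

lemma isPath_path (c c' : Fin N) : (T.path c c').IsPath :=
  (T.isTree.existsUnique_path c c').choose_spec.1

lemma eq_path {c c' : Fin N} {p : T.tree.Walk c c'} (hp : p.IsPath) : p = T.path c c' :=
  (T.isTree.existsUnique_path c c').choose_spec.2 p hp

lemma length_path (c c' : Fin N) : (T.path c c').length = T.tree.dist c c' := by
  obtain ⟨p, hp⟩ := T.isTree.connected.exists_walk_length_eq_dist c c'
  rw [← T.eq_path (p.isPath_of_length_eq_dist hp), hp]

/-- A walk which starts at a neighbour `c` of `d` and avoids `d` shows that the path from `d` to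
its end passes through `c`. -/
lemma exists_path_eq_cons {d c a : Fin N} (h : T.tree.Adj d c) (p : T.tree.Walk c a)
    (hd : d ∉ p.support) : ∃ q : T.tree.Walk c a, T.path d a = SimpleGraph.Walk.cons h q := by
  refine ⟨p.bypass, (T.eq_path ?_).symm⟩
  rw [SimpleGraph.Walk.cons_isPath_iff]
  exact ⟨p.bypass_isPath, fun hd' => hd (p.support_bypass_subset_support hd')⟩

lemma snd_path_eq {d c a : Fin N} (h : T.tree.Adj d c) (p : T.tree.Walk c a)
    (hd : d ∉ p.support) : (T.path d a).snd = c := by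
  obtain ⟨q, hq⟩ := T.exists_path_eq_cons h p hd
  rw [hq, SimpleGraph.Walk.snd_cons]

lemma dist_eq_succ {d c a : Fin N} (h : T.tree.Adj d c) (p : T.tree.Walk c a)
    (hd : d ∉ p.support) : T.tree.dist d a = T.tree.dist c a + 1 := by
  obtain ⟨q, hq⟩ := T.exists_path_eq_cons h p hd
  have hp := T.isPath_path d a
  rw [hq, SimpleGraph.Walk.cons_isPath_iff] at hp
  rw [← T.length_path, hq, SimpleGraph.Walk.length_cons, T.eq_path hp.1, T.length_path]

lemma eq_of_adj_of_walk {d c a : Fin N} (hc : T.tree.Adj d c) (ha : T.tree.Adj d a)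
    (p : T.tree.Walk c a) (hd : d ∉ p.support) : c = a := by
  rw [← T.snd_path_eq hc p hd, T.snd_path_eq ha SimpleGraph.Walk.nil (by simpa using ha.ne)]

lemma bag_inter_subset {d c a : Fin N} (hc : T.tree.Adj d c) (p : T.tree.Walk c a)
    (hd : d ∉ p.support) : T.bag d ∩ T.bag a ⊆ T.bag c := by
  obtain ⟨q, hq⟩ := T.exists_path_eq_cons hc p hd
  exact T.running_intersection d a _ (T.isPath_path d a) c (by simp [hq])

/-- Towards every `r ≠ d` there is a neighbour of `d`. -/
lemma exists_adj_walk {d r : Fin N} (h : d ≠ r) :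
    ∃ (c : Fin N) (_ : T.tree.Adj d c) (p : T.tree.Walk c r), d ∉ p.support := by
  have hp := T.isPath_path d r
  cases hq : T.path d r with
  | nil => exact absurd rfl h
  | cons hadj q =>
    rw [hq, SimpleGraph.Walk.cons_isPath_iff] at hp
    exact ⟨_, hadj, q, hp.2⟩

/-- Every edge of the tree is directed towards `r` in one of its orientations. -/
lemma toward_or_away {d c : Fin N} (h : T.tree.Adj d c) (r : Fin N) :
    (∃ p : T.tree.Walk c r, d ∉ p.support) ∨ ∃ p : T.tree.Walk d r, c ∉ p.support := by
  classical
  by_cases hd : d ∈ (T.path c r).support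
  · right
    refine ⟨(T.path c r).dropUntil d hd, fun hc => ?_⟩
    have hp := T.isPath_path c r
    rw [← (T.path c r).take_spec hd] at hp
    have hq := hp.support_nodup
    rw [SimpleGraph.Walk.support_append] at hq
    have hdisj := (List.nodup_append.1 hq).2.2
    have hc' : c ∈ ((T.path c r).dropUntil d hd).support.tail := by
      rcases (SimpleGraph.Walk.mem_support_iff _).1 hc with h' | h'
      · exact absurd h' h.ne'
      · exact h'
    exact hdisj c (SimpleGraph.Walk.start_mem_support _) c hc' rfl
  · exact Or.inl ⟨_, hd⟩

lemma mem_layer {r : Fin N} {j : ℕ} {e : Fin N × Fin N} :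
    e ∈ T.layer r j ↔ T.tree.dist e.1 r = j + 1 ∧ e.2 = (T.path e.1 r).snd := by
  unfold layer
  simp only [List.mem_map, List.mem_filter, List.mem_finRange, true_and, decide_eq_true_eq]
  constructor
  · rintro ⟨c, hc, rfl⟩
    exact ⟨hc, rfl⟩
  · rintro ⟨h1, h2⟩
    exact ⟨e.1, h1, by rw [← h2]⟩

lemma layer_spec {r : Fin N} {j : ℕ} {e : Fin N × Fin N} (he : e ∈ T.layer r j) :
    T.tree.Adj e.1 e.2 ∧ T.tree.dist e.1 r = j + 1 ∧ T.tree.dist e.2 r = j ∧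
      ∃ p : T.tree.Walk e.2 r, e.1 ∉ p.support := by
  obtain ⟨h1, h2⟩ := T.mem_layer.1 he
  have hne : e.1 ≠ r := by
    rintro rfl
    simp at h1
  obtain ⟨c, hc, p, hp⟩ := T.exists_adj_walk hne
  obtain rfl : e.2 = c := by rw [h2, T.snd_path_eq hc p hp]
  have := T.dist_eq_succ hc p hp
  exact ⟨hc, h1, by omega, p, hp⟩

lemma dist_lt (c r : Fin N) : T.tree.dist c r < N := by
  rw [← T.length_path]
  simpa using (T.isPath_path c r).length_lt

lemma exists_mem_layer {r d c : Fin N} (h : T.tree.Adj d c) (p : T.tree.Walk c r)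
    (hd : d ∉ p.support) : ∃ j < N, (d, c) ∈ T.layer r j := by
  have h1 := T.dist_eq_succ h p hd
  exact ⟨_, T.dist_lt c r, T.mem_layer.2 ⟨h1, (T.snd_path_eq h p hd).symm⟩⟩

lemma mem_collectSchedule {r : Fin N} {e : Fin N × Fin N} :
    e ∈ T.collectSchedule r ↔ ∃ j < N, e ∈ T.layer r j := by
  simp [collectSchedule]

lemma mem_distributeSchedule {r : Fin N} {e : Fin N × Fin N} :
    e ∈ T.distributeSchedule r ↔ ∃ j < N, e.swap ∈ T.layer r j := by
  simp only [distributeSchedule, List.mem_flatMap, List.mem_range, List.mem_map]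
  refine exists_congr fun j => and_congr_right fun _ => ?_
  constructor
  · rintro ⟨f, hf, rfl⟩
    simpa using hf
  · exact fun h => ⟨_, h, by simp⟩

lemma collectSchedule_pairwise (r : Fin N) :
    (T.collectSchedule r).Pairwise fun e f => f.2 = e.1 → f.1 = e.2 := by
  rw [collectSchedule, List.pairwise_flatMap]
  refine ⟨fun j _ => List.pairwise_of_forall_mem_list ?_, ?_⟩
  · intro e he f hf h
    have h1 := (T.layer_spec he).2.1
    have h2 := (T.layer_spec hf).2.2.1
    rw [h] at h2
    omega
  · rw [List.pairwise_reverse]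
    refine List.pairwise_lt_range.imp fun {a b} hab e he f hf h => ?_
    have h1 := (T.layer_spec he).2.1
    have h2 := (T.layer_spec hf).2.2.1
    rw [h] at h2
    omega

lemma distributeSchedule_pairwise (r : Fin N) :
    (T.distributeSchedule r).Pairwise fun e f => f.2 = e.1 → f.1 = e.2 := by
  rw [distributeSchedule, List.pairwise_flatMap]
  have key : ∀ i j, i ≤ j → ∀ e ∈ (T.layer r i).map Prod.swap, ∀ f ∈ (T.layer r j).map Prod.swap,
      f.2 = e.1 → f.1 = e.2 := by
    intro i j hij e he f hf h
    obtain ⟨e', he', rfl⟩ := List.mem_map.1 he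
    obtain ⟨f', hf', rfl⟩ := List.mem_map.1 hf
    have h1 := (T.layer_spec he').2.2.1
    have h2 := (T.layer_spec hf').2.1
    simp only [Prod.snd_swap, Prod.fst_swap] at h
    rw [h] at h2
    omega
  refine ⟨fun j _ => List.pairwise_of_forall_mem_list (key j j le_rfl), ?_⟩
  · exact List.pairwise_lt_range.imp fun {a b} hab => key a b hab.le

end JunctionTree

section Collect

variable {m n N : ℕ} {P : GraphMOT m n} {T : JunctionTree P.G N}

/-- All messages directed towards the cluster `r` are up to date. -/
def BPState.CollectedAt (s : BPState P T) (r : Fin N) : Prop :=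
  ∀ d c, T.tree.Adj d c → (∃ p : T.tree.Walk c r, d ∉ p.support) → s.Updated d c

namespace LeafSplitting

variable {S : LeafSplitting P T} {η : ℝ} {s : BPState P T}

lemma Consistent.collectedAt_collectSchedule (hs : S.Consistent η s) (r : Fin N) :
    (LeafSplitting.passes T (T.collectSchedule r) s).val.CollectedAt r := by
  rintro d c h ⟨p, hp⟩
  have := hs.updated_passes_of_mem (l := T.collectSchedule r) (fun e he => ?_)
    (T.collectSchedule_pairwise r) (T.mem_collectSchedule.2 (T.exists_mem_layer h p hp))
  · exact this
  · obtain ⟨j, _, hj⟩ := T.mem_collectSchedule.1 he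
    exact (T.layer_spec hj).1

/-- Updating the message from `r` to its neighbour `r'` moves the cluster at which all messages are
collected from `r` to `r'`: no other edge has to change its orientation. -/
lemma Consistent.collectedAt_pass (hs : S.Consistent η s) {r r' : Fin N} (hr : s.CollectedAt r)
    (hadj : T.tree.Adj r r') : (LeafSplitting.pass T s r r').val.CollectedAt r' := by
  rintro d c h ⟨p, hp⟩
  by_cases hd : d = r
  · subst hd
    obtain rfl := T.eq_of_adj_of_walk h hadj p hp
    exact hs.updated_pass_self hadj
  · refine hs.updated_pass hadj (hr d c h ⟨p.concat hadj.symm, ?_⟩) fun hr' => ?_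
    · rw [SimpleGraph.Walk.support_concat]
      simp [hp, hd]
    · subst hr'
      exact absurd (SimpleGraph.Walk.end_mem_support p) hp

lemma Consistent.collectedAt_walk {r r' : Fin N} (p : T.tree.Walk r r') :
    ∀ {s : BPState P T}, S.Consistent η s → s.CollectedAt r →
    (LeafSplitting.passes T (p.darts.map fun e => e.toProd) s).val.CollectedAt r' := by
  induction p with
  | nil => exact fun _ h => h
  | cons hadj p ih =>
    intro s hs h
    rw [SimpleGraph.Walk.darts_cons, List.map_cons, passes_cons]
    exact ih (hs.pass hadj) (hs.collectedAt_pass h hadj)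

lemma adj_of_mem_distributeSchedule {r : Fin N} {e : Fin N × Fin N}
    (he : e ∈ T.distributeSchedule r) : T.tree.Adj e.1 e.2 := by
  obtain ⟨j, _, hj⟩ := T.mem_distributeSchedule.1 he
  exact (T.layer_spec hj).1.symm

lemma adj_of_mem_collectSchedule {r : Fin N} {e : Fin N × Fin N}
    (he : e ∈ T.collectSchedule r) : T.tree.Adj e.1 e.2 := by
  obtain ⟨j, _, hj⟩ := T.mem_collectSchedule.1 he
  exact (T.layer_spec hj).1

lemma adj_of_mem_pathSchedule {c c' : Fin N} {e : Fin N × Fin N}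
    (he : e ∈ T.pathSchedule c c') : T.tree.Adj e.1 e.2 := by
  obtain ⟨f, _, rfl⟩ := List.mem_map.1 he
  exact f.adj

lemma Consistent.collectedAt_distributeSchedule (hs : S.Consistent η s) {r : Fin N}
    (hr : s.CollectedAt r) (r' : Fin N) :
    (LeafSplitting.passes T (T.distributeSchedule r) s).val.CollectedAt r' := by
  intro d c h _
  rcases T.toward_or_away h r with ⟨p, hp⟩ | ⟨p, hp⟩
  · refine hs.updated_passes (fun e he => adj_of_mem_distributeSchedule he) (hr d c h ⟨p, hp⟩) ?_
    intro e he hed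
    obtain ⟨j, _, hj⟩ := T.mem_distributeSchedule.1 he
    have h2 := (T.mem_layer.1 hj).2
    simp only [Prod.snd_swap, Prod.fst_swap] at h2
    rw [h2, hed, T.snd_path_eq h p hp]
  · refine hs.updated_passes_of_mem (e := (d, c)) (fun e he => adj_of_mem_distributeSchedule he)
      (T.distributeSchedule_pairwise r) (T.mem_distributeSchedule.2 ?_)
    exact T.exists_mem_layer h.symm p hp

open scoped Classical in
/-- The joint tensor of the clusters in `A`: the product of the beliefs, divided by the two
messages on every edge (with the convention `0 / 0 = 0`). -/
noncomputable def joint (s : BPState P T) (A : Finset (Fin N)) (x : Fin m → Fin n) : ℝ :=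
  (∏ c ∈ A, s.gbel c x) / ∏ c ∈ A, ∏ e ∈ A, if T.tree.Adj c e then s.gmsg c e x else 1

lemma joint_insert (s : BPState P T) {A : Finset (Fin N)} {d c : Fin N} (hd : d ∉ A) (hc : c ∈ A)
    (h : T.tree.Adj d c) (huniq : ∀ a ∈ A, T.tree.Adj d a → a = c) (x : Fin m → Fin n) :
    joint s (insert d A) x = joint s A x * (s.gbel d x / (s.gmsg d c x * s.gmsg c d x)) := by
  classical
  have h1 : ∏ e ∈ A, (if T.tree.Adj d e then s.gmsg d e x else 1) = s.gmsg d c x := by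
    rw [Finset.prod_eq_single_of_mem c hc]
    · simp [h]
    · intro a ha hac
      exact if_neg fun hda => hac (huniq a ha hda)
  have h2 : ∏ e ∈ A, (if T.tree.Adj e d then s.gmsg e d x else 1) = s.gmsg c d x := by
    rw [Finset.prod_eq_single_of_mem c hc]
    · simp [h.symm]
    · intro a ha hac
      exact if_neg fun hda => hac (huniq a ha hda.symm)
  unfold joint
  rw [Finset.prod_insert hd, Finset.prod_insert hd, Finset.prod_insert hd]
  simp only [Finset.prod_insert hd, Finset.prod_mul_distrib, h1, h2, SimpleGraph.irrefl, if_false,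
    one_mul]
  rw [mul_comm (s.gbel d x), ← mul_assoc, mul_comm _ (∏ x ∈ A, ∏ e ∈ A, _), mul_div_mul_comm]

lemma joint_dependsOn (s : BPState P T) (A : Finset (Fin N)) :
    DependsOn (joint s A) ((A.biUnion T.bag : Finset (Fin m)) : Set (Fin m)) := by
  intro x y h
  have h' : ∀ c ∈ A, ∀ i ∈ T.bag c, x i = y i := fun c hc i hi =>
    h i (by simpa using ⟨c, hc, hi⟩)
  unfold joint
  congr 1
  · exact Finset.prod_congr rfl fun c hc => s.gbel_dependsOn c fun i hi => h' c hc i hi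
  · refine Finset.prod_congr rfl fun c hc => Finset.prod_congr rfl fun e _ => ?_
    rw [s.gmsg_congr fun i hi _ => h' c hc i hi]

lemma Consistent.joint_univ (hs : S.Consistent η s) (x : Fin m → Fin n) :
    joint s Finset.univ x = P.scaledTensor η s.u x := by
  classical
  unfold joint
  by_cases hx : P.Valid x
  · rw [← S.prod_pot, div_eq_iff]
    · rw [Finset.prod_comm (s := Finset.univ), ← Finset.prod_mul_distrib]
      refine Finset.prod_congr rfl fun c _ => ?_
      rw [hs.bel_eq, Finset.prod_filter]
      simp only [T.tree.adj_comm c]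
    · refine Finset.prod_ne_zero_iff.2 fun c _ => Finset.prod_ne_zero_iff.2 fun e _ => ?_
      split_ifs
      · exact (hs.msg_pos c e x hx).ne'
      · exact one_ne_zero
  · unfold GraphMOT.Valid at hx
    push Not at hx
    obtain ⟨k, hk⟩ := hx
    rw [GraphMOT.scaledTensor, Finset.prod_eq_zero (Finset.mem_univ (S.leaf k)),
      Finset.prod_eq_zero (i := k) (Finset.mem_univ _)]
    · simp
    · rw [hk, mul_zero]
    · rw [hs.bel_eq, S.pot_leaf, hk, mul_zero, zero_mul]

/-- Attaching one more cluster to a subtree leaves the projections of the joint tensor unchanged, if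
the message from the new cluster is up to date. -/
lemma Consistent.sumOut_joint_insert (hs : S.Consistent η s) {A : Finset (Fin N)} {d c : Fin N}
    (hd : d ∉ A) (hc : c ∈ A) (h : T.tree.Adj d c) (huniq : ∀ a ∈ A, T.tree.Adj d a → a = c)
    (hsep : T.bag d ∩ A.biUnion T.bag ⊆ T.bag c) (hup : s.Updated d c) :
    sumOut (T.bag d \ T.bag c) (joint s (insert d A)) = joint s A := by
  funext x
  have hsep' : ∀ i, i ∈ A.biUnion T.bag → i ∉ T.bag d \ T.bag c := fun i hi hi' =>
    (Finset.mem_sdiff.1 hi').2 (hsep (Finset.mem_inter.2 ⟨(Finset.mem_sdiff.1 hi').1, hi⟩))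
  have hfun : joint s (insert d A) = fun x =>
      (joint s A x / (s.gmsg d c x * s.gmsg c d x)) * s.gbel d x := by
    funext x
    rw [joint_insert s hd hc h huniq x]
    ring
  rw [hfun, sumOut_mul_left, hup x]
  · by_cases h0 : s.gmsg d c x * s.gmsg c d x = 0
    -- If a message vanishes, then so does the belief of `c`, a factor of the joint tensor.
    · have hc0 : s.gbel c x = 0 := by
        rcases mul_eq_zero.1 h0 with h0 | h0
        · exact (hs.zero d c x h h0).2
        · exact (hs.zero c d x h.symm h0).1
      rw [h0, mul_zero, joint, Finset.prod_eq_zero hc hc0, zero_div]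
    · rw [div_mul_cancel₀ _ h0]
  · intro x' hx'
    have e1 : joint s A x' = joint s A x := joint_dependsOn s A fun i hi => hx' i (hsep' i hi)
    have e2 : ∀ i, i ∈ T.bag c → x' i = x i := fun i hi => hx' i (by simp [hi])
    rw [e1, s.gmsg_congr fun i _ hi => e2 i hi, s.gmsg_congr fun i hi _ => e2 i hi]

/-- Collecting all messages at `r` makes the belief of `r` the projection of the full tensor. The
proof attaches the clusters one after the other to the subtree `{r}`. -/
lemma Consistent.sumOut_scaledTensor (hs : S.Consistent η s) {r : Fin N} (hr : s.CollectedAt r) :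
    sumOut (T.bag r)ᶜ (P.scaledTensor η s.u) = s.gbel r := by
  classical
  have key : ∀ j, j < N → ∃ A : Finset (Fin N), A.card = j + 1 ∧ r ∈ A ∧
      (∀ a ∈ A, ∃ p : T.tree.Walk a r, ∀ v ∈ p.support, v ∈ A) ∧
      sumOut (A.biUnion T.bag \ T.bag r) (joint s A) = s.gbel r := by
    intro j
    induction j with
    | zero =>
      intro _
      refine ⟨{r}, by simp, by simp, ?_, ?_⟩
      · intro a ha
        obtain rfl := Finset.mem_singleton.1 ha
        exact ⟨SimpleGraph.Walk.nil, by simp⟩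
      · simp only [Finset.singleton_biUnion, Finset.sdiff_self, sumOut_empty]
        funext x
        simp [joint]
    | succ j ih =>
      intro hj
      obtain ⟨A, hcard, hrA, hconn, hsum⟩ := ih (by omega)
      obtain ⟨v, hv⟩ : ∃ v, v ∉ A := by
        by_contra! hall
        rw [Finset.eq_univ_iff_forall.2 hall, Finset.card_univ, Fintype.card_fin] at hcard
        omega
      obtain ⟨e, -, he1, he2⟩ :=
        (T.path r v).exists_boundary_dart (A : Set (Fin N)) (by simpa using hrA) (by simpa using hv)
      obtain ⟨⟨c, d⟩, hcd⟩ := e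
      simp only [Finset.mem_coe] at he1 he2
      have hdc : T.tree.Adj d c := hcd.symm
      have hwalk : ∀ a ∈ A, ∃ p : T.tree.Walk c a, d ∉ p.support := by
        intro a ha
        obtain ⟨p, hp⟩ := hconn c he1
        obtain ⟨q, hq⟩ := hconn a ha
        refine ⟨p.append q.reverse, fun hmem => ?_⟩
        rw [SimpleGraph.Walk.mem_support_append_iff, SimpleGraph.Walk.support_reverse,
          List.mem_reverse] at hmem
        rcases hmem with h | h
        · exact he2 (hp d h)
        · exact he2 (hq d h)
      have huniq : ∀ a ∈ A, T.tree.Adj d a → a = c := by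
        intro a ha hda
        obtain ⟨p, hp⟩ := hwalk a ha
        exact (T.eq_of_adj_of_walk hdc hda p hp).symm
      have hsep : T.bag d ∩ A.biUnion T.bag ⊆ T.bag c := by
        intro i hi
        obtain ⟨hi1, hi2⟩ := Finset.mem_inter.1 hi
        obtain ⟨a, ha, hia⟩ := Finset.mem_biUnion.1 hi2
        obtain ⟨p, hp⟩ := hwalk a ha
        exact T.bag_inter_subset hdc p hp (Finset.mem_inter.2 ⟨hi1, hia⟩)
      refine ⟨insert d A, by rw [Finset.card_insert_of_notMem he2, hcard],
        Finset.mem_insert_of_mem hrA, ?_, ?_⟩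
      · intro a ha
        rcases Finset.mem_insert.1 ha with rfl | ha
        · obtain ⟨p, hp⟩ := hconn c he1
          refine ⟨SimpleGraph.Walk.cons hdc p, fun v hv => ?_⟩
          rw [SimpleGraph.Walk.support_cons, List.mem_cons] at hv
          rcases hv with rfl | hv
          · exact Finset.mem_insert_self _ _
          · exact Finset.mem_insert_of_mem (hp v hv)
        · obtain ⟨p, hp⟩ := hconn a ha
          exact ⟨p, fun v hv => Finset.mem_insert_of_mem (hp v hv)⟩
      · have hc_sub : T.bag c ⊆ A.biUnion T.bag := Finset.subset_biUnion_of_mem T.bag he1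
        have hr_sub : T.bag r ⊆ A.biUnion T.bag := Finset.subset_biUnion_of_mem T.bag hrA
        have hset : (insert d A).biUnion T.bag \ T.bag r =
            (A.biUnion T.bag \ T.bag r) ∪ (T.bag d \ T.bag c) := by
          ext i
          have h1 : i ∈ T.bag c → i ∈ A.biUnion T.bag := fun h => hc_sub h
          have h2 : i ∈ T.bag r → i ∈ A.biUnion T.bag := fun h => hr_sub h
          have h3 : i ∈ T.bag d → i ∈ A.biUnion T.bag → i ∈ T.bag c := fun h h' =>
            hsep (Finset.mem_inter.2 ⟨h, h'⟩)
          simp only [Finset.biUnion_insert, Finset.mem_sdiff, Finset.mem_union]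
          tauto
        have hdisj : Disjoint (A.biUnion T.bag \ T.bag r) (T.bag d \ T.bag c) := by
          rw [Finset.disjoint_left]
          intro i hi hi'
          exact (Finset.mem_sdiff.1 hi').2 (hsep (Finset.mem_inter.2
            ⟨(Finset.mem_sdiff.1 hi').1, (Finset.mem_sdiff.1 hi).1⟩))
        obtain ⟨p, hp⟩ := hwalk r hrA
        rw [hset, ← sumOut_sumOut hdisj,
          hs.sumOut_joint_insert he2 he1 hdc huniq hsep (hr d c hdc ⟨p, hp⟩), hsum]
  have hN : 0 < N := r.pos
  obtain ⟨A, hcard, -, -, hsum⟩ := key (N - 1) (by omega)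
  have hA : A = Finset.univ := by
    rw [← Finset.card_eq_iff_eq_univ, hcard, Fintype.card_fin]
    omega
  subst hA
  have hcover : (Finset.univ : Finset (Fin N)).biUnion T.bag = Finset.univ := by
    ext i
    simpa using T.cover i
  rwa [hcover, ← Finset.compl_eq_univ_sdiff, funext hs.joint_univ] at hsum

end LeafSplitting

end Collect

/-! ### The scaling updates -/

lemma Counted.foldlM_val {α β : Type} (f : α → β → Counted α) (l : List β) (a : α) :
    (l.foldlM f a).val = l.foldl (fun a b => (f a b).val) a := by
  induction l generalizing a with
  | nil => rfl
  | cons b l ih => exact ih _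

section Scaling

variable {m n N : ℕ} {P : GraphMOT m n} {T : JunctionTree P.G N}

/-- The scaling vectors `u'` arise from `u` by a Sinkhorn update of `u k`. Entries outside the
support of `μ k` do not influence the tensor and are left unspecified. -/
structure GraphMOT.IsSinkhornUpdate (P : GraphMOT m n) (η : ℝ) (k : P.Γ) (u u' : P.Γ → Fin n → ℝ) :
    Prop where
  of_ne : ∀ j, j ≠ k → u' j = u j
  mul_marginal : ∀ a, P.μ k a ≠ 0 →
    u' k a * GraphMOT.marginal (P.scaledTensor η u) k a = u k a * P.μ k a

namespace LeafSplitting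

variable (S : LeafSplitting P T)

lemma incoming_apply (s : BPState P T) (k : P.Γ) (x : Fin m → Fin n) :
    S.incoming s k (x k) = s.gmsg (S.nbr k) (S.leaf k) x := by
  unfold incoming BPState.gmsg
  congr 1
  funext i
  have hi := (Finset.mem_inter.1 i.2).2
  rw [S.bag_leaf, Finset.mem_singleton] at hi
  simp [Finset.restrict, hi]

lemma refreshLeaf_gbel_self (s : BPState P T) (k : P.Γ) (x : Fin m → Fin n) :
    (S.refreshLeaf s k).val.gbel (S.leaf k) x =
      s.u k (x k) * P.μ k (x k) * s.gmsg (S.nbr k) (S.leaf k) x := by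
  rw [← incoming_apply]
  change (Function.update s.bel (S.leaf k) _) (S.leaf k) _ = _
  rw [Function.update_self]
  rfl

lemma refreshLeaf_bel_of_ne (s : BPState P T) {k : P.Γ} {c : Fin N} (h : c ≠ S.leaf k) :
    (S.refreshLeaf s k).val.bel c = s.bel c :=
  Function.update_of_ne h _ _

lemma scale_u (s : BPState P T) (k : P.Γ) :
    (S.scale s k).val.u = Function.update s.u k fun a => 1 / S.incoming s k a := rfl

lemma scale_gmsg (s : BPState P T) (k : P.Γ) (c e : Fin N) :
    (S.scale s k).val.gmsg c e = s.gmsg c e := rfl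

lemma scale_gbel_self (s : BPState P T) (k : P.Γ) (x : Fin m → Fin n) :
    (S.scale s k).val.gbel (S.leaf k) x =
      (1 / S.incoming s k (x k)) * P.μ k (x k) * s.gmsg (S.nbr k) (S.leaf k) x := by
  refine (S.refreshLeaf_gbel_self _ k x).trans ?_
  simp only [Function.update_self]
  rfl

lemma scale_gbel_of_ne (s : BPState P T) {k : P.Γ} {c : Fin N} (h : c ≠ S.leaf k) :
    (S.scale s k).val.gbel c = s.gbel c := by
  funext x
  exact congrFun (S.refreshLeaf_bel_of_ne _ h) _

lemma pot_scale_of_ne (η : ℝ) (s : BPState P T) {k : P.Γ} {c : Fin N} (h : c ≠ S.leaf k)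
    (x : Fin m → Fin n) : S.pot η (S.scale s k).val.u c x = S.pot η s.u c x := by
  classical
  unfold pot
  congr 1
  refine Finset.prod_congr rfl fun j hj => ?_
  have hjk : j ≠ k := by
    rintro rfl
    exact h (Finset.mem_filter.1 hj).2.symm
  rw [scale_u, Function.update_of_ne hjk]

variable {S} {η : ℝ} {s : BPState P T}

lemma Consistent.incoming_pos [NeZero n] (hs : S.Consistent η s) {k : P.Γ} {a : Fin n}
    (ha : P.μ k a ≠ 0) : 0 < S.incoming s k a := by
  obtain ⟨x, hx⟩ := P.exists_valid
  have := hs.msg_pos (S.nbr k) (S.leaf k) _ (hx.update ha)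
  rw [← S.incoming_apply] at this
  simpa using this

/-- A message out of the leaf of `k` vanishes only outside the support of `μ k`. -/
lemma Consistent.mu_eq_zero_of_leaf_msg [NeZero n] (hs : S.Consistent η s) {k : P.Γ} {e : Fin N}
    {x : Fin m → Fin n} (h : s.gmsg (S.leaf k) e x = 0) : P.μ k (x k) = 0 := by
  by_contra hk
  obtain ⟨y, hy⟩ := P.exists_valid
  have hpos := hs.msg_pos (S.leaf k) e _ (hy.update hk)
  rw [s.gmsg_congr (y := x), h] at hpos
  · exact hpos.false
  · intro i hi _
    rw [S.bag_leaf, Finset.mem_singleton] at hi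
    subst hi
    simp

lemma Consistent.gbel_leaf (hs : S.Consistent η s) (k : P.Γ) (x : Fin m → Fin n) :
    s.gbel (S.leaf k) x = s.u k (x k) * P.μ k (x k) * S.incoming s k (x k) := by
  classical
  rw [hs.bel_eq, S.pot_leaf, S.incoming_apply]
  congr 1
  rw [Finset.prod_filter, Finset.prod_eq_single (S.nbr k)]
  · simp [S.adj_nbr k]
  · intro e _ he
    rw [if_neg fun h => he (S.adj_leaf_iff.1 h)]
  · simp

lemma Consistent.scale [NeZero n] (hs : S.Consistent η s) (k : P.Γ) :
    S.Consistent η (S.scale s k).val := by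
  classical
  have hin : ∀ a, 0 ≤ S.incoming s k a := fun a => by
    have := hs.msg_nonneg (S.nbr k) (S.leaf k) fun _ => a
    rwa [← S.incoming_apply] at this
  have hu : ∀ j a, 0 ≤ (S.scale s k).val.u j a := by
    intro j a
    by_cases hj : j = k
    · subst hj
      rw [scale_u, Function.update_self]
      exact one_div_nonneg.2 (hin a)
    · rw [scale_u, Function.update_of_ne hj]
      exact hs.u_nonneg j a
  have hbel0 : ∀ c x, c ≠ S.leaf k → s.gbel c x = 0 → (S.scale s k).val.gbel c x = 0 :=
    fun c x hc h => by rw [scale_gbel_of_ne S s hc, h]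
  refine ⟨hu, ?_, ?_, hs.msg_nonneg, ?_, ?_, hs.msg_pos⟩
  · intro j a ha
    by_cases hj : j = k
    · subst hj
      rw [scale_u, Function.update_self]
      exact one_div_pos.2 (hs.incoming_pos ha)
    · rw [scale_u, Function.update_of_ne hj]
      exact hs.u_pos j a ha
  · intro c x
    by_cases hc : c = S.leaf k
    · subst hc
      rw [scale_gbel_self]
      exact mul_nonneg (mul_nonneg (one_div_nonneg.2 (hin _)) (P.μ_nonneg _ _))
        (hs.msg_nonneg _ _ _)
    · rw [scale_gbel_of_ne S s hc]
      exact hs.bel_nonneg c x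
  · intro c x
    by_cases hc : c = S.leaf k
    · subst hc
      rw [scale_gbel_self, S.pot_leaf, scale_u, Function.update_self]
      congr 1
      rw [Finset.prod_filter, Finset.prod_eq_single (S.nbr k)]
      · simp [S.adj_nbr k, scale_gmsg]
      · intro e _ he
        rw [if_neg fun h => he (S.adj_leaf_iff.1 h)]
      · simp
    · rw [scale_gbel_of_ne S s hc, hs.bel_eq, S.pot_scale_of_ne η s hc]
      rfl
  · intro c e x hce h
    rw [scale_gmsg] at h
    obtain ⟨h1, h2⟩ := hs.zero c e x hce h
    by_cases hc : c = S.leaf k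
    · subst hc
      refine ⟨?_, hbel0 _ _ hce.ne' h2⟩
      rw [scale_gbel_self, hs.mu_eq_zero_of_leaf_msg h]
      simp
    · refine ⟨hbel0 _ _ hc h1, ?_⟩
      by_cases he : e = S.leaf k
      · subst he
        obtain rfl := S.adj_leaf_iff.1 hce.symm
        rw [scale_gbel_self, h, mul_zero]
      · exact hbel0 _ _ he h2

lemma collectedAt_scale {k : P.Γ} (h : s.CollectedAt (S.leaf k)) :
    (S.scale s k).val.CollectedAt (S.leaf k) := by
  rintro d c hdc ⟨p, hp⟩ x
  have hd : d ≠ S.leaf k := by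
    rintro rfl
    exact hp (SimpleGraph.Walk.end_mem_support p)
  rw [scale_gbel_of_ne S s hd]
  exact h d c hdc ⟨p, hp⟩ x

lemma Consistent.marginal_eq [NeZero n] (hs : S.Consistent η s) {k : P.Γ}
    (h : s.CollectedAt (S.leaf k)) (a : Fin n) :
    GraphMOT.marginal (P.scaledTensor η s.u) k a = s.u k a * P.μ k a * S.incoming s k a := by
  have h1 := congrFun (hs.sumOut_scaledTensor h) fun _ => a
  rwa [S.bag_leaf, ← marginal_apply_eq_sumOut, hs.gbel_leaf] at h1

lemma Consistent.isSinkhornUpdate_scale [NeZero n] (hs : S.Consistent η s) {k : P.Γ}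
    (h : s.CollectedAt (S.leaf k)) : P.IsSinkhornUpdate η k s.u (S.scale s k).val.u := by
  refine ⟨fun j hj => by rw [scale_u, Function.update_of_ne hj], fun a ha => ?_⟩
  have := (hs.incoming_pos ha).ne'
  rw [hs.marginal_eq h, scale_u, Function.update_self]
  field_simp

variable (S)

lemma foldl_refreshLeaf (l : List P.Γ) (s : BPState P T) (hu : s.u = fun _ _ => 1)
    (hm : s.msg = fun _ _ _ => 1) :
    let s' := l.foldl (fun s k => (S.refreshLeaf s k).val) s
    s'.u = (fun _ _ => 1) ∧ s'.msg = (fun _ _ _ => 1) ∧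
      (∀ c, (∀ k ∈ l, S.leaf k ≠ c) → s'.bel c = s.bel c) ∧
      ∀ k ∈ l, ∀ x, s'.gbel (S.leaf k) x = P.μ k (x k) := by
  induction l generalizing s with
  | nil => exact ⟨hu, hm, fun _ _ => rfl, by simp⟩
  | cons k l ih =>
    obtain ⟨h1, h2, h3, h4⟩ := ih (S.refreshLeaf s k).val hu hm
    refine ⟨h1, h2, fun c hc => ?_, fun j hj x => ?_⟩
    · rw [List.foldl_cons, h3 c fun j hj => hc j (by simp [hj])]
      exact S.refreshLeaf_bel_of_ne s (hc k (by simp)).symm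
    · by_cases hjl : j ∈ l
      · exact h4 j hjl x
      · obtain rfl : j = k := by
          rcases List.mem_cons.1 hj with h | h
          · exact h
          · exact absurd h hjl
        have hb := h3 (S.leaf j) fun i hi hij => hjl (S.leaf_injective hij ▸ hi)
        rw [List.foldl_cons, BPState.gbel, hb]
        change (S.refreshLeaf s j).val.gbel (S.leaf j) x = _
        rw [S.refreshLeaf_gbel_self, hu, BPState.gmsg, hm]
        simp

/-- The state of the memory before the first message is computed. -/
noncomputable def initialState (η : ℝ) : BPState P T :=
  (Finset.univ : Finset P.Γ).toList.foldl (fun s k => (S.refreshLeaf s k).val)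
    { u := fun _ _ => 1, msg := fun _ _ _ => 1,
      bel := fun c y => Real.exp (-(S.clusterCost c y / η)) }

lemma initialState_u (η : ℝ) : (S.initialState η).u = fun _ _ => 1 :=
  (S.foldl_refreshLeaf _ _ rfl rfl).1

lemma init_val (η : ℝ) (k : P.Γ) : (S.init η k).val =
    (S.scale (passes T (T.collectSchedule (S.leaf k)) (S.initialState η)).val k).val := by
  rw [initialState, ← Counted.foldlM_val]
  rfl

lemma consistent_initialState (η : ℝ) : S.Consistent η (S.initialState η) := by
  classical
  obtain ⟨h1, h2, h3, h4⟩ := S.foldl_refreshLeaf (Finset.univ : Finset P.Γ).toList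
    { u := fun _ _ => 1, msg := fun _ _ _ => 1,
      bel := fun c y => Real.exp (-(S.clusterCost c y / η)) } rfl rfl
  change (S.initialState η).u = _ at h1
  change (S.initialState η).msg = _ at h2
  have hmsg : ∀ c e x, (S.initialState η).gmsg c e x = 1 := fun c e x => by
    rw [BPState.gmsg, h2]
  have hbel : ∀ c x, (S.initialState η).gbel c x = S.pot η (S.initialState η).u c x := by
    intro c x
    by_cases hc : ∃ k, S.leaf k = c
    · obtain ⟨k, rfl⟩ := hc
      rw [S.pot_leaf, h1, one_mul]
      exact h4 k (by simp) x
    · push Not at hc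
      rw [S.pot_of_ne _ _ hc, neg_div]
      exact congrFun (h3 c fun k _ => hc k) _
  refine ⟨by simp [h1], by simp [h1], ?_, by simp [hmsg], ?_, by simp [hmsg], by simp [hmsg]⟩
  · intro c x
    rw [hbel]
    exact S.pot_nonneg η (by simp [h1]) c x
  · intro c x
    simp [hbel, hmsg]

/-- The state of the memory in which the scaling vector of `κ t` is updated. -/
noncomputable def beforeScale (η : ℝ) (κ : ℕ → P.Γ) : ℕ → BPState P T
  | 0 => (passes T (T.collectSchedule (S.leaf (κ 0))) (S.initialState η)).val
  | t + 1 => (passes T (T.pathSchedule (S.leaf (κ t)) (S.leaf (κ (t + 1)))) (S.run η κ t).val).val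

lemma run_val (η : ℝ) (κ : ℕ → P.Γ) (t : ℕ) :
    (S.run η κ t).val = (S.scale (S.beforeScale η κ t) (κ t)).val := by
  cases t with
  | zero => exact S.init_val η (κ 0)
  | succ t => rfl

lemma beforeScale_spec [NeZero n] (η : ℝ) (κ : ℕ → P.Γ) (t : ℕ) :
    S.Consistent η (S.beforeScale η κ t) ∧ (S.beforeScale η κ t).CollectedAt (S.leaf (κ t)) := by
  induction t with
  | zero =>
    exact ⟨(S.consistent_initialState η).passes fun e he => adj_of_mem_collectSchedule he,
      (S.consistent_initialState η).collectedAt_collectSchedule _⟩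
  | succ t ih =>
    have h1 : S.Consistent η (S.run η κ t).val := by
      rw [run_val]
      exact ih.1.scale _
    have h2 : (S.run η κ t).val.CollectedAt (S.leaf (κ t)) := by
      rw [run_val]
      exact collectedAt_scale ih.2
    exact ⟨h1.passes fun e he => adj_of_mem_pathSchedule he, Consistent.collectedAt_walk _ h1 h2⟩

lemma consistent_run [NeZero n] (η : ℝ) (κ : ℕ → P.Γ) (t : ℕ) :
    S.Consistent η (S.run η κ t).val := by
  rw [run_val]
  exact (S.beforeScale_spec η κ t).1.scale _

lemma collectedAt_run [NeZero n] (η : ℝ) (κ : ℕ → P.Γ) (t : ℕ) :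
    (S.run η κ t).val.CollectedAt (S.leaf (κ t)) := by
  rw [run_val]
  exact collectedAt_scale (S.beforeScale_spec η κ t).2

/-- The first iterate is a Sinkhorn update of the scaling vectors with all entries equal to one. -/
lemma isSinkhornUpdate_run_zero [NeZero n] (η : ℝ) (κ : ℕ → P.Γ) :
    P.IsSinkhornUpdate η (κ 0) (fun _ _ => 1) (S.run η κ 0).val.u := by
  have h := S.beforeScale_spec η κ 0
  have := h.1.isSinkhornUpdate_scale h.2
  rwa [← run_val, show (S.beforeScale η κ 0).u = fun _ _ => 1 from
    (passes_u _ _).trans (S.initialState_u η)] at this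

lemma isSinkhornUpdate_run_succ [NeZero n] (η : ℝ) (κ : ℕ → P.Γ) (t : ℕ) :
    P.IsSinkhornUpdate η (κ (t + 1)) (S.run η κ t).val.u (S.run η κ (t + 1)).val.u := by
  have h := S.beforeScale_spec η κ (t + 1)
  have := h.1.isSinkhornUpdate_scale h.2
  rwa [← run_val, show (S.beforeScale η κ (t + 1)).u = (S.run η κ t).val.u from
    passes_u _ _] at this

lemma run_congr (η : ℝ) {κ κ' : ℕ → P.Γ} {t : ℕ} (h : ∀ i ≤ t, κ i = κ' i) :
    S.run η κ t = S.run η κ' t := by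
  induction t with
  | zero => rw [run, run, h 0 le_rfl]
  | succ t ih =>
    rw [run, run, ih fun i hi => h i (by omega), h t (by omega), h (t + 1) le_rfl]

/-- The cluster marginals that are rounded at the end. -/
lemma gbel_distribute [NeZero n] (η : ℝ) (κ : ℕ → P.Γ) (t : ℕ) (c : Fin N) :
    (passes T (T.distributeSchedule (S.leaf (κ t))) (S.run η κ t).val).val.gbel c =
      sumOut (T.bag c)ᶜ (P.scaledTensor η (S.run η κ t).val.u) := by
  have h := S.consistent_run η κ t
  have h1 := h.passes (l := T.distributeSchedule (S.leaf (κ t)))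
    fun e he => adj_of_mem_distributeSchedule he
  rw [← h1.sumOut_scaledTensor (h.collectedAt_distributeSchedule (S.collectedAt_run η κ t) c),
    passes_u]

end LeafSplitting

end Scaling

/-! ### Relative entropy inequalities -/

section Entropy

variable {ι : Type*} [Fintype ι]

/-- Gibbs' inequality, for vectors that need not be normalized. -/
lemma sum_mul_log_sub_log_le {p q : ι → ℝ} (hp : ∀ i, 0 ≤ p i) (hq : ∀ i, 0 ≤ q i)
    (h : ∀ i, p i = 0 → q i = 0) :
    ∑ i, q i * (Real.log (p i) - Real.log (q i)) ≤ ∑ i, p i - ∑ i, q i := by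
  rw [← Finset.sum_sub_distrib]
  refine Finset.sum_le_sum fun i _ => ?_
  rcases (hq i).eq_or_lt with hqi | hqi
  · rw [← hqi]
    simpa using hp i
  · have hpi : 0 < p i := (hp i).lt_of_ne' fun h0 => hqi.ne' (h i h0)
    rw [← Real.log_div hpi.ne' hqi.ne']
    have := mul_le_mul_of_nonneg_left (Real.log_le_sub_one_of_pos (div_pos hpi hqi)) hqi.le
    refine this.trans (le_of_eq ?_)
    field_simp

/-- A version of Pinsker's inequality with a worse constant, which follows from the comparison of
the relative entropy with the Hellinger distance. -/
lemma sq_sum_abs_sub_le {p q : ι → ℝ} (hp : ∀ i, 0 ≤ p i) (hq : ∀ i, 0 ≤ q i)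
    (h : ∀ i, p i = 0 → q i = 0) (hp1 : ∑ i, p i = 1) (hq1 : ∑ i, q i = 1) :
    (∑ i, |p i - q i|) ^ 2 / 4 ≤ ∑ i, q i * (Real.log (q i) - Real.log (p i)) := by
  have hs : ∀ i, Real.sqrt (p i) ^ 2 = p i := fun i => Real.sq_sqrt (hp i)
  have ht : ∀ i, Real.sqrt (q i) ^ 2 = q i := fun i => Real.sq_sqrt (hq i)
  have h1 : ∑ i, (Real.sqrt (p i) - Real.sqrt (q i)) ^ 2 ≤
      ∑ i, q i * (Real.log (q i) - Real.log (p i)) := by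
    have h2 : ∑ i, (Real.sqrt (p i) - Real.sqrt (q i)) ^ 2 =
        ∑ i, (2 * q i - 2 * (Real.sqrt (q i) * Real.sqrt (p i))) := by
      have : ∑ i, (Real.sqrt (p i) - Real.sqrt (q i)) ^ 2 -
          ∑ i, (2 * q i - 2 * (Real.sqrt (q i) * Real.sqrt (p i))) = ∑ i, p i - ∑ i, q i := by
        rw [← Finset.sum_sub_distrib, ← Finset.sum_sub_distrib]
        refine Finset.sum_congr rfl fun i _ => ?_
        linear_combination hs i + ht i
      rw [hp1, hq1] at this
      linarith
    rw [h2]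
    refine Finset.sum_le_sum fun i _ => ?_
    rcases (hq i).eq_or_lt with hqi | hqi
    · rw [← hqi]
      simp
    · have hpi : 0 < p i := (hp i).lt_of_ne' fun h0 => hqi.ne' (h i h0)
      have ha := Real.sqrt_pos.2 hqi
      have hb := Real.sqrt_pos.2 hpi
      have h3 := Real.log_le_sub_one_of_pos (div_pos hb ha)
      rw [Real.log_div hb.ne' ha.ne', Real.log_sqrt (hp i), Real.log_sqrt (hq i)] at h3
      have h4 := mul_le_mul_of_nonneg_left h3 hqi.le
      have h5 : q i * (Real.sqrt (p i) / Real.sqrt (q i) - 1) =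
          Real.sqrt (q i) * Real.sqrt (p i) - q i := by
        field_simp
        linear_combination -Real.sqrt (p i) * ht i
      rw [h5] at h4
      linarith
  have h2 : (∑ i, |p i - q i|) ^ 2 ≤ (∑ i, (Real.sqrt (p i) - Real.sqrt (q i)) ^ 2) *
      ∑ i, (Real.sqrt (p i) + Real.sqrt (q i)) ^ 2 := by
    have := Finset.sum_mul_sq_le_sq_mul_sq Finset.univ
      (fun i => |Real.sqrt (p i) - Real.sqrt (q i)|) (fun i => Real.sqrt (p i) + Real.sqrt (q i))
    simp only [sq_abs] at this
    refine le_trans (le_of_eq ?_) this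
    congr 1
    refine Finset.sum_congr rfl fun i _ => ?_
    rw [← abs_of_nonneg (add_nonneg (Real.sqrt_nonneg (p i)) (Real.sqrt_nonneg (q i))), ← abs_mul]
    congr 1
    linear_combination -hs i + ht i
  have h3 : ∑ i, (Real.sqrt (p i) + Real.sqrt (q i)) ^ 2 ≤ 4 := by
    have : ∑ i, (Real.sqrt (p i) + Real.sqrt (q i)) ^ 2 ≤ ∑ i, (2 * p i + 2 * q i) := by
      refine Finset.sum_le_sum fun i _ => ?_
      nlinarith [sq_nonneg (Real.sqrt (p i) - Real.sqrt (q i)), hs i, ht i]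
    rw [Finset.sum_add_distrib, ← Finset.mul_sum, ← Finset.mul_sum, hp1, hq1] at this
    linarith
  have h4 : 0 ≤ ∑ i, (Real.sqrt (p i) - Real.sqrt (q i)) ^ 2 :=
    Finset.sum_nonneg fun _ _ => sq_nonneg _
  nlinarith [mul_le_mul_of_nonneg_left h3 h4]

end Entropy

/-! ### The dual objective -/

namespace GraphMOT

variable {m n : ℕ} (P : GraphMOT m n)

/-- Scaling vectors whose entries are positive on the supports of the marginals, vary there by at
most a factor `exp ρ`, and define a tensor of mass one. All iterates are of this form. -/
structure Admissible (η ρ : ℝ) (u : P.Γ → Fin n → ℝ) : Prop where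
  pos : ∀ k a, P.μ k a ≠ 0 → 0 < u k a
  osc : ∀ k a b, P.μ k a ≠ 0 → P.μ k b ≠ 0 → u k a ≤ Real.exp ρ * u k b
  mass : ∑ x, P.scaledTensor η u x = 1

/-- The objective of the entropic dual problem, for scaling vectors that define a tensor of mass
one, in units of `η`. -/
noncomputable def dual (u : P.Γ → Fin n → ℝ) : ℝ := ∑ k, ∑ a, P.μ k a * Real.log (u k a)

/-- The distance of the dual objective from its supremum over the admissible scaling vectors. -/
noncomputable def gap (η ρ : ℝ) (u : P.Γ → Fin n → ℝ) : ℝ :=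
  sSup (P.dual '' {v | P.Admissible η ρ v}) - P.dual u

variable {P} {η ρ : ℝ} {u v u' : P.Γ → Fin n → ℝ}

lemma scaledTensor_pos (hu : ∀ k a, P.μ k a ≠ 0 → 0 < u k a) {x : Fin m → Fin n}
    (hx : P.Valid x) : 0 < P.scaledTensor η u x :=
  mul_pos (Real.exp_pos _) (Finset.prod_pos fun k _ =>
    mul_pos (hu k _ (hx k)) ((P.μ_nonneg _ _).lt_of_ne' (hx k)))

lemma scaledTensor_eq_zero {k : P.Γ} {x : Fin m → Fin n} (hx : P.μ k (x k) = 0) :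
    P.scaledTensor η u x = 0 := by
  rw [scaledTensor, Finset.prod_eq_zero (Finset.mem_univ k) (by rw [hx, mul_zero]), mul_zero]

lemma scaledTensor_eq_zero' {x : Fin m → Fin n} (hx : ¬ P.Valid x) :
    P.scaledTensor η u x = 0 := by
  unfold Valid at hx
  push Not at hx
  obtain ⟨k, hk⟩ := hx
  exact scaledTensor_eq_zero hk

lemma scaledTensor_nonneg (hu : ∀ k a, P.μ k a ≠ 0 → 0 < u k a) (x : Fin m → Fin n) :
    0 ≤ P.scaledTensor η u x := by
  by_cases hx : P.Valid x
  · exact (scaledTensor_pos hu hx).le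
  · rw [scaledTensor_eq_zero' hx]

lemma valid_of_scaledTensor_ne_zero {x : Fin m → Fin n} (hx : P.scaledTensor η u x ≠ 0) :
    P.Valid x := by
  by_contra h
  exact hx (scaledTensor_eq_zero' h)

lemma log_scaledTensor (hu : ∀ k a, P.μ k a ≠ 0 → 0 < u k a) {x : Fin m → Fin n}
    (hx : P.Valid x) : Real.log (P.scaledTensor η u x) =
      -P.cost x / η + ∑ k : P.Γ, Real.log (u k (x k) * P.μ k (x k)) := by
  rw [scaledTensor, Real.log_mul (Real.exp_pos _).ne', Real.log_exp, Real.log_prod]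
  · exact fun k _ => mul_ne_zero (hu k _ (hx k)).ne' (hx k)
  · exact Finset.prod_ne_zero_iff.2 fun k _ => mul_ne_zero (hu k _ (hx k)).ne' (hx k)

lemma marginal_scaledTensor_eq_zero {k : P.Γ} {a : Fin n} (h : P.μ k a = 0) :
    marginal (P.scaledTensor η u) k a = 0 :=
  Finset.sum_eq_zero fun x hx => scaledTensor_eq_zero (k := k) (by
    rw [(Finset.mem_filter.1 hx).2, h])

lemma marginal_scaledTensor_pos [NeZero n] (hu : ∀ k a, P.μ k a ≠ 0 → 0 < u k a) {k : P.Γ}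
    {a : Fin n} (h : P.μ k a ≠ 0) : 0 < marginal (P.scaledTensor η u) k a := by
  obtain ⟨x, hx⟩ := P.exists_valid
  have h1 := scaledTensor_pos (η := η) hu (hx.update h)
  have h2 := le_marginal (scaledTensor_nonneg (η := η) hu) k (Function.update x k a)
  simpa using h1.trans_le h2

/-- The slope of the dual objective, in terms of the residual. -/
lemma dual_sub_dual_le (hu : P.Admissible η ρ u) (hv : P.Admissible η ρ v) :
    P.dual v - P.dual u ≤ 2 * ρ * P.residual η u := by
  set w : P.Γ → Fin n → ℝ := fun k a => Real.log (v k a) - Real.log (u k a) with hw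
  have hgibbs := sum_mul_log_sub_log_le (scaledTensor_nonneg (η := η) hv.pos)
    (scaledTensor_nonneg (η := η) hu.pos) fun x hx => by
      by_contra h
      exact (scaledTensor_pos hv.pos (valid_of_scaledTensor_ne_zero h)).ne' hx
  rw [hu.mass, hv.mass, sub_self] at hgibbs
  have h1 : ∑ x, P.scaledTensor η u x *
      (Real.log (P.scaledTensor η v x) - Real.log (P.scaledTensor η u x)) =
      ∑ k : P.Γ, ∑ a, marginal (P.scaledTensor η u) k a * w k a := by
    simp only [sum_marginal_mul]
    rw [Finset.sum_comm]
    refine Finset.sum_congr rfl fun x _ => ?_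
    rw [← Finset.mul_sum]
    by_cases hx : P.Valid x
    · rw [log_scaledTensor hu.pos hx, log_scaledTensor hv.pos hx, add_sub_add_left_eq_sub,
        ← Finset.sum_sub_distrib]
      congr 1
      refine Finset.sum_congr rfl fun k _ => ?_
      rw [Real.log_mul (hv.pos k _ (hx k)).ne' (hx k), Real.log_mul (hu.pos k _ (hx k)).ne' (hx k)]
      ring
    · rw [scaledTensor_eq_zero' hx, zero_mul, zero_mul]
  have h2 : P.dual v - P.dual u = ∑ k, ∑ a, P.μ k a * w k a := by
    simp only [dual, hw, mul_sub, Finset.sum_sub_distrib]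
  have h3 : ∀ k : P.Γ, ∑ a, P.μ k a * w k a - ∑ a, marginal (P.scaledTensor η u) k a * w k a ≤
      2 * ρ * ∑ a, |marginal (P.scaledTensor η u) k a - P.μ k a| := by
    intro k
    obtain ⟨b, hb⟩ := P.exists_mu_ne_zero k
    have h4 : ∑ a, P.μ k a * w k a - ∑ a, marginal (P.scaledTensor η u) k a * w k a =
        ∑ a, (P.μ k a - marginal (P.scaledTensor η u) k a) * (w k a - w k b) := by
      simp only [sub_mul, mul_sub, Finset.sum_sub_distrib, ← Finset.sum_mul, sum_marginal, hu.mass,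
        P.μ_sum]
      ring
    rw [h4, Finset.mul_sum]
    refine Finset.sum_le_sum fun a _ => ?_
    by_cases ha : P.μ k a = 0
    · rw [ha, marginal_scaledTensor_eq_zero ha]
      simp
    · have hlog : ∀ {u : P.Γ → Fin n → ℝ}, P.Admissible η ρ u → ∀ {a b}, P.μ k a ≠ 0 →
          P.μ k b ≠ 0 → Real.log (u k a) ≤ ρ + Real.log (u k b) := by
        intro u hu a b ha hb
        rw [← Real.log_exp ρ, ← Real.log_mul (Real.exp_pos _).ne' (hu.pos k b hb).ne']
        exact Real.log_le_log (hu.pos k a ha) (hu.osc k a b ha hb)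
      have hle : |w k a - w k b| ≤ 2 * ρ := by
        rw [abs_le]
        constructor <;> simp only [hw] <;>
          linarith [hlog hu ha hb, hlog hu hb ha, hlog hv ha hb, hlog hv hb ha]
      calc _ ≤ |(P.μ k a - marginal (P.scaledTensor η u) k a) * (w k a - w k b)| := le_abs_self _
        _ = |w k a - w k b| * |marginal (P.scaledTensor η u) k a - P.μ k a| := by
          rw [abs_mul, mul_comm, abs_sub_comm (P.μ k a)]
        _ ≤ _ := mul_le_mul_of_nonneg_right hle (abs_nonneg _)
  have h5 := Finset.sum_le_sum fun k (_ : k ∈ Finset.univ) => h3 k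
  rw [Finset.sum_sub_distrib, ← Finset.mul_sum] at h5
  rw [h1] at hgibbs
  rw [h2, residual]
  linarith

lemma bddAbove_dual (hu : P.Admissible η ρ u) :
    BddAbove (P.dual '' {v | P.Admissible η ρ v}) := by
  refine ⟨P.dual u + 2 * ρ * P.residual η u, ?_⟩
  rintro _ ⟨v, hv, rfl⟩
  linarith [dual_sub_dual_le hu hv]

lemma gap_nonneg (hu : P.Admissible η ρ u) : 0 ≤ P.gap η ρ u :=
  sub_nonneg.2 (le_csSup (bddAbove_dual hu) ⟨u, hu, rfl⟩)

lemma gap_le (hu : P.Admissible η ρ u) : P.gap η ρ u ≤ 2 * ρ * P.residual η u := by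
  rw [gap, sub_le_iff_le_add]
  refine csSup_le ⟨_, u, hu, rfl⟩ ?_
  rintro _ ⟨v, hv, rfl⟩
  linarith [dual_sub_dual_le hu hv]

namespace IsSinkhornUpdate

variable {k : P.Γ}

lemma eq_div [NeZero n] (h : P.IsSinkhornUpdate η k u u')
    (hu : ∀ k a, P.μ k a ≠ 0 → 0 < u k a) {a : Fin n} (ha : P.μ k a ≠ 0) :
    u' k a = u k a * P.μ k a / marginal (P.scaledTensor η u) k a := by
  rw [eq_div_iff (marginal_scaledTensor_pos hu ha).ne', h.mul_marginal a ha]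

lemma scaledTensor_mul (h : P.IsSinkhornUpdate η k u u') (x : Fin m → Fin n) :
    P.scaledTensor η u' x * marginal (P.scaledTensor η u) k (x k) =
      P.scaledTensor η u x * P.μ k (x k) := by
  classical
  by_cases hx : P.Valid x
  · simp only [scaledTensor]
    rw [← Finset.mul_prod_erase _ _ (Finset.mem_univ k),
      ← Finset.mul_prod_erase _ _ (Finset.mem_univ k), Finset.prod_congr rfl fun j hj => by
        rw [h.of_ne j (Finset.ne_of_mem_erase hj)]]
    linear_combination Real.exp (-P.cost x / η) * P.μ k (x k) *
      (∏ j ∈ Finset.univ.erase k, u j (x j) * P.μ j (x j)) * h.mul_marginal _ (hx k)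
  · rw [scaledTensor_eq_zero' hx, scaledTensor_eq_zero' hx, zero_mul, zero_mul]

lemma marginal_eq [NeZero n] (h : P.IsSinkhornUpdate η k u u')
    (hu : ∀ k a, P.μ k a ≠ 0 → 0 < u k a) (a : Fin n) :
    marginal (P.scaledTensor η u') k a = P.μ k a := by
  by_cases ha : P.μ k a = 0
  · rw [ha, marginal_scaledTensor_eq_zero ha]
  · have hpos := marginal_scaledTensor_pos (η := η) hu ha
    refine mul_right_cancel₀ hpos.ne' ?_
    rw [marginal, Finset.sum_mul, mul_comm (P.μ k a), marginal, Finset.sum_mul]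
    refine Finset.sum_congr rfl fun x hx => ?_
    have := h.scaledTensor_mul x
    rwa [(Finset.mem_filter.1 hx).2] at this

lemma mass [NeZero n] (h : P.IsSinkhornUpdate η k u u')
    (hu : ∀ k a, P.μ k a ≠ 0 → 0 < u k a) : ∑ x, P.scaledTensor η u' x = 1 := by
  rw [← sum_marginal _ (k : Fin m), ← P.μ_sum k]
  exact Finset.sum_congr rfl fun a _ => h.marginal_eq hu a

/-- After an update the scaling vector of `k` is a reciprocal of a sum of exponentials of the costs,
hence its oscillation is controlled by that of the cost in the coordinate `k`. -/
lemma osc [NeZero n] (h : P.IsSinkhornUpdate η k u u')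
    (hu : ∀ k a, P.μ k a ≠ 0 → 0 < u k a) {R : ℝ} (hη : 0 < η)
    (hR : ∀ (k : P.Γ) x a, P.cost (Function.update x k a) ≤ P.cost x + R)
    (hosc : ∀ k a b, P.μ k a ≠ 0 → P.μ k b ≠ 0 → u k a ≤ Real.exp (R / η) * u k b)
    (j : P.Γ) (a b : Fin n) (ha : P.μ j a ≠ 0) (hb : P.μ j b ≠ 0) :
    u' j a ≤ Real.exp (R / η) * u' j b := by
  classical
  by_cases hj : j = k
  · subst hj
    rw [h.eq_div hu ha, h.eq_div hu hb, ← mul_div_assoc,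
      div_le_div_iff₀ (marginal_scaledTensor_pos hu ha) (marginal_scaledTensor_pos hu hb)]
    have hμa : 0 < P.μ j a := (P.μ_nonneg _ _).lt_of_ne' ha
    have hμb : 0 < P.μ j b := (P.μ_nonneg _ _).lt_of_ne' hb
    rw [marginal, marginal, Finset.mul_sum, Finset.mul_sum]
    refine le_of_le_of_eq (b := ∑ x with x j = b, Real.exp (R / η) * (u j b * P.μ j b) *
      P.scaledTensor η u (Function.update x j a)) ?_ ?_
    · refine Finset.sum_le_sum fun x hx => ?_
      have hxb : x j = b := (Finset.mem_filter.1 hx).2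
      have hexp : Real.exp (-P.cost x / η) ≤
          Real.exp (R / η) * Real.exp (-P.cost (Function.update x j a) / η) := by
        rw [← Real.exp_add, Real.exp_le_exp, ← add_div]
        exact div_le_div_of_nonneg_right (by linarith [hR j x a]) hη.le
      simp only [scaledTensor]
      rw [← Finset.mul_prod_erase _ _ (Finset.mem_univ j),
        ← Finset.mul_prod_erase _ _ (Finset.mem_univ j)]
      have hrest : ∏ i ∈ Finset.univ.erase j, (u i (Function.update x (j : Fin m) a i) *
          P.μ i (Function.update x (j : Fin m) a i)) =
          ∏ i ∈ Finset.univ.erase j, (u i (x i) * P.μ i (x i)) :=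
        Finset.prod_congr rfl fun i hi => by
          rw [Function.update_of_ne fun hij => Finset.ne_of_mem_erase hi (Subtype.ext hij)]
      rw [hrest, Function.update_self, hxb]
      set W := ∏ i ∈ Finset.univ.erase j, (u i (x i) * P.μ i (x i))
      by_cases hW0 : 0 ≤ W
      · have hc : 0 ≤ u j a * P.μ j a * (u j b * P.μ j b) * W :=
          mul_nonneg (mul_pos (mul_pos (hu j a ha) hμa) (mul_pos (hu j b hb) hμb)).le hW0
        nlinarith [mul_le_mul_of_nonneg_left hexp hc]
      · exfalso
        refine hW0 (Finset.prod_nonneg fun i _ => ?_)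
        by_cases hi : P.μ i (x i) = 0
        · rw [hi, mul_zero]
        · exact mul_nonneg (hu i _ hi).le (P.μ_nonneg _ _)
    · refine Finset.sum_nbij' (fun x => Function.update x (j : Fin m) a)
        (fun x => Function.update x (j : Fin m) b) ?_ ?_ ?_ ?_ ?_
      · simp
      · simp
      · intro x hx
        rw [Function.update_idem, ← (Finset.mem_filter.1 hx).2, Function.update_eq_self]
      · intro x hx
        rw [Function.update_idem, ← (Finset.mem_filter.1 hx).2, Function.update_eq_self]
      · intro x _; rfl
  · rw [h.of_ne j hj]
    exact hosc j a b ha hb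

/-- An update increases the dual objective by the relative entropy of the corrected marginal. -/
lemma le_dual [NeZero n] (h : P.IsSinkhornUpdate η k u u')
    (hu : ∀ k a, P.μ k a ≠ 0 → 0 < u k a) (hmass : ∑ x, P.scaledTensor η u x = 1) :
    P.dual u + (∑ a, |marginal (P.scaledTensor η u) k a - P.μ k a|) ^ 2 / 4 ≤ P.dual u' := by
  have hne : ∀ a, marginal (P.scaledTensor η u) k a = 0 → P.μ k a = 0 := fun a h0 => by
    by_contra ha
    exact (marginal_scaledTensor_pos (η := η) hu ha).ne' h0
  have hpinsker := sq_sum_abs_sub_le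
    (fun a => marginal_nonneg (scaledTensor_nonneg (η := η) hu) k a) (P.μ_nonneg k) hne
    (by rw [sum_marginal, hmass]) (P.μ_sum k)
  have hdual : P.dual u' - P.dual u = ∑ a, P.μ k a *
      (Real.log (P.μ k a) - Real.log (marginal (P.scaledTensor η u) k a)) := by
    unfold dual
    rw [← Finset.sum_sub_distrib, Finset.sum_eq_single k, ← Finset.sum_sub_distrib]
    · refine Finset.sum_congr rfl fun a _ => ?_
      by_cases ha : P.μ k a = 0
      · simp [ha]
      · rw [h.eq_div hu ha, Real.log_div (mul_ne_zero (hu k a ha).ne' ha)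
          (marginal_scaledTensor_pos hu ha).ne', Real.log_mul (hu k a ha).ne' ha]
        ring
    · intro j _ hj
      rw [h.of_ne j hj, sub_self]
    · simp
  linarith

end IsSinkhornUpdate

end GraphMOT

/-! ### Rounding -/

section RoundTensor

variable {m n : ℕ}

/-- Rounding of a tensor in the coordinate `k`: its entries are scaled by `keep`, and the lost mass
is put back as a product with the vector `dir`. -/
noncomputable def roundTensor (k : Fin m) (keep dir : Fin n → ℝ) (B : (Fin m → Fin n) → ℝ)
    (x : Fin m → Fin n) : ℝ :=
  B x * keep (x k) + sumOut {k} (fun x => B x - B x * keep (x k)) x * dir (x k)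

/-- The factors by which a vector `p` is scaled down to `min p ν`. -/
noncomputable def keepFactor (p ν : Fin n → ℝ) (a : Fin n) : ℝ := min (ν a / p a) 1

/-- What is missing in `min p ν` compared to `ν`. -/
noncomputable def deficit (p ν : Fin n → ℝ) (a : Fin n) : ℝ := ν a - keepFactor p ν a * p a

/-- The normalized deficit, which is zero if there is no deficit at all. -/
noncomputable def refill (p ν : Fin n → ℝ) (a : Fin n) : ℝ := deficit p ν a / ∑ b, deficit p ν b

section Vectors

variable {p ν : Fin n → ℝ}

lemma keepFactor_mul (hp : ∀ a, 0 ≤ p a) (hν : ∀ a, 0 ≤ ν a) (a : Fin n) :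
    keepFactor p ν a * p a = min (ν a) (p a) := by
  unfold keepFactor
  rcases (hp a).eq_or_lt with h | h
  · rw [← h, mul_zero, min_eq_right (hν a)]
  · rw [min_mul_of_nonneg _ _ h.le, div_mul_cancel₀ _ h.ne', one_mul]

lemma keepFactor_nonneg (hp : ∀ a, 0 ≤ p a) (hν : ∀ a, 0 ≤ ν a) (a : Fin n) :
    0 ≤ keepFactor p ν a :=
  le_min (div_nonneg (hν a) (hp a)) zero_le_one

lemma keepFactor_le_one (a : Fin n) : keepFactor p ν a ≤ 1 := min_le_right _ _

lemma deficit_nonneg (hp : ∀ a, 0 ≤ p a) (hν : ∀ a, 0 ≤ ν a) (a : Fin n) :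
    0 ≤ deficit p ν a := by
  rw [deficit, keepFactor_mul hp hν]
  exact sub_nonneg.2 (min_le_left _ _)

lemma deficit_le_abs (hp : ∀ a, 0 ≤ p a) (hν : ∀ a, 0 ≤ ν a) (a : Fin n) :
    deficit p ν a ≤ |p a - ν a| := by
  rw [deficit, keepFactor_mul hp hν]
  rcases le_total (ν a) (p a) with h | h
  · rw [min_eq_left h, sub_self]
    exact abs_nonneg _
  · rw [min_eq_right h, abs_sub_comm]
    exact le_abs_self _

lemma refill_nonneg (hp : ∀ a, 0 ≤ p a) (hν : ∀ a, 0 ≤ ν a) (a : Fin n) : 0 ≤ refill p ν a :=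
  div_nonneg (deficit_nonneg hp hν a) (Finset.sum_nonneg fun b _ => deficit_nonneg hp hν b)

lemma sum_deficit_mul_refill (hp : ∀ a, 0 ≤ p a) (hν : ∀ a, 0 ≤ ν a) (a : Fin n) :
    (∑ b, deficit p ν b) * refill p ν a = deficit p ν a := by
  by_cases h : ∑ b, deficit p ν b = 0
  · rw [h, zero_mul, (Finset.sum_eq_zero_iff_of_nonneg fun b _ => deficit_nonneg hp hν b).1 h a
      (Finset.mem_univ a)]
  · rw [refill, mul_div_cancel₀ _ h]

end Vectors

section RoundSpec

variable {k : Fin m} {p ν : Fin n → ℝ} {B : (Fin m → Fin n) → ℝ}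

lemma lost_nonneg (hB : ∀ x, 0 ≤ B x) (x : Fin m → Fin n) :
    0 ≤ B x - B x * keepFactor p ν (x k) := by
  have := mul_le_mul_of_nonneg_left (keepFactor_le_one (p := p) (ν := ν) (x k)) (hB x)
  linarith

lemma sum_lost (hBp : ∀ a, GraphMOT.marginal B k a = p a) (hsum : ∑ a, p a = ∑ a, ν a) :
    ∑ x, (B x - B x * keepFactor p ν (x k)) = ∑ a, deficit p ν a := by
  rw [Finset.sum_sub_distrib, ← sum_marginal_mul B k (keepFactor p ν), ← sum_marginal B k]
  simp only [hBp, deficit, Finset.sum_sub_distrib, hsum, mul_comm]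

lemma roundTensor_nonneg (hB : ∀ x, 0 ≤ B x) (hp : ∀ a, 0 ≤ p a) (hν : ∀ a, 0 ≤ ν a)
    (x : Fin m → Fin n) : 0 ≤ roundTensor k (keepFactor p ν) (refill p ν) B x :=
  add_nonneg (mul_nonneg (hB x) (keepFactor_nonneg hp hν _))
    (mul_nonneg (sumOut_nonneg (lost_nonneg hB) x) (refill_nonneg hp hν _))

/-- The lost mass is either redistributed along a probability vector, or there is none. -/
lemma sum_refill_or (hB : ∀ x, 0 ≤ B x) (hBp : ∀ a, GraphMOT.marginal B k a = p a)
    (hsum : ∑ a, p a = ∑ a, ν a) :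
    ∑ a, refill p ν a = 1 ∨ ∀ x, B x - B x * keepFactor p ν (x k) = 0 := by
  by_cases h : ∑ b, deficit p ν b = 0
  · right
    intro x
    rw [← sum_lost hBp hsum] at h
    exact (Finset.sum_eq_zero_iff_of_nonneg fun x _ => lost_nonneg hB x).1 h x (Finset.mem_univ x)
  · left
    simp only [refill]
    rw [← Finset.sum_div, div_self h]

lemma sumOut_singleton_roundTensor (hB : ∀ x, 0 ≤ B x)
    (hBp : ∀ a, GraphMOT.marginal B k a = p a) (hsum : ∑ a, p a = ∑ a, ν a) :
    sumOut {k} (roundTensor k (keepFactor p ν) (refill p ν) B) = sumOut {k} B := by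
  funext x
  have h1 : sumOut {k} (fun x => sumOut {k} (fun x => B x - B x * keepFactor p ν (x k)) x *
      refill p ν (x k)) x = sumOut {k} (fun x => B x - B x * keepFactor p ν (x k)) x := by
    rw [sumOut_mul_left fun x' hx' => sumOut_eq_of_agree _ hx']
    rcases sum_refill_or hB hBp hsum with h | h
    · rw [sumOut_singleton k fun x => refill p ν (x k)]
      simp [h]
    · simp [h, sumOut]
  unfold roundTensor
  rw [sumOut_add, h1, ← sumOut_add]
  simp

/-- Rounding in the coordinate `k` does not affect the projection on other coordinates. -/
lemma sumOut_roundTensor_of_mem (hB : ∀ x, 0 ≤ B x)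
    (hBp : ∀ a, GraphMOT.marginal B k a = p a) (hsum : ∑ a, p a = ∑ a, ν a)
    {t : Finset (Fin m)} (hk : k ∈ t) :
    sumOut t (roundTensor k (keepFactor p ν) (refill p ν) B) = sumOut t B := by
  have ht : t = t.erase k ∪ {k} := by
    ext i
    by_cases hi : i = k <;> simp [hi, hk]
  rw [ht, ← sumOut_sumOut (by simp), ← sumOut_sumOut (by simp),
    sumOut_singleton_roundTensor hB hBp hsum]

/-- Rounding in the coordinate `k` commutes with projections that keep this coordinate. -/
lemma sumOut_roundTensor_of_notMem {keep dir : Fin n → ℝ} {t : Finset (Fin m)} (hk : k ∉ t)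
    (x : Fin m → Fin n) : sumOut t (roundTensor k keep dir B) x =
      sumOut t B x * keep (x k) +
        sumOut {k} (fun x => sumOut t B x - sumOut t B x * keep (x k)) x * dir (x k) := by
  have h1 : ∀ (f : (Fin m → Fin n) → ℝ) (g : Fin n → ℝ) (x : Fin m → Fin n),
      sumOut t (fun x => f x * g (x k)) x = sumOut t f x * g (x k) := by
    intro f g x
    rw [mul_comm, ← sumOut_mul_left (h := fun x => g (x k)) fun x' hx' => by rw [hx' k hk]]
    exact sumOut_congr fun _ _ => mul_comm _ _
  unfold roundTensor
  rw [sumOut_add, h1, h1, sumOut_sumOut (by simpa using hk), Finset.union_comm,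
    ← sumOut_sumOut (by simpa using hk)]
  congr 3
  funext y
  rw [sumOut_sub, h1]

lemma marginal_roundTensor_self [NeZero n] (hB : ∀ x, 0 ≤ B x)
    (hBp : ∀ a, GraphMOT.marginal B k a = p a)
    (hν : ∀ a, 0 ≤ ν a) (hsum : ∑ a, p a = ∑ a, ν a) (a : Fin n) :
    GraphMOT.marginal (roundTensor k (keepFactor p ν) (refill p ν) B) k a = ν a := by
  have hp : ∀ a, 0 ≤ p a := fun a => hBp a ▸ marginal_nonneg hB k a
  have h := marginal_apply_eq_sumOut (roundTensor k (keepFactor p ν) (refill p ν) B) k fun _ => a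
  rw [sumOut_roundTensor_of_notMem (by simp), ← marginal_apply_eq_sumOut, hBp,
    sumOut_singleton] at h
  have h2 : ∑ b, (sumOut {k}ᶜ B (Function.update (fun _ => a) k b) -
      sumOut {k}ᶜ B (Function.update (fun _ => a) k b) *
        keepFactor p ν (Function.update (fun _ : Fin m => a) k b k)) = ∑ b, deficit p ν b := by
    simp only [← marginal_apply_eq_sumOut, Function.update_self, hBp, deficit,
      Finset.sum_sub_distrib, hsum, mul_comm]
  rw [h2, sum_deficit_mul_refill hp hν, deficit] at h
  rw [h]
  ring

lemma marginal_roundTensor_of_ne [NeZero n] (hB : ∀ x, 0 ≤ B x)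
    (hBp : ∀ a, GraphMOT.marginal B k a = p a)
    (hsum : ∑ a, p a = ∑ a, ν a) {j : Fin m} (hj : j ≠ k) (a : Fin n) :
    GraphMOT.marginal (roundTensor k (keepFactor p ν) (refill p ν) B) j a =
      GraphMOT.marginal B j a := by
  have h := marginal_apply_eq_sumOut (roundTensor k (keepFactor p ν) (refill p ν) B) j fun _ => a
  rwa [sumOut_roundTensor_of_mem hB hBp hsum (by simpa using hj.symm),
    ← marginal_apply_eq_sumOut] at h

lemma sum_mul_roundTensor_le (hB : ∀ x, 0 ≤ B x) (hBp : ∀ a, GraphMOT.marginal B k a = p a)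
    (hν : ∀ a, 0 ≤ ν a) (hsum : ∑ a, p a = ∑ a, ν a) {C : (Fin m → Fin n) → ℝ} {R : ℝ}
    (hC : ∀ x a, C (Function.update x k a) ≤ C x + R) :
    ∑ x, C x * roundTensor k (keepFactor p ν) (refill p ν) B x ≤
      ∑ x, C x * B x + R * ∑ a, deficit p ν a := by
  have hp : ∀ a, 0 ≤ p a := fun a => hBp a ▸ marginal_nonneg hB k a
  set L : (Fin m → Fin n) → ℝ := fun x => B x - B x * keepFactor p ν (x k) with hL
  have h1 : ∑ x, C x * roundTensor k (keepFactor p ν) (refill p ν) B x =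
      ∑ x, C x * B x - ∑ x, C x * L x +
        ∑ x, L x * ∑ a, C (Function.update x k a) * refill p ν a := by
    have h2 : ∑ x, L x * ∑ a, C (Function.update x k a) * refill p ν a =
        ∑ x, (C x * refill p ν (x k)) * sumOut {k} L x := by
      rw [sum_mul_sumOut]
      refine Finset.sum_congr rfl fun x _ => ?_
      rw [sumOut_singleton]
      simp
    rw [h2, ← Finset.sum_sub_distrib, ← Finset.sum_add_distrib]
    refine Finset.sum_congr rfl fun x _ => ?_
    simp only [roundTensor, hL]
    ring
  have h3 : ∑ x, L x * ∑ a, C (Function.update x k a) * refill p ν a ≤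
      ∑ x, L x * (C x + R) := by
    refine Finset.sum_le_sum fun x _ => ?_
    rcases sum_refill_or hB hBp hsum with h | h
    · refine mul_le_mul_of_nonneg_left ?_ (lost_nonneg hB x)
      calc _ ≤ ∑ a, (C x + R) * refill p ν a := Finset.sum_le_sum fun a _ =>
            mul_le_mul_of_nonneg_right (hC x a) (refill_nonneg hp hν a)
        _ = C x + R := by rw [← Finset.mul_sum, h, mul_one]
    · simp [hL, h]
  have h4 : ∑ x, L x * (C x + R) = ∑ x, C x * L x + R * ∑ a, deficit p ν a := by
    rw [← sum_lost hBp hsum, Finset.mul_sum, ← Finset.sum_add_distrib]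
    exact Finset.sum_congr rfl fun x _ => by simp only [hL]; ring
  linarith

/-- Rounding of a cluster projection is the cluster projection of the rounded tensor. -/
lemma roundCoordinate_val {s : Finset (Fin m)} (hk : k ∈ s) {keep dir : Fin n → ℝ} {F : Table n s}
    (hF : ∀ x, F (s.restrict x) = sumOut sᶜ B x) (x : Fin m → Fin n) :
    (LeafSplitting.roundCoordinate k hk keep dir F).val (s.restrict x) =
      sumOut sᶜ (roundTensor k keep dir B) x := by
  rw [sumOut_roundTensor_of_notMem (by simpa using hk)]
  simp only [← hF]
  have hsd : s \ s.erase k = {k} := by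
    ext i
    by_cases hi : i = k <;> simp [hi, hk]
  have h := project_val_restrict (Finset.erase_subset k s)
    (fun y => F y - F y * keep (y ⟨k, hk⟩)) x
  rw [hsd] at h
  exact congrArg (fun z => F (s.restrict x) * keep (x k) + z * dir (x k)) h

end RoundSpec

end RoundTensor

namespace GraphMOT

variable {m n : ℕ} {P : GraphMOT m n}

/-- Successive rounding in the coordinates of a list, from the marginals `p` to the marginals
`ν`. -/
noncomputable def roundList (P : GraphMOT m n) (p ν : P.Γ → Fin n → ℝ) (l : List P.Γ)
    (B : (Fin m → Fin n) → ℝ) : (Fin m → Fin n) → ℝ :=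
  l.foldl (fun B (k : P.Γ) =>
    roundTensor (k : Fin m) (keepFactor (p k) (ν k)) (refill (p k) (ν k)) B) B

lemma roundList_spec [NeZero n] {p ν : P.Γ → Fin n → ℝ} (hν : ∀ k a, 0 ≤ ν k a)
    (hsum : ∀ k, ∑ a, p k a = ∑ a, ν k a) {R : ℝ}
    (hR0 : 0 ≤ R) (hR : ∀ (k : P.Γ) x a, P.cost (Function.update x k a) ≤ P.cost x + R)
    (l : List P.Γ) (hl : l.Nodup) {B : (Fin m → Fin n) → ℝ} (hB : ∀ x, 0 ≤ B x)
    (hBp : ∀ k ∈ l, ∀ a, marginal B k a = p k a) :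
    (∀ x, 0 ≤ P.roundList p ν l B x) ∧
      (∀ k ∈ l, ∀ a, marginal (P.roundList p ν l B) k a = ν k a) ∧
      (∀ k : P.Γ, k ∉ l → ∀ a, marginal (P.roundList p ν l B) k a = marginal B k a) ∧
      P.totalCost (P.roundList p ν l B) ≤
        P.totalCost B + R * (l.map fun k => ∑ a, |p k a - ν k a|).sum := by
  induction l generalizing B with
  | nil => exact ⟨hB, by simp, fun _ _ _ => rfl, by simp [roundList]⟩
  | cons k l ih =>
    obtain ⟨hkl, hl⟩ := List.nodup_cons.1 hl
    have hk := hBp k (by simp)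
    have hp : ∀ a, 0 ≤ p k a := fun a => hk a ▸ marginal_nonneg hB k a
    have hB' := roundTensor_nonneg (k := (k : Fin m)) hB hp (hν k)
    have hne : ∀ j ∈ l, (j : Fin m) ≠ k := fun j hj h => hkl (Subtype.ext h ▸ hj)
    obtain ⟨h1, h2, h3, h4⟩ := ih hl hB' fun j hj a => by
      rw [marginal_roundTensor_of_ne hB hk (hsum k) (hne j hj), hBp j (by simp [hj])]
    refine ⟨h1, fun j hj a => ?_, fun j hj a => ?_, ?_⟩
    · rcases List.mem_cons.1 hj with rfl | hj
      · exact (h3 j hkl a).trans (marginal_roundTensor_self hB hk (hν j) (hsum j) a)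
      · exact h2 j hj a
    · rw [List.mem_cons, not_or] at hj
      exact (h3 j hj.2 a).trans
        (marginal_roundTensor_of_ne hB hk (hsum k) (fun h => hj.1 (Subtype.ext h)) a)
    · refine h4.trans ?_
      have h5 := sum_mul_roundTensor_le hB hk (hν k) (hsum k) (hR k)
      have h6 : R * ∑ a, deficit (p k) (ν k) a ≤ R * ∑ a, |p k a - ν k a| :=
        mul_le_mul_of_nonneg_left
          (Finset.sum_le_sum fun a _ => deficit_le_abs hp (hν k) a) hR0
      rw [List.map_cons, List.sum_cons, mul_add]
      unfold totalCost
      linarith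

lemma exists_rounding [NeZero n] {p ν : P.Γ → Fin n → ℝ} (hν : ∀ k a, 0 ≤ ν k a)
    (hsum : ∀ k, ∑ a, p k a = ∑ a, ν k a) {R : ℝ}
    (hR0 : 0 ≤ R) (hR : ∀ (k : P.Γ) x a, P.cost (Function.update x k a) ≤ P.cost x + R)
    {B : (Fin m → Fin n) → ℝ} (hB : ∀ x, 0 ≤ B x) (hBp : ∀ (k : P.Γ) a, marginal B k a = p k a) :
    (∀ x, 0 ≤ P.roundList p ν Finset.univ.toList B x) ∧
      (∀ (k : P.Γ) a, marginal (P.roundList p ν Finset.univ.toList B) k a = ν k a) ∧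
      P.totalCost (P.roundList p ν Finset.univ.toList B) ≤
        P.totalCost B + R * ∑ k, ∑ a, |p k a - ν k a| := by
  obtain ⟨h1, h2, -, h4⟩ := roundList_spec hν hsum hR0 hR Finset.univ.toList
    (Finset.nodup_toList _) hB fun k _ => hBp k
  refine ⟨h1, fun k => h2 k (by simp), ?_⟩
  rwa [Finset.sum_map_toList] at h4

/-! ### Approximate optimality -/

/-- A scaled tensor minimizes the entropically regularized cost among the tensors with the same
marginals, and the entropy of a tensor of mass one is at most `m log n`. -/
lemma totalCost_scaledTensor_le [NeZero n] {η : ℝ} (hη : 0 < η) {u : P.Γ → Fin n → ℝ}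
    (hu : ∀ k a, P.μ k a ≠ 0 → 0 < u k a) (hmass : ∑ x, P.scaledTensor η u x = 1)
    {B : (Fin m → Fin n) → ℝ} (hB : ∀ x, 0 ≤ B x) (hB1 : ∑ x, B x = 1)
    (hmarg : ∀ (k : P.Γ) a, marginal B k a = marginal (P.scaledTensor η u) k a) :
    P.totalCost (P.scaledTensor η u) ≤ P.totalCost B + η * (m * Real.log n) := by
  set D := P.scaledTensor η u with hD
  have hD0 : ∀ x, 0 ≤ D x := scaledTensor_nonneg hu
  have hsupp : ∀ x, D x = 0 → B x = 0 := by
    intro x hx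
    by_contra h
    refine (scaledTensor_pos (η := η) hu fun k => ?_).ne' hx
    intro hk
    have h1 := le_marginal hB k x
    rw [hmarg, hD, marginal_scaledTensor_eq_zero hk] at h1
    exact h (le_antisymm h1 (hB x))
  have hlin : ∀ B' : (Fin m → Fin n) → ℝ, (∀ x, D x = 0 → B' x = 0) →
      ∑ x, B' x * Real.log (D x) = -P.totalCost B' / η +
        ∑ k : P.Γ, ∑ a, marginal B' k a * Real.log (u k a * P.μ k a) := by
    intro B' hB'
    have h1 : ∀ x, B' x * Real.log (D x) = -(P.cost x * B' x) / η +
        ∑ k : P.Γ, B' x * Real.log (u k (x k) * P.μ k (x k)) := by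
      intro x
      by_cases hx : P.Valid x
      · rw [hD, log_scaledTensor hu hx, ← Finset.mul_sum]
        ring
      · have : B' x = 0 := hB' x (scaledTensor_eq_zero' hx)
        simp [this]
    simp only [h1, Finset.sum_add_distrib, totalCost]
    rw [← Finset.sum_div, Finset.sum_neg_distrib, Finset.sum_comm]
    congr 1
    exact Finset.sum_congr rfl fun k _ =>
      (sum_marginal_mul B' k fun a => Real.log (u k a * P.μ k a)).symm
  have hlinB := hlin B hsupp
  have hlinD := hlin D fun x hx => hx
  simp only [hmarg] at hlinB
  -- The relative entropy of `B` with respect to `D` is nonnegative, and so is the entropy of `B`.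
  have h1 : ∑ x, B x * Real.log (D x) ≤ 0 := by
    have hg := sum_mul_log_sub_log_le hD0 hB hsupp
    rw [hmass, hB1, sub_self] at hg
    simp only [mul_sub, Finset.sum_sub_distrib] at hg
    have hneg : ∑ x, B x * Real.log (B x) ≤ 0 := by
      refine Finset.sum_nonpos fun x _ => mul_nonpos_of_nonneg_of_nonpos (hB x) ?_
      refine Real.log_nonpos (hB x) ?_
      rw [← hB1]
      exact Finset.single_le_sum (f := B) (fun y _ => hB y) (Finset.mem_univ x)
    linarith
  -- The entropy of `D` is at most that of the uniform distribution.
  have h2 : -(m * Real.log n) ≤ ∑ x, D x * Real.log (D x) := by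
    have hn : (0 : ℝ) < n := Nat.cast_pos.2 (Nat.pos_of_neZero n)
    have hg := sum_mul_log_sub_log_le (p := fun _ : Fin m → Fin n => ((n : ℝ) ^ m)⁻¹) (q := D)
      (fun _ => by positivity) hD0 fun x hx => absurd hx (by positivity)
    have hcard : ∑ _x : Fin m → Fin n, ((n : ℝ) ^ m)⁻¹ = 1 := by
      simp [hn.ne']
    rw [hcard, hmass, sub_self] at hg
    simp only [mul_sub, Finset.sum_sub_distrib, ← Finset.sum_mul, hmass, Real.log_inv,
      Real.log_pow, one_mul] at hg
    linarith
  have h3 : P.totalCost D / η ≤ P.totalCost B / η + m * Real.log n := by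
    rw [neg_div] at hlinB hlinD
    linarith
  have h4 := mul_le_mul_of_nonneg_left h3 hη.le
  rwa [mul_add, mul_div_cancel₀ _ hη.ne', mul_div_cancel₀ _ hη.ne'] at h4

/-- Rounding a scaled tensor gives an approximate solution. In the comparison with a plan, this plan
is itself rounded to the marginals of the scaled tensor. -/
lemma isApproxSolution_round [NeZero n] [Nonempty P.Γ] {η : ℝ} (hη : 0 < η)
    {u : P.Γ → Fin n → ℝ} (hu : ∀ k a, P.μ k a ≠ 0 → 0 < u k a)
    (hmass : ∑ x, P.scaledTensor η u x = 1) {R : ℝ} (hR0 : 0 ≤ R)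
    (hR : ∀ (k : P.Γ) x a, P.cost (Function.update x k a) ≤ P.cost x + R) {ε : ℝ}
    (hε : 2 * (R * P.residual η u) + η * (m * Real.log n) ≤ ε) :
    P.IsApproxSolution ε (P.roundList (fun k => marginal (P.scaledTensor η u) k) P.μ
      Finset.univ.toList (P.scaledTensor η u)) := by
  have hD0 := scaledTensor_nonneg (η := η) hu
  set D := P.scaledTensor η u
  have hsum : ∀ k : P.Γ, ∑ a, marginal D k a = ∑ a, P.μ k a := fun k => by
    rw [sum_marginal, hmass, P.μ_sum]
  obtain ⟨h1, h2, h3⟩ := exists_rounding (p := fun k : P.Γ => marginal D k) (ν := P.μ)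
    P.μ_nonneg hsum hR0 hR hD0 fun k a => rfl
  refine ⟨⟨h1, h2⟩, fun B' hB' => ?_⟩
  obtain ⟨h4, h5, h6⟩ := exists_rounding (p := P.μ) (ν := fun k : P.Γ => marginal D k)
    (fun (k : P.Γ) => marginal_nonneg hD0 k) (fun k => (hsum k).symm) hR0 hR hB'.1 hB'.2
  set B'' := P.roundList P.μ (fun k : P.Γ => marginal D k) Finset.univ.toList B'
  have hB1 : ∑ x, B'' x = 1 := by
    obtain ⟨k⟩ := ‹Nonempty P.Γ›
    rw [← sum_marginal _ (k : Fin m), ← hmass, ← sum_marginal D (k : Fin m)]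
    exact Finset.sum_congr rfl fun a _ => h5 k a
  have h7 : P.totalCost D ≤ P.totalCost B'' + η * (m * Real.log n) :=
    totalCost_scaledTensor_le hη hu hmass h4 hB1 h5
  simp only [abs_sub_comm (P.μ _ _)] at h6
  have h8 : P.residual η u = ∑ k : P.Γ, ∑ a, |marginal D k a - P.μ k a| := rfl
  rw [h8] at hε
  linarith

end GraphMOT

namespace LeafSplitting

variable {m n N : ℕ} {P : GraphMOT m n} {T : JunctionTree P.G N} (S : LeafSplitting P T)

lemma foldl_round_val (c : Fin N) (p ν : P.Γ → Fin n → ℝ) (l : List P.Γ) (hl : l.Nodup)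
    [NeZero n] (hν : ∀ k a, 0 ≤ ν k a) (hsum : ∀ k, ∑ a, p k a = ∑ a, ν k a)
    {B : (Fin m → Fin n) → ℝ} (hB : ∀ x, 0 ≤ B x)
    (hBp : ∀ k ∈ l, ∀ a, GraphMOT.marginal B k a = p k a)
    {F : Table n (T.bag c)} (hF : ∀ x, F ((T.bag c).restrict x) = sumOut (T.bag c)ᶜ B x)
    (x : Fin m → Fin n) :
    (l.foldlM (m := Counted) (fun F (k : P.Γ) => if hk : (k : Fin m) ∈ T.bag c
      then roundCoordinate (k : Fin m) hk (keepFactor (p k) (ν k)) (refill (p k) (ν k)) F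
      else pure F) F).val ((T.bag c).restrict x) =
      sumOut (T.bag c)ᶜ (P.roundList p ν l B) x := by
  induction l generalizing B F with
  | nil => exact hF x
  | cons k l ih =>
    obtain ⟨hkl, hl⟩ := List.nodup_cons.1 hl
    have hk := hBp k (by simp)
    have hp : ∀ a, 0 ≤ p k a := fun a => hk a ▸ marginal_nonneg hB k a
    have hne : ∀ j ∈ l, (j : Fin m) ≠ k := fun j hj h => hkl (Subtype.ext h ▸ hj)
    refine ih hl (roundTensor_nonneg (k := (k : Fin m)) hB hp (hν k)) (fun j hj a => ?_)
      fun y => ?_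
    · rw [marginal_roundTensor_of_ne hB hk (hsum k) (hne j hj), hBp j (by simp [hj])]
    · beta_reduce
      by_cases hkc : (k : Fin m) ∈ T.bag c
      · rw [dif_pos hkc]
        exact roundCoordinate_val hkc hF y
      · rw [dif_neg hkc, sumOut_roundTensor_of_mem hB hk (hsum k) (by simpa using hkc)]
        exact hF y

lemma round_val [NeZero n] {s : BPState P T} {B : (Fin m → Fin n) → ℝ} (hB : ∀ x, 0 ≤ B x)
    (hB1 : ∑ x, B x = 1) (hs : ∀ c x, s.gbel c x = sumOut (T.bag c)ᶜ B x) (c : Fin N)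
    (x : Fin m → Fin n) :
    (S.round s).val c ((T.bag c).restrict x) =
      sumOut (T.bag c)ᶜ
        (P.roundList (fun k => GraphMOT.marginal B k) P.μ Finset.univ.toList B) x := by
  have hp : (fun (k : P.Γ) a => s.bel (S.leaf k) fun _ => a) =
      fun (k : P.Γ) => GraphMOT.marginal B k := by
    funext k a
    have := hs (S.leaf k) fun _ => a
    rw [S.bag_leaf, ← marginal_apply_eq_sumOut] at this
    exact this
  have hp' : ∀ (k : P.Γ) a, GraphMOT.marginal B k a = s.bel (S.leaf k) fun _ => a :=
    fun k a => (congrFun (congrFun hp k) a).symm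
  rw [← hp, ← foldl_round_val c _ _ _ (Finset.nodup_toList _) P.μ_nonneg
    (fun k => by simp only [← hp']; rw [sum_marginal, hB1, P.μ_sum]) hB
    (fun k _ a => hp' k a) (hs c)]
  rfl

/-! ### The oscillation of the cost -/

lemma R_at_nonneg (k : P.Γ) : 0 ≤ S.R_at k :=
  Real.iSup_nonneg fun _ => Finset.sum_nonneg fun c _ => S.clusterCost_nonneg c _

lemma R_nonneg : 0 ≤ S.R := Real.iSup_nonneg S.R_at_nonneg

lemma cost_update_le (k : P.Γ) (x : Fin m → Fin n) (a : Fin n) :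
    P.cost (Function.update x k a) ≤ P.cost x + S.R := by
  classical
  have h1 : S.R_at k ≤ S.R := le_ciSup (f := S.R_at) (Set.finite_range _).bddAbove k
  refine le_trans ?_ (add_le_add_right h1 _)
  rw [← S.sum_clusterCost, ← S.sum_clusterCost]
  have h2 := le_ciSup (f := fun x : Fin m → Fin n => ∑ c with c = S.nbr k ∨
    (S.clusterCost c).DependsOn k, S.clusterCost c ((T.bag c).restrict x))
    (Set.finite_range _).bddAbove (Function.update x k a)
  refine le_trans ?_ (add_le_add_right h2 _)
  rw [← Finset.sum_filter_add_sum_filter_not Finset.univ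
    (fun c => c = S.nbr k ∨ (S.clusterCost c).DependsOn k), add_comm]
  refine add_le_add_left ?_ _
  refine le_trans (le_of_eq (Finset.sum_congr rfl fun c hc => ?_))
    (Finset.sum_le_univ_sum_of_nonneg fun c => S.clusterCost_nonneg c ((T.bag c).restrict x))
  by_contra hne
  exact (Finset.mem_filter.1 hc).2 (Or.inr ⟨_, _, fun i hi => Function.update_of_ne hi _ _, hne⟩)

end LeafSplitting

/-! ### The number of clusters and the number of operations -/

namespace JunctionTree

variable {m N : ℕ} {G : SimpleGraph (Fin m)} (T : JunctionTree G N)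

lemma dist_le_diam (c r : Fin N) : T.tree.dist c r ≤ T.tree.diam := by
  have : Nonempty (Fin N) := ⟨c⟩
  exact SimpleGraph.dist_le_diam (SimpleGraph.connected_iff_ediam_ne_top.1 T.isTree.connected)

lemma length_pathSchedule (c c' : Fin N) : (T.pathSchedule c c').length ≤ T.tree.diam := by
  rw [pathSchedule, List.length_map, SimpleGraph.Walk.length_darts, length_path]
  exact T.dist_le_diam c c'

lemma sum_length_layer_le (r : Fin N) :
    ((List.range N).map fun j => (T.layer r j).length).sum ≤ N := by
  have h1 : ∀ j, (T.layer r j).length =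
      (Finset.univ.filter fun c => T.tree.dist c r = j + 1).card := by
    intro j
    rw [layer, List.length_map, ← List.toFinset_card_of_nodup ((List.nodup_finRange N).filter _)]
    congr 1
    ext c
    simp
  rw [Finset.sum_list_map_count]
  simp only [h1]
  have h2 : ((List.range N).toFinset.sum fun j => (List.range N).count j •
      (Finset.univ.filter fun c => T.tree.dist c r = j + 1).card) =
      ∑ j ∈ Finset.range N, (Finset.univ.filter fun c => T.tree.dist c r = j + 1).card := by
    rw [List.toFinset_range]
    refine Finset.sum_congr rfl fun j hj => ?_
    rw [List.count_eq_one_of_mem List.nodup_range (by simpa using hj), one_smul]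
  rw [h2, ← Finset.card_biUnion]
  · exact (Finset.card_le_univ _).trans (by simp)
  · intro i _ j _ hij
    change Disjoint _ _
    rw [Finset.disjoint_left]
    intro c hc hc'
    simp only [Finset.mem_filter, Finset.mem_univ, true_and] at hc hc'
    omega

lemma length_collectSchedule (r : Fin N) : (T.collectSchedule r).length ≤ N := by
  rw [collectSchedule, List.length_flatMap, List.map_reverse, List.sum_reverse]
  exact T.sum_length_layer_le r

lemma length_distributeSchedule (r : Fin N) : (T.distributeSchedule r).length ≤ N := by
  rw [distributeSchedule, List.length_flatMap]
  simpa using T.sum_length_layer_le r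

end JunctionTree

namespace LeafSplitting

variable {m n N : ℕ} {P : GraphMOT m n} {T : JunctionTree P.G N} (S : LeafSplitting P T)

/-- Every cluster lies on the path from some leaf to a fixed cluster `r`. -/
lemma exists_leaf_path (k₀ : P.Γ) (c : Fin N) :
    ∃ k, c ∈ (T.path (S.leaf k) (S.leaf k₀)).support := by
  classical
  set r := S.leaf k₀ with hr
  obtain ⟨v, hv, hmax⟩ := Finset.exists_max_image
    (Finset.univ.filter fun v => c ∈ (T.path v r).support) (fun v => T.tree.dist v r) ⟨c, by simp⟩
  simp only [Finset.mem_filter, Finset.mem_univ, true_and] at hv hmax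
  by_cases hvr : v = r
  · exact ⟨k₀, by rw [← hr, ← hvr]; rwa [hvr] at hv ⊢⟩
  obtain ⟨d, hvd, p, hp⟩ := T.exists_adj_walk hvr
  -- A further neighbour of `v` would continue the path away from `r`.
  have huniq : ∀ d', T.tree.Adj v d' → d' = d := by
    intro d' hd'
    rcases T.toward_or_away hd' r with ⟨q, hq⟩ | ⟨q, hq⟩
    · rw [← T.snd_path_eq hd' q hq, T.snd_path_eq hvd p hp]
    · exfalso
      have hq' : d' ∉ (T.path v r).support := by
        rw [← T.eq_path q.bypass_isPath]
        exact fun h => hq (q.support_bypass_subset_support h)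
      have h1 := T.dist_eq_succ hd'.symm _ hq'
      have h2 : T.path d' r = SimpleGraph.Walk.cons hd'.symm (T.path v r) :=
        (T.eq_path ((SimpleGraph.Walk.cons_isPath_iff _ _).2 ⟨T.isPath_path v r, hq'⟩)).symm
      have h3 := hmax d' (by
        rw [h2, SimpleGraph.Walk.support_cons]
        exact List.mem_cons_of_mem _ hv)
      omega
  obtain ⟨k, hk⟩ := (S.isLeaf_iff v).1 ⟨d, hvd, huniq⟩
  exact ⟨k, by rwa [hk]⟩

/-- A cluster is determined by a leaf whose path to a fixed leaf contains it, and by its distance to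
the latter. -/
lemma card_clusters_le (S : LeafSplitting P T) (k₀ : P.Γ) : N ≤ P.Γ.card * (T.tree.diam + 1) := by
  classical
  choose f hf using S.exists_leaf_path k₀
  have hdist : ∀ c, T.tree.dist c (S.leaf k₀) < T.tree.diam + 1 := fun c =>
    Nat.lt_succ_of_le (T.dist_le_diam c _)
  have hinj : Function.Injective fun c => (f c, (⟨_, hdist c⟩ : Fin (T.tree.diam + 1))) := by
    intro c c' h
    simp only [Prod.mk.injEq, Fin.mk.injEq] at h
    have key : ∀ c (hc : c ∈ (T.path (S.leaf (f c)) (S.leaf k₀)).support),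
        c = (T.path (S.leaf (f c)) (S.leaf k₀)).getVert
          ((T.path (S.leaf (f c)) (S.leaf k₀)).length - T.tree.dist c (S.leaf k₀)) := by
      intro c hc
      have hpath := T.isPath_path (S.leaf (f c)) (S.leaf k₀)
      have h1 := T.eq_path (hpath.dropUntil hc)
      have h2 := congrArg SimpleGraph.Walk.length
        ((T.path (S.leaf (f c)) (S.leaf k₀)).take_spec hc)
      rw [SimpleGraph.Walk.length_append, h1, T.length_path c] at h2
      rw [← h2, Nat.add_sub_cancel]
      exact (SimpleGraph.Walk.getVert_length_takeUntil hc).symm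
    rw [key c (hf c), key c' (hf c'), h.1, h.2]
  have := Fintype.card_le_of_injective _ hinj
  simpa using this

end LeafSplitting

lemma Counted.foldlM_ops_le {α β : Type} (f : α → β → Counted α) (l : List β) (a : α) {C : ℕ}
    (h : ∀ a, ∀ b ∈ l, (f a b).ops ≤ C) : (l.foldlM f a).ops ≤ l.length * C := by
  induction l generalizing a with
  | nil => exact Nat.zero_le _
  | cons b l ih =>
    change (f a b).ops + (l.foldlM f (f a b).val).ops ≤ _
    have h1 := h a b (by simp)
    have h2 := ih (f a b).val fun a b hb => h a b (by simp [hb])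
    rw [List.length_cons, Nat.succ_mul]
    omega

namespace LeafSplitting

variable {m n N : ℕ} {P : GraphMOT m n} {T : JunctionTree P.G N} (S : LeafSplitting P T)

lemma card_bag_le (c : Fin N) : (T.bag c).card ≤ T.width + 1 := by
  have : (T.bag c).card ≤ Finset.univ.sup fun c => (T.bag c).card :=
    Finset.le_sup (f := fun c => (T.bag c).card) (Finset.mem_univ c)
  unfold JunctionTree.width
  omega

lemma pow_card_le [NeZero n] {s : Finset (Fin m)} {c : Fin N} (h : s ⊆ T.bag c) :
    n ^ s.card ≤ n ^ (T.width + 1) :=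
  Nat.pow_le_pow_right (Nat.pos_of_neZero n) ((Finset.card_le_card h).trans (card_bag_le c))

lemma pass_ops_le [NeZero n] (s : BPState P T) (c e : Fin N) :
    (pass T s c e).ops ≤ 4 * n ^ (T.width + 1) := by
  have h : (pass T s c e).ops = n ^ (T.bag c).card + ((∑ _z : T.sep c e → Fin n, 1) +
      ((∑ _z : T.sep c e → Fin n, 1) + ((∑ _y : T.bag e → Fin n, 1) + 0))) := by
    rw [← project_ops (t := T.sep c e) Finset.inter_subset_left (s.bel c)]
    rfl
  rw [h]
  simp only [Finset.sum_const, Finset.card_univ, Fintype.card_fun, Fintype.card_fin,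
    Fintype.card_coe, smul_eq_mul, mul_one]
  have h1 := pow_card_le (n := n) (T := T) (c := c) (Finset.Subset.refl _)
  have h2 := pow_card_le (n := n) (T := T) (c := e) (Finset.Subset.refl _)
  have h3 := pow_card_le (n := n) (T := T) (s := T.sep c e) (c := c) Finset.inter_subset_left
  omega

lemma passes_ops_le [NeZero n] (l : List (Fin N × Fin N)) (s : BPState P T) :
    (passes T l s).ops ≤ l.length * (4 * n ^ (T.width + 1)) :=
  Counted.foldlM_ops_le _ l s fun s e _ => pass_ops_le s e.1 e.2

lemma refreshLeaf_ops (s : BPState P T) (k : P.Γ) : (S.refreshLeaf s k).ops = 2 * n := by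
  have h : (S.refreshLeaf s k).ops = (∑ _a : Fin n, (1 + 1)) + 0 := rfl
  rw [h]
  simp [mul_comm]

lemma scale_ops (s : BPState P T) (k : P.Γ) : (S.scale s k).ops = 3 * n := by
  have h : (S.scale s k).ops = (∑ _a : Fin n, 1) + ((∑ _a : Fin n, (1 + 1)) + 0) := rfl
  rw [h]
  simp
  ring

lemma le_pow_width (n : ℕ) (T : JunctionTree P.G N) : n ≤ n ^ (T.width + 1) :=
  Nat.le_self_pow (Nat.succ_ne_zero _) n

lemma init_ops_le [NeZero n] (η : ℝ) (k : P.Γ) :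
    (S.init η k).ops ≤ (7 * N + 2 * P.Γ.card + 3) * n ^ (T.width + 1) := by
  set W := n ^ (T.width + 1) with hW
  have h : (S.init η k).ops = (∑ c : Fin N, ∑ _y : T.bag c → Fin n, (1 + (1 + 1))) +
      (((Finset.univ : Finset P.Γ).toList.foldlM S.refreshLeaf
        { u := fun _ _ => 1, msg := fun _ _ _ => 1,
          bel := fun c y => Real.exp (-(S.clusterCost c y / η)) }).ops +
      ((passes T (T.collectSchedule (S.leaf k)) (S.initialState η)).ops +
        (S.scale (passes T (T.collectSchedule (S.leaf k)) (S.initialState η)).val k).ops)) := by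
    rw [initialState, ← Counted.foldlM_val]
    rfl
  have hn : n ≤ W := le_pow_width n T
  have h1 : (∑ c : Fin N, ∑ _y : T.bag c → Fin n, (1 + (1 + 1))) ≤ 3 * N * W := by
    have : ∀ c ∈ (Finset.univ : Finset (Fin N)),
        ∑ _y : T.bag c → Fin n, (1 + (1 + 1)) ≤ 3 * W := by
      intro c _
      simp only [Finset.sum_const, Finset.card_univ, Fintype.card_fun, Fintype.card_fin,
        Fintype.card_coe, smul_eq_mul]
      have := pow_card_le (n := n) (T := T) (c := c) (Finset.Subset.refl _)
      omega
    refine (Finset.sum_le_sum this).trans (le_of_eq ?_)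
    simp
    ring
  have h2 := Counted.foldlM_ops_le S.refreshLeaf (Finset.univ : Finset P.Γ).toList
    { u := fun _ _ => 1, msg := fun _ _ _ => 1,
      bel := fun c y => Real.exp (-(S.clusterCost c y / η)) }
    fun s k _ => (S.refreshLeaf_ops s k).le
  rw [Finset.length_toList, Finset.card_univ, Fintype.card_coe] at h2
  have h3 := passes_ops_le (T.collectSchedule (S.leaf k)) (S.initialState η)
  have h4 := Nat.mul_le_mul_right (4 * W) (T.length_collectSchedule (S.leaf k))
  have h5 := S.scale_ops (passes T (T.collectSchedule (S.leaf k)) (S.initialState η)).val k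
  have h6 : P.Γ.card * (2 * n) ≤ P.Γ.card * (2 * W) :=
    Nat.mul_le_mul_left _ (Nat.mul_le_mul_left _ hn)
  rw [h, h5]
  nlinarith

lemma step_ops_le [NeZero n] (k k' : P.Γ) (s : BPState P T) :
    (S.step k k' s).ops ≤ (4 * T.tree.diam + 3) * n ^ (T.width + 1) := by
  set W := n ^ (T.width + 1) with hW
  have h : (S.step k k' s).ops = (passes T (T.pathSchedule (S.leaf k) (S.leaf k')) s).ops +
      (S.scale (passes T (T.pathSchedule (S.leaf k) (S.leaf k')) s).val k').ops := rfl
  have hn : n ≤ W := le_pow_width n T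
  have h3 := passes_ops_le (T.pathSchedule (S.leaf k) (S.leaf k')) s
  have h4 := Nat.mul_le_mul_right (4 * W) (T.length_pathSchedule (S.leaf k) (S.leaf k'))
  rw [h, scale_ops]
  nlinarith

lemma run_ops_le [NeZero n] (η : ℝ) (κ : ℕ → P.Γ) (t : ℕ) :
    (S.run η κ t).ops ≤
      (7 * N + 2 * P.Γ.card + 3 + t * (4 * T.tree.diam + 3)) * n ^ (T.width + 1) := by
  induction t with
  | zero => simpa [run] using S.init_ops_le η (κ 0)
  | succ t ih =>
    change (S.run η κ t).ops + (S.step (κ t) (κ (t + 1)) (S.run η κ t).val).ops ≤ _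
    have := S.step_ops_le (κ t) (κ (t + 1)) (S.run η κ t).val
    nlinarith

lemma roundCoordinate_ops_le [NeZero n] {k : Fin m} {c : Fin N} (hk : k ∈ T.bag c)
    (keep dir : Fin n → ℝ) (F : Table n (T.bag c)) :
    (roundCoordinate k hk keep dir F).ops ≤ 5 * n ^ (T.width + 1) := by
  have h : (roundCoordinate k hk keep dir F).ops = (∑ _y : T.bag c → Fin n, 1) +
      ((∑ _y : T.bag c → Fin n, 1) + (n ^ (T.bag c).card + ∑ _y : T.bag c → Fin n, (1 + 1))) := by
    rw [← project_ops (Finset.erase_subset k (T.bag c)) fun y => F y - F y * keep (y ⟨k, hk⟩)]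
    rfl
  rw [h]
  simp only [Finset.sum_const, Finset.card_univ, Fintype.card_fun, Fintype.card_fin,
    Fintype.card_coe, smul_eq_mul, mul_one]
  have h1 := pow_card_le (n := n) (T := T) (c := c) (Finset.Subset.refl _)
  omega

lemma round_ops_le [NeZero n] (s : BPState P T) :
    (S.round s).ops ≤ (6 * P.Γ.card + 5 * N * P.Γ.card) * n ^ (T.width + 1) := by
  set W := n ^ (T.width + 1) with hW
  set p : P.Γ → Fin n → ℝ := fun k a => s.bel (S.leaf k) fun _ => a
  have h : (S.round s).ops = (∑ _k : P.Γ, ∑ _a : Fin n, (1 + 1)) +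
      ((∑ _k : P.Γ, ∑ _a : Fin n, (1 + 1)) + ((∑ _k : P.Γ, (Finset.univ : Finset (Fin n)).card) +
      ((∑ _k : P.Γ, ∑ _a : Fin n, 1) + ∑ c : Fin N,
        ((Finset.univ : Finset P.Γ).toList.foldlM (m := Counted)
          (fun F (k : P.Γ) => if hk : (k : Fin m) ∈ T.bag c
          then roundCoordinate (k : Fin m) hk (keepFactor (p k) (P.μ k)) (refill (p k) (P.μ k)) F
          else pure F) (s.bel c)).ops))) := rfl
  have hn : n ≤ W := le_pow_width n T
  have h1 : ∑ c : Fin N, ((Finset.univ : Finset P.Γ).toList.foldlM (m := Counted)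
          (fun F (k : P.Γ) => if hk : (k : Fin m) ∈ T.bag c
          then roundCoordinate (k : Fin m) hk (keepFactor (p k) (P.μ k)) (refill (p k) (P.μ k)) F
          else pure F) (s.bel c)).ops ≤ N * (P.Γ.card * (5 * W)) := by
    have : ∀ c ∈ (Finset.univ : Finset (Fin N)),
        ((Finset.univ : Finset P.Γ).toList.foldlM (m := Counted)
          (fun F (k : P.Γ) => if hk : (k : Fin m) ∈ T.bag c
          then roundCoordinate (k : Fin m) hk (keepFactor (p k) (P.μ k)) (refill (p k) (P.μ k)) F
          else pure F) (s.bel c)).ops ≤ P.Γ.card * (5 * W) := by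
      intro c _
      refine (Counted.foldlM_ops_le (C := 5 * W) _ _ _ fun F k _ => ?_).trans (le_of_eq ?_)
      · split_ifs with hk
        · exact roundCoordinate_ops_le hk _ _ F
        · exact Nat.zero_le _
      · rw [Finset.length_toList, Finset.card_univ, Fintype.card_coe]
    refine (Finset.sum_le_sum this).trans (le_of_eq ?_)
    simp
  have h2 : P.Γ.card * n ≤ P.Γ.card * W := Nat.mul_le_mul_left _ hn
  rw [h]
  simp only [Finset.sum_const, Finset.card_univ, Fintype.card_fin, Fintype.card_coe, smul_eq_mul,
    mul_one] at h1 ⊢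
  nlinarith

/-- The operation count of the complete method, in terms of the number of iterations. -/
lemma computation_ops_le [NeZero n] (ε : ℝ) (κ : ℕ → P.Γ) (t : ℕ) :
    (S.computation ε κ t).ops ≤
      43 * (T.tree.diam * n ^ (T.width + 1)) * (P.Γ.card ^ 2 + t) := by
  set W := n ^ (T.width + 1) with hW
  set d := T.tree.diam with hd
  set g := P.Γ.card with hg
  have h : (S.computation ε κ t).ops = (S.run (S.eta ε) κ t).ops +
      ((passes T (T.distributeSchedule (S.leaf (κ t))) (S.run (S.eta ε) κ t).val).ops +
        (S.round (passes T (T.distributeSchedule (S.leaf (κ t)))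
          (S.run (S.eta ε) κ t).val).val).ops) := rfl
  have h1 := S.run_ops_le (S.eta ε) κ t
  have h2 := passes_ops_le (T.distributeSchedule (S.leaf (κ t))) (S.run (S.eta ε) κ t).val
  have h3 := Nat.mul_le_mul_right (4 * W) (T.length_distributeSchedule (S.leaf (κ t)))
  have h4 := S.round_ops_le
    (passes T (T.distributeSchedule (S.leaf (κ t))) (S.run (S.eta ε) κ t).val).val
  have h5 : N ≤ g * (d + 1) := card_clusters_le S (κ t)
  have hd1 : 1 ≤ d := by
    have := T.dist_le_diam (S.leaf (κ t)) (S.nbr (κ t))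
    rwa [SimpleGraph.dist_eq_one_iff_adj.2 (S.adj_nbr (κ t))] at this
  have hg1 : 1 ≤ g := Finset.card_pos.2 ⟨_, (κ t).2⟩
  have hN : N ≤ 2 * (g * d) := by nlinarith
  have hgg : g ≤ g ^ 2 := by nlinarith
  have hgd : g * d ≤ g ^ 2 * d := Nat.mul_le_mul_right d hgg
  have hgd' : g ≤ g ^ 2 * d := by nlinarith
  have hNg : N * g ≤ 2 * (g ^ 2 * d) := by nlinarith
  have ht : t ≤ t * d := Nat.le_mul_of_pos_right t hd1
  have hcoef : 7 * N + 2 * g + 3 + t * (4 * d + 3) + 4 * N + (6 * g + 5 * N * g) ≤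
      43 * d * (g ^ 2 + t) := by
    nlinarith
  calc _ ≤ (7 * N + 2 * g + 3 + t * (4 * d + 3) + 4 * N + (6 * g + 5 * N * g)) * W := by
        rw [h]
        nlinarith
    _ ≤ 43 * d * (g ^ 2 + t) * W := Nat.mul_le_mul_right W hcoef
    _ = _ := by ring

end LeafSplitting

/-! ### Random sequences of indices -/

namespace IsRandomPick

variable {Ω : Type*} [MeasurableSpace Ω] {ℙ : Measure Ω} {m : ℕ} {Γ : Finset (Fin m)}
  {κ : ℕ → Ω → Γ}

lemma measurableSet_prefix (h : IsRandomPick ℙ κ) (t : ℕ) (j : ℕ → Γ) :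
    MeasurableSet {ω | ∀ i ≤ t, κ i ω = j i} := by
  simp only [Set.ofPred_forall]
  exact MeasurableSet.iInter fun i => MeasurableSet.iInter fun _ => h.measurable i _

/-- The sequence that starts with the entries of `p` and is constant afterwards. -/
def extend {t : ℕ} (p : Fin (t + 1) → Γ) (i : ℕ) : Γ := p ⟨min i t, by omega⟩

lemma extend_prefix (j : ℕ → Γ) {t i : ℕ} (hi : i ≤ t) :
    extend (fun i : Fin (t + 1) => j i) i = j i := by
  simp [extend, min_eq_left hi]

/-- The paths up to time `t` are the only ones that contribute to an expectation. -/
lemma sum_indicator_prefix {Ω : Type*} {κ : ℕ → Ω → Γ} (t : ℕ) (ω : Ω)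
    (f : (Fin (t + 1) → Γ) → ℝ≥0∞) :
    ∑ p, {ω | ∀ i ≤ t, κ i ω = extend p i}.indicator (fun _ => f p) ω =
      f fun i => κ i ω := by
  classical
  rw [Finset.sum_eq_single fun i : Fin (t + 1) => κ i ω]
  · rw [Set.indicator_of_mem]
    intro i hi
    exact (extend_prefix (fun i => κ i ω) hi).symm
  · intro p _ hp
    rw [Set.indicator_of_notMem]
    intro hmem
    refine hp (funext fun i => ?_)
    have := hmem i (Nat.lt_succ_iff.1 i.2)
    rw [this, extend]
    congr 1
    ext
    simp [Nat.lt_succ_iff.1 i.2]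
  · simp

lemma lintegral_eq_sum (h : IsRandomPick ℙ κ) (t : ℕ) {φ : (ℕ → Γ) → ℝ≥0∞}
    (hφ : ∀ j j', (∀ i ≤ t, j i = j' i) → φ j = φ j') :
    ∫⁻ ω, φ (fun i => κ i ω) ∂ℙ =
      ∑ p : Fin (t + 1) → Γ, φ (extend p) * ℙ {ω | ∀ i ≤ t, κ i ω = extend p i} := by
  have h1 : ∀ ω, φ (fun i => κ i ω) = ∑ p : Fin (t + 1) → Γ,
      {ω | ∀ i ≤ t, κ i ω = extend p i}.indicator (fun _ => φ (extend p)) ω := by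
    intro ω
    rw [sum_indicator_prefix t ω fun p => φ (extend p)]
    exact hφ _ _ fun i hi => (extend_prefix (fun i => κ i ω) hi).symm
  simp only [h1]
  rw [lintegral_finsetSum _ fun p _ => measurable_const.indicator (h.measurableSet_prefix t _)]
  exact Finset.sum_congr rfl fun p _ =>
    lintegral_indicator_const (h.measurableSet_prefix t _) _

/-- A function of the past contracts in mean, if it does so for a uniform choice of the next index
after every given past. -/
lemma lintegral_succ_le (h : IsRandomPick ℙ κ) {t : ℕ} {φ ψ : (ℕ → Γ) → ℝ≥0∞}
    (hφ : ∀ j j', (∀ i ≤ t, j i = j' i) → φ j = φ j')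
    (hψ : ∀ j j', (∀ i ≤ t + 1, j i = j' i) → ψ j = ψ j') {r : ℝ≥0∞}
    (hstep : ∀ j, ∑ k with k ≠ j t, ψ (Function.update j (t + 1) k) *
      ((Γ.card - 1 : ℕ) : ℝ≥0∞)⁻¹ ≤ r * φ j) :
    ∫⁻ ω, ψ (fun i => κ i ω) ∂ℙ ≤ r * ∫⁻ ω, φ (fun i => κ i ω) ∂ℙ := by
  classical
  have hset : ∀ (p : Fin (t + 1) → Γ) (k : Γ),
      {ω | ∀ i ≤ t, κ i ω = extend p i} ∩ {ω | κ (t + 1) ω = k} =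
        {ω | ∀ i ≤ t + 1, κ i ω = Function.update (extend p) (t + 1) k i} := by
    intro p k
    ext ω
    simp only [Set.mem_inter_iff, Set.mem_ofPred_eq]
    constructor
    · rintro ⟨h1, h2⟩ i hi
      rcases Nat.le_succ_iff.1 hi with hi | rfl
      · rw [Function.update_of_ne (by omega), h1 i hi]
      · rw [Function.update_self, h2]
    · intro h1
      refine ⟨fun i hi => ?_, ?_⟩
      · rw [h1 i (by omega), Function.update_of_ne (by omega)]
      · rw [h1 (t + 1) le_rfl, Function.update_self]
  have hlaw : ∀ (p : Fin (t + 1) → Γ) (k : Γ),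
      ℙ ({ω | ∀ i ≤ t, κ i ω = extend p i} ∩ {ω | κ (t + 1) ω = k}) =
        ℙ {ω | ∀ i ≤ t, κ i ω = extend p i} *
          if k = extend p t then 0 else ((Γ.card - 1 : ℕ) : ℝ≥0∞)⁻¹ := by
    intro p k
    rw [hset, h.law, Function.update_self, Function.update_of_ne (by omega)]
    congr 2
    ext ω
    refine forall_congr' fun i => forall_congr' fun hi => ?_
    rw [Function.update_of_ne (by omega)]
  have h1 : ∀ ω, ψ (fun i => κ i ω) = ∑ p : Fin (t + 1) → Γ, ∑ k : Γ,
      ({ω | ∀ i ≤ t, κ i ω = extend p i} ∩ {ω | κ (t + 1) ω = k}).indicator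
        (fun _ => ψ (Function.update (extend p) (t + 1) k)) ω := by
    intro ω
    have h2 : ∀ p : Fin (t + 1) → Γ, ∑ k : Γ,
        ({ω | ∀ i ≤ t, κ i ω = extend p i} ∩ {ω | κ (t + 1) ω = k}).indicator
          (fun _ => ψ (Function.update (extend p) (t + 1) k)) ω =
        {ω | ∀ i ≤ t, κ i ω = extend p i}.indicator
          (fun _ => ψ (Function.update (extend p) (t + 1) (κ (t + 1) ω))) ω := by
      intro p
      rw [Finset.sum_eq_single (κ (t + 1) ω)]
      · simp only [Set.indicator, Set.mem_inter_iff, Set.mem_ofPred_eq, and_true]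
      · intro k _ hk
        rw [Set.indicator_of_notMem]
        exact fun hmem => hk hmem.2.symm
      · simp
    simp only [h2]
    rw [sum_indicator_prefix t ω fun p => ψ (Function.update (extend p) (t + 1) (κ (t + 1) ω))]
    refine hψ _ _ fun i hi => ?_
    rcases Nat.le_succ_iff.1 hi with hi | rfl
    · rw [Function.update_of_ne (by omega), extend_prefix (fun i => κ i ω) hi]
    · rw [Function.update_self]
  have hmeas : ∀ (p : Fin (t + 1) → Γ) (k : Γ),
      MeasurableSet ({ω | ∀ i ≤ t, κ i ω = extend p i} ∩ {ω | κ (t + 1) ω = k}) :=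
    fun p k => (h.measurableSet_prefix t _).inter (h.measurable _ _)
  rw [h.lintegral_eq_sum t hφ]
  simp only [h1]
  rw [lintegral_finsetSum _ fun p _ => Finset.measurable_fun_sum _ fun k _ =>
    measurable_const.indicator (hmeas p k), Finset.mul_sum]
  refine Finset.sum_le_sum fun p _ => ?_
  rw [lintegral_finsetSum _ fun k _ => measurable_const.indicator (hmeas p k), ← mul_assoc]
  refine le_trans (le_of_eq ?_) (mul_le_mul_left (hstep (extend p)) _)
  rw [Finset.sum_filter, Finset.sum_mul]
  refine Finset.sum_congr rfl fun k _ => ?_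
  rw [lintegral_indicator_const (hmeas p k), hlaw]
  by_cases hk : k = extend p t
  · simp [hk]
  · simp only [hk, if_false, ne_eq, not_false_eq_true, if_true]
    ring

/-- With a single index there would be none left to pick. -/
lemma two_le_card [IsProbabilityMeasure ℙ] (h : IsRandomPick ℙ κ) : 2 ≤ Γ.card := by
  by_contra! hcard
  obtain ⟨ω⟩ := ℙ.nonempty_of_neZero
  have hsub : ∀ a b : Γ, a = b := fun a b =>
    Subtype.ext (Finset.card_le_one.1 (show Γ.card ≤ 1 by omega) a.1 a.2 b.1 b.2)
  have := h.law 0 fun _ => κ 0 ω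
  simp [hsub _ (κ 0 ω)] at this

end IsRandomPick

/-! ### The number of iterations -/

/-- One step of the analysis: the concave function `G ↦ G / (G + G₀)` turns the expected decrease of
the gap, which is quadratic in `G + G₀`, into a decrease by a constant. -/
lemma sum_one_add_div_le {ι : Type*} (s : Finset ι) {G G₀ ρ β : ℝ} (hG : 0 ≤ G) (hG₀ : 0 < G₀)
    (hρ : 0 < ρ) (hβ : 0 ≤ β) (hβs : β * (64 * ρ ^ 2 * s.card ^ 2) ≤ G₀) {Gs es : ι → ℝ}
    (hGs : ∀ k ∈ s, 0 ≤ Gs k) (hdec : ∀ k ∈ s, Gs k ≤ G - es k ^ 2 / 4)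
    (he : (G + G₀) / (4 * ρ) ≤ ∑ k ∈ s, es k) :
    ∑ k ∈ s, (1 + Gs k / (Gs k + G₀)) ≤
      s.card * ((1 - β / 2) * (1 + G / (G + G₀))) := by
  have hGG : 0 < G + G₀ := by linarith
  have h1 : ∀ k ∈ s, 1 + Gs k / (Gs k + G₀) ≤
      1 + G / (G + G₀) - G₀ / (G + G₀) ^ 2 * (es k ^ 2 / 4) := by
    intro k hk
    have hk0 := hGs k hk
    have hkk : 0 < Gs k + G₀ := by linarith
    have h2 : Gs k / (Gs k + G₀) - G / (G + G₀) ≤ G₀ / (G + G₀) ^ 2 * (Gs k - G) := by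
      rw [div_sub_div _ _ hkk.ne' hGG.ne', div_mul_eq_mul_div, div_le_div_iff₀ (by positivity)
        (by positivity)]
      have : 0 ≤ G₀ * (G + G₀) * (Gs k - G) ^ 2 := by positivity
      nlinarith
    have h3 : G₀ / (G + G₀) ^ 2 * (Gs k - G) ≤ G₀ / (G + G₀) ^ 2 * (-(es k ^ 2 / 4)) :=
      mul_le_mul_of_nonneg_left (by linarith [hdec k hk]) (by positivity)
    linarith
  have h2 := Finset.sum_le_sum h1
  rw [Finset.sum_sub_distrib, ← Finset.mul_sum, ← Finset.sum_div, Finset.sum_const,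
    nsmul_eq_mul] at h2
  have hcs : (∑ k ∈ s, es k) ^ 2 ≤ s.card * ∑ k ∈ s, es k ^ 2 := sq_sum_le_card_mul_sum_sq
  have he2 : ((G + G₀) / (4 * ρ)) ^ 2 ≤ s.card * ∑ k ∈ s, es k ^ 2 :=
    (pow_le_pow_left₀ (by positivity) he 2).trans hcs
  rcases s.eq_empty_or_nonempty with rfl | hs
  · simp
  have hc : (0 : ℝ) < s.card := by exact_mod_cast hs.card_pos
  have h3 : s.card * β ≤ G₀ / (G + G₀) ^ 2 * ((∑ k ∈ s, es k ^ 2) / 4) := by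
    have h4 : (G + G₀) ^ 2 / (16 * ρ ^ 2 * s.card) ≤ ∑ k ∈ s, es k ^ 2 := by
      rw [div_le_iff₀ (by positivity)]
      have : ((G + G₀) / (4 * ρ)) ^ 2 * (16 * ρ ^ 2) = (G + G₀) ^ 2 := by
        field_simp
        ring
      nlinarith [mul_le_mul_of_nonneg_right he2 (by positivity : (0 : ℝ) ≤ 16 * ρ ^ 2)]
    refine le_trans ?_ (mul_le_mul_of_nonneg_left (div_le_div_of_nonneg_right h4
      (by norm_num : (0 : ℝ) ≤ 4)) (by positivity))
    have : G₀ / (G + G₀) ^ 2 * ((G + G₀) ^ 2 / (16 * ρ ^ 2 * s.card) / 4) =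
        G₀ / (64 * ρ ^ 2 * s.card) := by
      field_simp
      ring
    rw [this, le_div_iff₀ (by positivity)]
    nlinarith
  have h5 : G / (G + G₀) ≤ 1 := (div_le_one hGG).2 (by linarith)
  have h6 : s.card * β * (1 + G / (G + G₀)) ≤ s.card * β * 2 :=
    mul_le_mul_of_nonneg_left (by linarith) (by positivity)
  nlinarith

namespace LeafSplitting

variable {m n N : ℕ} {P : GraphMOT m n} {T : JunctionTree P.G N} (S : LeafSplitting P T)

lemma admissible_run [NeZero n] {η : ℝ} (hη : 0 < η) (κ : ℕ → P.Γ) (t : ℕ) :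
    P.Admissible η (S.R / η) (S.run η κ t).val.u := by
  have hR0 : 0 ≤ S.R / η := div_nonneg S.R_nonneg hη.le
  refine ⟨(S.consistent_run η κ t).u_pos, ?_, ?_⟩
  · induction t with
    | zero =>
      refine (S.isSinkhornUpdate_run_zero η κ).osc (fun _ _ _ => one_pos) hη S.cost_update_le ?_
      intro _ _ _ _ _
      rw [mul_one]
      exact Real.one_le_exp hR0
    | succ t ih =>
      exact (S.isSinkhornUpdate_run_succ η κ t).osc (S.consistent_run η κ t).u_pos hη
        S.cost_update_le ih
  · cases t with
    | zero => exact (S.isSinkhornUpdate_run_zero η κ).mass fun _ _ _ => one_pos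
    | succ t => exact (S.isSinkhornUpdate_run_succ η κ t).mass (S.consistent_run η κ t).u_pos

lemma marginal_run [NeZero n] (η : ℝ) (κ : ℕ → P.Γ) (t : ℕ) (a : Fin n) :
    GraphMOT.marginal (P.scaledTensor η (S.run η κ t).val.u) (κ t) a = P.μ (κ t) a := by
  cases t with
  | zero => exact (S.isSinkhornUpdate_run_zero η κ).marginal_eq (fun _ _ _ => one_pos) a
  | succ t =>
    exact (S.isSinkhornUpdate_run_succ η κ t).marginal_eq (S.consistent_run η κ t).u_pos a

/-- The stopping criterion does not hold up to time `t`. -/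
def Running (ε : ℝ) (κ : ℕ → P.Γ) (t : ℕ) : Prop := ∀ s ≤ t, ¬ S.Converged ε κ s

lemma running_congr {ε : ℝ} {κ κ' : ℕ → P.Γ} {t : ℕ} (h : ∀ i ≤ t, κ i = κ' i) :
    S.Running ε κ t ↔ S.Running ε κ' t := by
  refine forall_congr' fun s => forall_congr' fun hs => ?_
  rw [Converged, Converged, S.run_congr _ fun i hi => h i (hi.trans hs)]

open scoped Classical in
/-- The Lyapunov function of the analysis: a bounded concave function of the gap, as long as the
method is running. -/
noncomputable def lyapunov (ε G₀ : ℝ) (t : ℕ) (κ : ℕ → P.Γ) : ℝ≥0∞ :=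
  if S.Running ε κ t then
    ENNReal.ofReal (1 + P.gap (S.eta ε) (S.R / S.eta ε) (S.run (S.eta ε) κ t).val.u /
      (P.gap (S.eta ε) (S.R / S.eta ε) (S.run (S.eta ε) κ t).val.u + G₀))
  else 0

lemma lyapunov_congr {ε G₀ : ℝ} {t : ℕ} (κ κ' : ℕ → P.Γ) (h : ∀ i ≤ t, κ i = κ' i) :
    S.lyapunov ε G₀ t κ = S.lyapunov ε G₀ t κ' := by
  classical
  rw [lyapunov, lyapunov, S.run_congr _ h]
  exact if_congr (S.running_congr h) rfl rfl

lemma lyapunov_step [NeZero n] {ε : ℝ} (hη : 0 < S.eta ε) (hR : 0 < S.R) (htol : 0 < S.tol ε)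
    (hcard : 2 ≤ P.Γ.card) {β : ℝ} (hβ : β = S.tol ε / (32 * (S.R / S.eta ε) * P.Γ.card ^ 2))
    (hβ1 : β ≤ 1) (t : ℕ) (κ : ℕ → P.Γ) :
    ∑ k with k ≠ κ t, S.lyapunov ε (2 * (S.R / S.eta ε) * S.tol ε) (t + 1)
      (Function.update κ (t + 1) k) * ((P.Γ.card - 1 : ℕ) : ℝ≥0∞)⁻¹ ≤
      ENNReal.ofReal (1 - β / 2) * S.lyapunov ε (2 * (S.R / S.eta ε) * S.tol ε) t κ := by
  classical
  set η := S.eta ε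
  set ρ := S.R / η
  set τ := S.tol ε
  have hρ : 0 < ρ := div_pos hR hη
  have hprefix : ∀ k : P.Γ, ∀ i ≤ t, Function.update κ (t + 1) k i = κ i := fun k i hi =>
    Function.update_of_ne (by omega) _ _
  by_cases hrun : S.Running ε κ t
  swap
  · refine le_trans (le_of_eq (Finset.sum_eq_zero fun k _ => ?_)) (zero_le)
    have : ¬ S.Running ε (Function.update κ (t + 1) k) (t + 1) := fun h =>
      hrun ((S.running_congr (hprefix k)).1 fun s hs => h s (by omega))
    rw [lyapunov, if_neg this, zero_mul]
  set u := (S.run η κ t).val.u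
  set u' : P.Γ → P.Γ → Fin n → ℝ :=
    fun k => (S.run η (Function.update κ (t + 1) k) (t + 1)).val.u
  have hadm := S.admissible_run hη κ t
  have hadm' := fun k => S.admissible_run hη (Function.update κ (t + 1) k) (t + 1)
  have hupd : ∀ k, P.IsSinkhornUpdate η k u (u' k) := by
    intro k
    have := S.isSinkhornUpdate_run_succ η (Function.update κ (t + 1) k) t
    rwa [Function.update_self, S.run_congr η (hprefix k)] at this
  set G := P.gap η ρ u
  set es : P.Γ → ℝ := fun k => ∑ a, |GraphMOT.marginal (P.scaledTensor η u) k a - P.μ k a| with hes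
  set s : Finset P.Γ := Finset.univ.filter fun k => k ≠ κ t with hs
  have hscard : s.card = P.Γ.card - 1 := by
    rw [hs, Finset.filter_ne', Finset.card_erase_of_mem (Finset.mem_univ _), Finset.card_univ,
      Fintype.card_coe]
  have hres : P.residual η u = ∑ k ∈ s, es k := by
    have h0 : es (κ t) = 0 := Finset.sum_eq_zero fun a _ => by
      rw [S.marginal_run, sub_self, abs_zero]
    rw [hs, Finset.filter_ne', show P.residual η u = ∑ k, es k from rfl,
      ← Finset.add_sum_erase _ _ (Finset.mem_univ (κ t)), h0, zero_add]
  have hres1 : τ ≤ ∑ k ∈ s, es k := hres ▸ not_lt.1 (hrun t le_rfl)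
  have hres2 : G ≤ 2 * ρ * ∑ k ∈ s, es k := hres ▸ GraphMOT.gap_le hadm
  have hβ0 : 0 ≤ β := by rw [hβ]; positivity
  have hkey := sum_one_add_div_le s (GraphMOT.gap_nonneg hadm) (by positivity : 0 < 2 * ρ * τ) hρ
    hβ0 (by
      have h1 : (s.card : ℝ) ≤ P.Γ.card := by exact_mod_cast (hscard.le.trans (Nat.sub_le _ _))
      have h2 : (s.card : ℝ) ^ 2 ≤ (P.Γ.card : ℝ) ^ 2 := pow_le_pow_left₀ (by positivity) h1 2
      have h3 : (0 : ℝ) < P.Γ.card := by exact_mod_cast (by omega : 0 < P.Γ.card)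
      calc β * (64 * ρ ^ 2 * s.card ^ 2) ≤ β * (64 * ρ ^ 2 * P.Γ.card ^ 2) :=
            mul_le_mul_of_nonneg_left (mul_le_mul_of_nonneg_left h2 (by positivity)) hβ0
        _ = 2 * ρ * τ := by rw [hβ]; field_simp; norm_num)
    (Gs := fun k => P.gap η ρ (u' k)) (es := es) (fun k _ => GraphMOT.gap_nonneg (hadm' k))
    (fun k _ => by
      have := (hupd k).le_dual hadm.pos hadm.mass
      simp only [GraphMOT.gap, hes]
      linarith)
    (by
      rw [div_le_iff₀ (by positivity)]
      nlinarith)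
  have hc : (0 : ℝ) < s.card := by
    rw [hscard]
    exact_mod_cast (by omega : 0 < P.Γ.card - 1)
  have hle : ∀ k, S.lyapunov ε (2 * ρ * τ) (t + 1) (Function.update κ (t + 1) k) ≤
      ENNReal.ofReal (1 + P.gap η ρ (u' k) / (P.gap η ρ (u' k) + 2 * ρ * τ)) := by
    intro k
    rw [lyapunov]
    split_ifs
    · exact le_rfl
    · exact zero_le
  rw [lyapunov, if_pos hrun, ← Finset.sum_mul, ← hscard,
    ← ENNReal.ofReal_mul (by linarith)]
  calc _ ≤ (∑ k ∈ s, ENNReal.ofReal (1 + P.gap η ρ (u' k) / (P.gap η ρ (u' k) + 2 * ρ * τ))) *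
        ((s.card : ℕ) : ℝ≥0∞)⁻¹ := mul_le_mul_left (Finset.sum_le_sum fun k _ => hle k) _
    _ = ENNReal.ofReal ((∑ k ∈ s, (1 + P.gap η ρ (u' k) / (P.gap η ρ (u' k) + 2 * ρ * τ))) /
        s.card) := by
      rw [ENNReal.ofReal_div_of_pos hc, ENNReal.ofReal_natCast, ENNReal.ofReal_sum_of_nonneg,
        div_eq_mul_inv]
      intro k _
      have := GraphMOT.gap_nonneg (hadm' k)
      positivity
    _ ≤ _ := by
      refine ENNReal.ofReal_le_ofReal ?_
      rw [div_le_iff₀ hc, mul_comm _ (s.card : ℝ)]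
      exact hkey

section Probability

variable {Ω : Type*} [MeasurableSpace Ω] {ℙ : Measure Ω} {κ : ℕ → Ω → P.Γ}

lemma measurableSet_running (hκ : IsRandomPick ℙ κ) (ε : ℝ) (t : ℕ) :
    MeasurableSet {ω | S.Running ε (fun i => κ i ω) t} := by
  have : {ω | S.Running ε (fun i => κ i ω) t} =
      ⋃ p : {p : Fin (t + 1) → P.Γ // S.Running ε (IsRandomPick.extend p) t},
        {ω | ∀ i ≤ t, κ i ω = IsRandomPick.extend p.1 i} := by
    ext ω
    simp only [Set.mem_ofPred_eq, Set.mem_iUnion, Subtype.exists]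
    constructor
    · intro h
      have h1 : ∀ i ≤ t, κ i ω = IsRandomPick.extend (fun i : Fin (t + 1) => κ i ω) i :=
        fun i hi => (IsRandomPick.extend_prefix (fun i => κ i ω) hi).symm
      exact ⟨_, (S.running_congr h1).1 h, h1⟩
    · rintro ⟨p, hp, h1⟩
      exact (S.running_congr h1).2 hp
  rw [this]
  exact MeasurableSet.iUnion fun p => hκ.measurableSet_prefix t _

/-- The number of iterations has an exponential tail. -/
lemma measure_running_le [NeZero n] [IsProbabilityMeasure ℙ] (hκ : IsRandomPick ℙ κ) {ε : ℝ}
    (hη : 0 < S.eta ε) (hR : 0 < S.R) (htol : 0 < S.tol ε) {β : ℝ}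
    (hβ : β = S.tol ε / (32 * (S.R / S.eta ε) * P.Γ.card ^ 2)) (hβ1 : β ≤ 1) (t : ℕ) :
    ℙ {ω | S.Running ε (fun i => κ i ω) t} ≤ ENNReal.ofReal (1 - β / 2) ^ t * 2 := by
  classical
  set G₀ := 2 * (S.R / S.eta ε) * S.tol ε
  have hG₀pos : 0 < G₀ := by positivity
  have h1 : ∀ t, ∫⁻ ω, S.lyapunov ε G₀ t (fun i => κ i ω) ∂ℙ ≤
      ENNReal.ofReal (1 - β / 2) ^ t * 2 := by
    intro t
    induction t with
    | zero =>
      rw [pow_zero, one_mul]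
      calc _ ≤ ∫⁻ _ω, 2 ∂ℙ := by
            refine lintegral_mono fun ω => ?_
            rw [lyapunov]
            split_ifs
            · have hg := GraphMOT.gap_nonneg (S.admissible_run hη (fun i => κ i ω) 0)
              rw [← ENNReal.ofReal_ofNat 2]
              refine ENNReal.ofReal_le_ofReal ?_
              have := div_le_one_of_le₀ (le_add_of_nonneg_right hG₀pos.le) (add_nonneg hg hG₀pos.le)
              linarith
            · exact zero_le
        _ = 2 := by simp
    | succ t ih =>
      refine (hκ.lintegral_succ_le (fun j j' => S.lyapunov_congr j j')
        (fun j j' => S.lyapunov_congr j j')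
        (S.lyapunov_step hη hR htol hκ.two_le_card hβ hβ1 t)).trans ?_
      rw [pow_succ', mul_assoc (ENNReal.ofReal _)]
      exact mul_le_mul_right ih _
  refine le_trans ?_ (h1 t)
  rw [← lintegral_indicator_one (S.measurableSet_running hκ ε t)]
  refine lintegral_mono fun ω => ?_
  by_cases hω : S.Running ε (fun i => κ i ω) t
  · rw [Set.indicator_of_mem (by exact hω), lyapunov, if_pos hω, Pi.one_apply,
      ← ENNReal.ofReal_one]
    have hg := GraphMOT.gap_nonneg (S.admissible_run hη (fun i => κ i ω) t)
    exact ENNReal.ofReal_le_ofReal (le_add_of_nonneg_right (div_nonneg hg (by linarith)))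
  · rw [Set.indicator_of_notMem (by exact hω)]
    exact zero_le

end Probability

end LeafSplitting

/-! ### Correctness and running time -/

namespace LeafSplitting

variable {m n N : ℕ} {P : GraphMOT m n} {T : JunctionTree P.G N} (S : LeafSplitting P T)

lemma not_running_iff {ε : ℝ} {κ : ℕ → P.Γ} {t : ℕ} :
    ¬ S.Running ε κ t ↔ ∃ s ≤ t, S.Converged ε κ s := by
  simp [Running]

/-- When the method stops, its output consists of the cluster marginals of an approximate
solution. -/
lemma finds_of_converged [NeZero n] {ε : ℝ} (hε : 0 < ε) (hη : 0 < S.eta ε) (hR : 0 < S.R)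
    {κ : ℕ → P.Γ} (h : ∃ t, S.Converged ε κ t) : S.Finds ε κ := by
  classical
  have hm : S.eta ε * (m * Real.log n) = ε / 2 := by
    have h0 : m * Real.log n ≠ 0 := by
      intro h0
      rw [eta, mul_assoc, h0] at hη
      simp at hη
    obtain ⟨h1, h2⟩ := mul_ne_zero_iff.1 h0
    rw [eta]
    field_simp
  set t := Nat.find h
  have hconv : S.Converged ε κ t := Nat.find_spec h
  have hadm := S.admissible_run hη κ t
  have : Nonempty P.Γ := ⟨κ 0⟩
  have hres : S.R * P.residual (S.eta ε) (S.run (S.eta ε) κ t).val.u ≤ ε / 8 := by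
    refine (mul_le_mul_of_nonneg_left hconv.le hR.le).trans (le_of_eq ?_)
    rw [tol]
    field_simp
  refine ⟨(S.computation ε κ t).val, _, by rw [output, dif_pos h],
    GraphMOT.isApproxSolution_round hη hadm.pos hadm.mass S.R_nonneg S.cost_update_le
      (by linarith), fun c => ?_⟩
  funext y
  obtain ⟨x, rfl⟩ := restrict_surjective _ y
  rw [clusterMarginal_restrict]
  exact (S.round_val (GraphMOT.scaledTensor_nonneg hadm.pos) hadm.mass
    (fun c x => by rw [S.gbel_distribute]) c x).symm

/-- The number of operations, in terms of the number of iterations. -/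
lemma operations_le_tsum [NeZero n] (ε : ℝ) {κ : ℕ → P.Γ} {K : ℕ} (hK : 0 < K)
    (hops : ∀ t, (S.computation ε κ t).ops ≤ K * (P.Γ.card ^ 2 + t)) :
    S.operations ε κ ≤ K * (P.Γ.card ^ 2 + ∑' t, {t | S.Running ε κ t}.indicator 1 t) := by
  classical
  have hK0 : (K : ℝ≥0∞) ≠ 0 := by exact_mod_cast hK.ne'
  rw [operations]
  split_ifs with h
  · have h1 : (Nat.find h : ℝ≥0∞) ≤ ∑' t, {t | S.Running ε κ t}.indicator (1 : ℕ → ℝ≥0∞) t := by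
      refine le_trans (le_of_eq ?_) (ENNReal.sum_le_tsum (Finset.range (Nat.find h)))
      rw [Finset.sum_congr rfl (g := fun _ => (1 : ℝ≥0∞)) fun t ht => ?_]
      · simp
      · rw [Set.indicator_of_mem, Pi.one_apply]
        intro s hs
        exact Nat.find_min h (lt_of_le_of_lt hs (Finset.mem_range.1 ht))
    calc ((S.computation ε κ (Nat.find h)).ops : ℝ≥0∞) ≤
          ((K * (P.Γ.card ^ 2 + Nat.find h) : ℕ) : ℝ≥0∞) := by exact_mod_cast hops _
      _ = K * (P.Γ.card ^ 2 + (Nat.find h : ℝ≥0∞)) := by push_cast; rfl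
      _ ≤ _ := by gcongr
  · have h1 : ∑' t, {t | S.Running ε κ t}.indicator (1 : ℕ → ℝ≥0∞) t = ⊤ := by
      have : ∀ t, {t | S.Running ε κ t}.indicator (1 : ℕ → ℝ≥0∞) t = 1 := by
        intro t
        rw [Set.indicator_of_mem, Pi.one_apply]
        exact fun s _ hs => h ⟨s, hs⟩
      simp only [this]
      exact ENNReal.tsum_const_eq_top_of_ne_zero one_ne_zero
    rw [h1, add_top, ENNReal.mul_top hK0]

lemma operations_le_of_converged (ε : ℝ) {κ : ℕ → P.Γ} {K t : ℕ}
    (hops : ∀ t, (S.computation ε κ t).ops ≤ K * (P.Γ.card ^ 2 + t))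
    (h : ∃ s ≤ t, S.Converged ε κ s) :
    S.operations ε κ ≤ ((K * (P.Γ.card ^ 2 + t) : ℕ) : ℝ≥0∞) := by
  classical
  obtain ⟨s, hst, hs⟩ := h
  rw [operations, dif_pos ⟨s, hs⟩]
  have h1 : Nat.find ⟨s, hs⟩ ≤ t := (Nat.find_min' _ hs).trans hst
  exact_mod_cast (hops _).trans (Nat.mul_le_mul_left K (Nat.add_le_add_left h1 _))

section Probability

variable {Ω : Type*} [MeasurableSpace Ω] {ℙ : Measure Ω} {κ : ℕ → Ω → P.Γ}

lemma lintegral_operations_le [NeZero n] [IsProbabilityMeasure ℙ] (hκ : IsRandomPick ℙ κ) {ε : ℝ}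
    {K : ℕ} (hK : 0 < K)
    (hops : ∀ κ t, (S.computation ε κ t).ops ≤ K * (P.Γ.card ^ 2 + t)) {β : ℝ} (hβ0 : 0 < β)
    (hβ1 : β ≤ 1) (htail : ∀ t, ℙ {ω | S.Running ε (fun i => κ i ω) t} ≤
      ENNReal.ofReal (1 - β / 2) ^ t * 2) :
    ∫⁻ ω, S.operations ε (fun i => κ i ω) ∂ℙ ≤
      ENNReal.ofReal (K * (P.Γ.card ^ 2 + 4 / β)) := by
  have hsum : ∫⁻ ω, ∑' t, {ω | S.Running ε (fun i => κ i ω) t}.indicator (1 : Ω → ℝ≥0∞) ω ∂ℙ ≤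
      ENNReal.ofReal (4 / β) := by
    rw [lintegral_tsum fun t => (measurable_one.indicator
      (S.measurableSet_running hκ ε t)).aemeasurable]
    calc _ ≤ ∑' t, ENNReal.ofReal (1 - β / 2) ^ t * 2 := by
          refine ENNReal.tsum_le_tsum fun t => ?_
          rw [lintegral_indicator_one (S.measurableSet_running hκ ε t)]
          exact htail t
      _ = ENNReal.ofReal (4 / β) := by
          rw [ENNReal.tsum_mul_right, ENNReal.tsum_geometric, ← ENNReal.ofReal_one,
            ← ENNReal.ofReal_sub _ (by linarith), ← ENNReal.ofReal_inv_of_pos (by linarith),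
            ← ENNReal.ofReal_ofNat 2, ← ENNReal.ofReal_mul (by rw [inv_nonneg]; linarith)]
          rw [sub_sub_cancel]
          congr 1
          field_simp
          norm_num
  calc _ ≤ ∫⁻ ω, K * (P.Γ.card ^ 2 +
        ∑' t, {ω | S.Running ε (fun i => κ i ω) t}.indicator (1 : Ω → ℝ≥0∞) ω) ∂ℙ :=
        lintegral_mono fun ω => S.operations_le_tsum ε hK (hops _)
    _ = K * (P.Γ.card ^ 2 + ∫⁻ ω, ∑' t,
        {ω | S.Running ε (fun i => κ i ω) t}.indicator (1 : Ω → ℝ≥0∞) ω ∂ℙ) := by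
      have hmeas : Measurable fun ω => ∑' t,
          {ω | S.Running ε (fun i => κ i ω) t}.indicator (1 : Ω → ℝ≥0∞) ω :=
        Measurable.tsum fun t =>
          measurable_one.indicator (S.measurableSet_running hκ ε t)
      rw [lintegral_const_mul _ (hmeas.const_add _), lintegral_add_left measurable_const,
        lintegral_const, measure_univ, mul_one]
    _ ≤ K * (P.Γ.card ^ 2 + ENNReal.ofReal (4 / β)) := by gcongr
    _ = _ := by
      rw [ENNReal.ofReal_mul (by positivity), ENNReal.ofReal_add (by positivity) (by positivity),
        ENNReal.ofReal_natCast, ENNReal.ofReal_pow (by positivity), ENNReal.ofReal_natCast]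

lemma le_measure_not_running [IsProbabilityMeasure ℙ] (hκ : IsRandomPick ℙ κ) {ε : ℝ}
    {β : ℝ} (hβ0 : 0 < β) (hβ1 : β ≤ 1) {t : ℕ}
    (htail : ℙ {ω | S.Running ε (fun i => κ i ω) t} ≤ ENNReal.ofReal (1 - β / 2) ^ t * 2)
    {δ : ℝ} (hδ0 : 0 < δ) (hδ : δ < 1 / 2) (ht : 4 / β * Real.log (1 / δ) ≤ t) :
    ENNReal.ofReal (1 - δ) ≤ ℙ {ω | S.Running ε (fun i => κ i ω) t}ᶜ := by
  rw [prob_compl_eq_one_sub (S.measurableSet_running hκ ε t), ENNReal.ofReal_sub _ hδ0.le,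
    ENNReal.ofReal_one]
  refine tsub_le_tsub_left (htail.trans ?_) 1
  rw [← ENNReal.ofReal_pow (by linarith), ← ENNReal.ofReal_ofNat 2,
    ← ENNReal.ofReal_mul (pow_nonneg (by linarith) t)]
  refine ENNReal.ofReal_le_ofReal ?_
  have h1 : (1 - β / 2) ^ t ≤ Real.exp (-(β / 2)) ^ t :=
    pow_le_pow_left₀ (by linarith) (by linarith [Real.add_one_le_exp (-(β / 2))]) t
  have h2 : Real.exp (-(β / 2)) ^ t ≤ δ ^ 2 := by
    rw [← Real.exp_nat_mul, ← Real.exp_log (pow_pos hδ0 2), Real.exp_le_exp, Real.log_pow]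
    rw [one_div, Real.log_inv, div_mul_eq_mul_div, div_le_iff₀ hβ0] at ht
    push_cast
    linarith
  nlinarith

end Probability

end LeafSplitting

theorem mainTheorem4 : ∃ c : ℝ, 0 < c ∧
    ∀ (m n N : ℕ) (P : GraphMOT m n) (T : JunctionTree P.G N) (S : LeafSplitting P T) (ε : ℝ),
      T.width = treewidth P.G → 0 < ε → ε ^ 2 ≤ m * S.R ^ 2 * Real.log n →
      ∀ (Ω : Type*) [MeasurableSpace Ω] (ℙ : Measure Ω) [IsProbabilityMeasure ℙ]
        (κ : ℕ → Ω → P.Γ), IsRandomPick ℙ κ →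
        (∀ᵐ ω ∂ℙ, S.Finds ε fun t => κ t ω) ∧
        (∫⁻ ω, S.operations ε (fun t => κ t ω) ∂ℙ) ≤
          ENNReal.ofReal (c * (T.tree.diam * m * P.Γ.card ^ 2 * n ^ (treewidth P.G + 1) * S.R ^ 2 *
            Real.log n / ε ^ 2)) ∧
        ∀ δ : ℝ, 0 < δ → δ < 1 / 2 →
          ENNReal.ofReal (1 - δ) ≤ ℙ {ω | S.operations ε (fun t => κ t ω) ≤
            ENNReal.ofReal (c * (T.tree.diam * m * P.Γ.card ^ 2 * n ^ (treewidth P.G + 1) *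
              S.R ^ 2 * Real.log n * Real.log (1 / δ) / ε ^ 2))} := by
  refine ⟨90000, by norm_num, ?_⟩
  intro m n N P T S ε hw hε hle Ω _ ℙ _ κ hκ
  rw [← hw]
  have hpos : 0 < m * S.R ^ 2 * Real.log n := (pow_pos hε 2).trans_le hle
  have hR : 0 < S.R := S.R_nonneg.lt_of_ne' fun h0 => by simp [h0] at hpos
  have hlog : 0 < Real.log n :=
    (Real.log_natCast_nonneg n).lt_of_ne' fun h0 => by simp [h0] at hpos
  have hm : (0 : ℝ) < m := (Nat.cast_nonneg m).lt_of_ne' fun h0 => by simp [h0] at hpos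
  have : NeZero n := ⟨fun h0 => by simp [h0] at hlog⟩
  have hη : 0 < S.eta ε := by
    rw [LeafSplitting.eta]
    positivity
  have htol : 0 < S.tol ε := by
    rw [LeafSplitting.tol]
    positivity
  set g := P.Γ.card with hg
  have hg2 : 2 ≤ g := hκ.two_le_card
  have hg0 : (0 : ℝ) < g := by exact_mod_cast (by omega : 0 < g)
  have hg1 : (1 : ℝ) ≤ g := by exact_mod_cast (by omega : 1 ≤ g)
  set M : ℝ := m * S.R ^ 2 * Real.log n / ε ^ 2 with hM
  have hM1 : 1 ≤ M := (one_le_div (by positivity)).2 hle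
  have hgM : (1 : ℝ) ≤ g ^ 2 * M := by nlinarith
  have hgM' : (g : ℝ) ^ 2 ≤ g ^ 2 * M := le_mul_of_one_le_right (by positivity) hM1
  obtain ⟨β, hβ⟩ : ∃ β : ℝ, β = S.tol ε / (32 * (S.R / S.eta ε) * g ^ 2) := ⟨_, rfl⟩
  have hβ0 : 0 < β := by rw [hβ]; positivity
  have hβinv : β⁻¹ = 512 * (g ^ 2 * M) := by
    rw [hβ, hM, LeafSplitting.tol, LeafSplitting.eta]
    field_simp
    norm_num
  have hβ1 : β ≤ 1 := by
    rw [← inv_inv β, hβinv]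
    exact inv_le_one_of_one_le₀ (by linarith)
  have htail := S.measure_running_le hκ hη hR htol hβ hβ1
  set K : ℕ := 43 * (T.tree.diam * n ^ (T.width + 1)) with hK
  have hops : ∀ κ t, (S.computation ε κ t).ops ≤ K * (P.Γ.card ^ 2 + t) := S.computation_ops_le ε
  obtain ⟨ω₀⟩ := ℙ.nonempty_of_neZero
  have hd : 0 < T.tree.diam := by
    have h1 := T.dist_le_diam (S.leaf (κ 0 ω₀)) (S.nbr (κ 0 ω₀))
    rwa [SimpleGraph.dist_eq_one_iff_adj.2 (S.adj_nbr _)] at h1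
  have hn0 : 0 < n := Nat.pos_of_neZero n
  have hK0 : 0 < K := by positivity
  have hKr : (K : ℝ) = 43 * (T.tree.diam * n ^ (T.width + 1)) := by rw [hK]; push_cast; rfl
  refine ⟨?_, ?_, ?_⟩
  · have hzero : ℙ {ω | ∀ t, S.Running ε (fun i => κ i ω) t} = 0 := by
      have hlim : Filter.Tendsto (fun t : ℕ => ENNReal.ofReal (1 - β / 2) ^ t * 2) Filter.atTop
          (nhds (0 * 2)) := ENNReal.Tendsto.mul_const
        (ENNReal.tendsto_pow_atTop_nhds_zero_of_lt_one (by
          rw [ENNReal.ofReal_lt_one]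
          linarith)) (Or.inr (by simp))
      rw [zero_mul] at hlim
      exact le_antisymm (ge_of_tendsto' hlim fun t =>
        (measure_mono (Set.ofPred_subset_ofPred.2 fun ω hω => hω t)).trans (htail t)) zero_le
    have hae : ∀ᵐ ω ∂ℙ, ¬ ∀ t, S.Running ε (fun i => κ i ω) t := by
      rw [ae_iff]
      simpa using hzero
    filter_upwards [hae] with ω hω
    push Not at hω
    obtain ⟨t, ht⟩ := hω
    obtain ⟨s, -, hs⟩ := S.not_running_iff.1 ht
    exact S.finds_of_converged hε hη hR ⟨s, hs⟩
  · refine (S.lintegral_operations_le hκ hK0 hops hβ0 hβ1 htail).trans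
      (ENNReal.ofReal_le_ofReal ?_)
    have h1 : (90000 : ℝ) * (T.tree.diam * m * g ^ 2 * n ^ (T.width + 1) * S.R ^ 2 *
        Real.log n / ε ^ 2) = 90000 * (T.tree.diam * n ^ (T.width + 1)) * (g ^ 2 * M) := by
      rw [hM]
      ring
    rw [h1, hKr, div_eq_mul_inv, hβinv]
    have h2 : (0 : ℝ) ≤ T.tree.diam * n ^ (T.width + 1) := by positivity
    nlinarith [mul_le_mul_of_nonneg_left hgM' h2, mul_nonneg h2 (by linarith : 0 ≤ g ^ 2 * M)]
  · intro δ hδ0 hδ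
    set L := Real.log (1 / δ)
    have hL1 : 1 / 2 ≤ L := by
      have h1 : Real.log 2 ≤ L := Real.log_le_log (by norm_num) (by
        rw [le_div_iff₀ hδ0]
        linarith)
      linarith [Real.log_two_gt_d9]
    set t := ⌈4 / β * L⌉₊ with ht
    have ht1 : 4 / β * L ≤ t := Nat.le_ceil _
    have ht2 : (t : ℝ) < 4 / β * L + 1 := Nat.ceil_lt_add_one (by positivity)
    refine (S.le_measure_not_running hκ hβ0 hβ1 (htail t) hδ0 hδ ht1).trans
      (measure_mono fun ω hω => ?_)
    refine (S.operations_le_of_converged ε (hops _) (S.not_running_iff.1 hω)).trans ?_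
    rw [← ENNReal.ofReal_natCast]
    refine ENNReal.ofReal_le_ofReal ?_
    have h1 : (90000 : ℝ) * (T.tree.diam * m * g ^ 2 * n ^ (T.width + 1) * S.R ^ 2 *
        Real.log n * L / ε ^ 2) = 90000 * (T.tree.diam * n ^ (T.width + 1)) * (g ^ 2 * M * L) := by
      rw [hM]
      ring
    have h2 : (0 : ℝ) ≤ T.tree.diam * n ^ (T.width + 1) := by positivity
    have h3 : (g : ℝ) ^ 2 + t ≤ 2052 * (g ^ 2 * M * L) := by
      rw [div_eq_mul_inv, hβinv] at ht2
      nlinarith [mul_le_mul_of_nonneg_left hL1 (by linarith : (0 : ℝ) ≤ g ^ 2 * M)]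
    rw [h1]
    push_cast
    rw [hKr, ← hg]
    nlinarith [mul_le_mul_of_nonneg_left h3 h2, mul_nonneg h2 (by positivity : 0 ≤ g ^ 2 * M * L)]
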